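/- **Setting.** Let $n,d\ge 1$. A *weight* on $\mathbb R^d$ is a locally integrable, a.e. positive function; $\sigma(E)=\int_E\sigma$. $\mathcal Q$ is the set of non-degenerate cubes with sides parallel to the axes. For $0\le\alpha<nd$ put $$\mathcal M_\alpha(f_1,\dots,f_n)(x)=\sup_{Q\in\mathcal Q}|Q|^{\alpha/d}\prod_{i=1}^n\frac{\chi_Q(x)}{|Q|}\int_Q|f_i|,$$ and let $\mathcal M$ be the case $n=1$, $\alpha=0$. A *growth function* is a continuous nondecreasing map $\Phi$ of $\mathbb R_+=[0,\infty)$ onto itself. $\Phi\in\Delta_2$ means $\Phi(2t)\le K\Phi(t)$ for $t>0$; $\Phi\in\Delta'$ means $\Phi(st)\le C\Phi(s)\Phi(t)$ for $s,t>0$. $\Phi\in\nabla_2$ means that $\Phi$ is a convex growth function in $\Delta_2$ with $\int_0^t\Phi(s)s^{-2}ds\le C\Phi(t)/t$ for all $t>0$. $\Phi\in\widetilde{\mathscr U}$ means that $\Phi$ is a growth function in $\Delta'$ with $\Phi(t)/t$ nondecreasing on $(0,\infty)$ and that, for some $q\ge1$ and $C>0$, $\Phi(st)\le Ct^q\Phi(s)$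 for $s>0,\ t\ge1$, and $\Phi(s/t)\le C\Phi(s)t^{-q}$ for $s,t\ge1$. Every $\Phi\in\widetilde{\mathscr U}$ is a bijection of $\mathbb R_+$. Further, $$\|f\|_{L^\Phi_\sigma}^{lux}=\inf\Big\{\lambda>0:\int_{\mathbb R^d}\Phi\big(|f|/\lambda\big)\sigma\,dx\le1\Big\},$$ and $L^\Phi(\sigma)$ is the space of measurable $f:\mathbb R^d\to\mathbb C$ for which this is finite. Let $\Phi_1,\dots,\Phi_n\in\widetilde{\mathscr U}\cap\nabla_2$, $\Psi\in\widetilde{\mathscr U}$, and let $\Phi$ be a bijection of $\mathbb R_+$ onto itself with $\Phi^{-1}=\Phi_1^{-1}\cdots\Phi_n^{-1}$ (pointwise product) and $t\mapsto\Psi(t)/\Phi(t)$ nondecreasing on $(0,\infty)$. Let $\varphi_i(s)=\sup_{t\ge0}\{st-\Phi_i(t)\}$ be the complementary function of $\Phi_i$. For weights $\sigma_1,\dots,\sigma_n,\omega$ put $\nu=1/\Phi\big(\prod_i\Phi_i^{-1}(1/\sigma_i)\big)$ and $$[\vec\sigma,\omega]_{A}=\sup_{Q\in\mathcal Q}\omega(Q)\,\Psi\Big(\prod_i\tfrac{\sigma_i(Q)}{|Q|^{1-\alpha/(nd)}}\Big)\Psi\Big(\prod_i\Phi_i^{-1}\big(\tfrac1{\sigma_i(Q)}\big)\Big),$$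 $$[\vec\sigma,\omega]_{B}=\sup_{Q\in\mathcal Q}\omega(Q)\,\Psi\Big(\prod_i\tfrac{\sigma_i(Q)}{|Q|^{1-\alpha/(nd)}}\Big)\Psi\Big(\prod_i\Phi_i^{-1}\Big(\tfrac1{|Q|}\exp\Big(\tfrac1{|Q|}\int_Q\log\tfrac1{\sigma_i}\Big)\Big)\Big),$$ $$[\vec\sigma,\omega]_{\widetilde A}=\sup_{Q\in\mathcal Q}\frac{\omega(Q)}{|Q|}\,\Psi\Big(|Q|^{\alpha/d}\prod_i\varphi_i^{-1}\big(\tfrac{\sigma_i(Q)}{|Q|}\big)\Big),\qquad [\sigma]_{\mathcal A_\infty}=\sup_{Q\in\mathcal Q}\frac1{\sigma(Q)}\int_Q\mathcal M(\sigma\chi_Q)\,dx,$$ $$[\vec\sigma]_{W}=\sup_{Q\in\mathcal Q}\Psi\circ\Phi^{-1}\Big(\frac1{\nu(Q)}\Big)\int_Q\Psi\Big(\prod_i\Phi_i^{-1}\big(\mathcal M(\sigma_i\chi_Q)(x)\big)\Big)dx.$$ **Theorem.** There are constants $C_1,C_2,C_3>0$, depending only on $n,d,\Psi,\Phi_1,\dots,\Phi_n$,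 such that for all $0\le\alpha<nd$, all weights $\sigma_1,\dots,\sigma_n,\omega$ and all $f_i\in L^{\Phi_i}(\sigma_i)$, $1\le i\le n$: (i) if $[\vec\sigma,\omega]_B<\infty$, then $$\|\mathcal M_\alpha(\sigma_1f_1,\dots,\sigma_nf_n)\|^{lux}_{L^\Psi_\omega}\le C_1\,\Psi^{-1}\big([\vec\sigma,\omega]_B\big)\prod_{i=1}^n\|f_i\|^{lux}_{L^{\Phi_i}_{\sigma_i}};$$ (ii) if $[\vec\sigma,\omega]_A<\infty$ and $[\sigma_i]_{\mathcal A_\infty}<\infty$ for all $i$, then $$\|\mathcal M_\alpha(\sigma_1f_1,\dots,\sigma_nf_n)\|^{lux}_{L^\Psi_\omega}\le C_2\,\Psi^{-1}\Big([\vec\sigma,\omega]_A\sum_{i=1}^n\Psi\circ\Phi^{-1}\big([\sigma_i]_{\mathcal A_\infty}\big)\Big)\prod_{i=1}^n\|f_i\|^{lux}_{L^{\Phi_i}_{\sigma_i}};$$ (iii) if $[\vec\sigma,\omega]_{\widetilde A}<\infty$ and $[\vec\sigma]_W<\infty$, then $$\|\mathcal M_\alpha(\sigma_1f_1,\dots,\sigma_nf_n)\|^{lux}_{L^\Psi_\omega}\le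 C_3\,\Psi^{-1}\big([\vec\sigma]_W\,[\vec\sigma,\omega]_{\widetilde A}\big)\prod_{i=1}^n\|f_i\|^{lux}_{L^{\Phi_i}_{\sigma_i}}.$$ -/

import Mathlib

open MeasureTheory Set
open scoped NNReal ENNReal

noncomputable section

namespace OrliczMax

/-! ### Growth functions -/

/-- A growth function: a continuous, nondecreasing map of `[0, ∞)` onto itself. -/
structure IsGrowth (Φ : ℝ≥0 → ℝ≥0) : Prop where
  continuous : Continuous Φ
  monotone : Monotone Φ
  surjective : Function.Surjective Φ

/-- The condition `Δ₂`. -/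
def Delta2 (Φ : ℝ≥0 → ℝ≥0) : Prop :=
  ∃ K : ℝ≥0, 0 < K ∧ ∀ t : ℝ≥0, 0 < t → Φ (2 * t) ≤ K * Φ t

/-- The condition `Δ'`. -/
def DeltaPrime (Φ : ℝ≥0 → ℝ≥0) : Prop :=
  ∃ C : ℝ≥0, 0 < C ∧ ∀ s t : ℝ≥0, 0 < s → 0 < t → Φ (s * t) ≤ C * Φ s * Φ t

/-- The condition `∇₂`, a property of convex growth functions in `Δ₂`. The integral takes the
value `∞` when it diverges. -/
structure Nabla2 (Φ : ℝ≥0 → ℝ≥0) : Prop where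
  growth : IsGrowth Φ
  convex : ConvexOn ℝ≥0 Set.univ Φ
  delta2 : Delta2 Φ
  integral_le : ∃ C : ℝ≥0, 0 < C ∧ ∀ t : ℝ≥0, 0 < t →
    ∫⁻ s in Set.Ioc (0 : ℝ) t, ((Φ s.toNNReal / s.toNNReal ^ 2 : ℝ≥0) : ℝ≥0∞)
      ≤ ((C * (Φ t / t) : ℝ≥0) : ℝ≥0∞)

/-- `Φ` is of upper type `q`. -/
def UpperType (q : ℝ) (Φ : ℝ≥0 → ℝ≥0) : Prop :=
  ∃ C : ℝ≥0, 0 < C ∧ ∀ s t : ℝ≥0, 0 < s → 1 ≤ t → Φ (s * t) ≤ C * t ^ q * Φ s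

/-- The class `𝒰^q`. -/
structure ClassU (q : ℝ) (Φ : ℝ≥0 → ℝ≥0) : Prop where
  growth : IsGrowth Φ
  one_le : 1 ≤ q
  upperType : UpperType q Φ
  monotone_div : MonotoneOn (fun t => Φ t / t) (Set.Ioi 0)

/-- The class `𝒰̃^q`. -/
structure ClassUTildeExp (q : ℝ) (Φ : ℝ≥0 → ℝ≥0) : Prop where
  deltaPrime : DeltaPrime Φ
  classU : ClassU q Φ
  div_le : ∃ C : ℝ≥0, 0 < C ∧ ∀ s t : ℝ≥0, 1 ≤ s → 1 ≤ t → Φ (s / t) ≤ C * (Φ s / t ^ q)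

/-- The class `𝒰̃`, the union of the classes `𝒰̃^q` over `q ≥ 1`. -/
def ClassUTilde (Φ : ℝ≥0 → ℝ≥0) : Prop := ∃ q : ℝ, 1 ≤ q ∧ ClassUTildeExp q Φ

/-- The inverse of a bijection of `[0, ∞)`. -/
def inv (Φ : ℝ≥0 → ℝ≥0) : ℝ≥0 → ℝ≥0 := Function.invFun Φ

/-- The extension of a function on `[0, ∞)` to `[0, ∞]` with value `∞` at `∞`. -/
def ext (Φ : ℝ≥0 → ℝ≥0) (t : ℝ≥0∞) : ℝ≥0∞ := if t = ∞ then ∞ else (Φ t.toNNReal : ℝ≥0∞)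

/-- The complementary function `s ↦ sup_{t ≥ 0} (s t - Φ t)`. As `Φ 0 = 0`, the supremum
is not changed by truncating the differences at `0`; it is finite for every `s` as soon as
`Φ t / t → ∞`, which holds for all functions that satisfy `∇₂`. -/
def complementary (Φ : ℝ≥0 → ℝ≥0) (s : ℝ≥0) : ℝ≥0 := ⨆ t : ℝ≥0, (s * t - Φ t)

/-! ### Cubes, weights, Luxemburg norms -/

variable {d n : ℕ}

/-- Non-degenerate cubes with sides parallel to the axes. -/
def cubes (d : ℕ) : Set (Set (Fin d → ℝ)) :=
  {Q | ∃ (a : Fin d → ℝ) (l : ℝ), 0 < l ∧ Q = Set.Icc a (fun i => a i + l)}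

/-- A weight: a locally integrable, almost everywhere positive function. -/
structure IsWeight (σ : (Fin d → ℝ) → ℝ) : Prop where
  locallyIntegrable : LocallyIntegrable σ volume
  pos : ∀ᵐ x, 0 < σ x

/-- `σ(E) = ∫_E σ`. -/
def mass (σ : (Fin d → ℝ) → ℝ) (E : Set (Fin d → ℝ)) : ℝ≥0∞ :=
  ∫⁻ x in E, ENNReal.ofReal (σ x)

/-- The Luxemburg norm in `L^Φ(σ)` of a function with absolute value `‖f‖ₑ`; it is `∞` if no
`r` is admissible. -/
def luxNorm {E : Type*} [ENorm E] (Φ : ℝ≥0 → ℝ≥0) (σ : (Fin d → ℝ) → ℝ)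
    (f : (Fin d → ℝ) → E) : ℝ≥0∞ :=
  ⨅ (r : ℝ≥0) (_ : 0 < r)
    (_ : ∫⁻ x, ext Φ (‖f x‖ₑ / (r : ℝ≥0∞)) * ENNReal.ofReal (σ x) ≤ 1), (r : ℝ≥0∞)

/-- `f ∈ L^Φ(σ)`. -/
def MemOrlicz (Φ : ℝ≥0 → ℝ≥0) (σ : (Fin d → ℝ) → ℝ) (f : (Fin d → ℝ) → ℂ) : Prop :=
  AEStronglyMeasurable f volume ∧ luxNorm Φ σ f < ∞

/-! ### Maximal functions -/

/-- The multilinear fractional maximal function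
`sup_{Q ∋ x} |Q|^{α/d} ∏ᵢ |Q|⁻¹ ∫_Q |fᵢ|`. -/
def fracMax {E : Type*} [ENorm E] (α : ℝ) (f : Fin n → (Fin d → ℝ) → E) (x : Fin d → ℝ) :
    ℝ≥0∞ :=
  ⨆ Q ∈ cubes d, Q.indicator
    (fun _ => volume Q ^ (α / d) * ∏ i, (∫⁻ y in Q, ‖f i y‖ₑ) / volume Q) x

/-- The Hardy–Littlewood maximal function. -/
def hlMax {E : Type*} [ENorm E] (f : (Fin d → ℝ) → E) : (Fin d → ℝ) → ℝ≥0∞ :=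
  fracMax 0 (fun _ : Fin 1 => f)

/-! ### Weight constants -/

open Classical in
/-- `exp (|Q|⁻¹ ∫_Q log (1/σ))`. For a weight, the positive part of `log σ` is integrable on `Q`,
so the mean of `log (1/σ)` is `+∞` if `log (1/σ)` is not integrable on `Q`. -/
def expMeanLogInv (σ : (Fin d → ℝ) → ℝ) (Q : Set (Fin d → ℝ)) : ℝ≥0∞ :=
  if IntegrableOn (fun x => Real.log (1 / σ x)) Q volume then
    ENNReal.ofReal (Real.exp (⨍ x in Q, Real.log (1 / σ x)))
  else ∞

/-- The function `1 / Φ (∏ᵢ Φᵢ⁻¹ (1 / σᵢ))`. -/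
def nu (Φ : ℝ≥0 → ℝ≥0) (Φs : Fin n → ℝ≥0 → ℝ≥0) (σ : Fin n → (Fin d → ℝ) → ℝ)
    (x : Fin d → ℝ) : ℝ≥0 :=
  (Φ (∏ i, inv (Φs i) ((σ i x).toNNReal)⁻¹))⁻¹

/-- The constant of the class `A^α`. -/
def constA (α : ℝ) (Φs : Fin n → ℝ≥0 → ℝ≥0) (Ψ : ℝ≥0 → ℝ≥0)
    (σ : Fin n → (Fin d → ℝ) → ℝ) (ω : (Fin d → ℝ) → ℝ) : ℝ≥0∞ :=
  ⨆ Q ∈ cubes d, mass ω Q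
    * ext Ψ (∏ i, mass (σ i) Q / volume Q ^ (1 - α / (n * d)))
    * ext Ψ (∏ i, ext (inv (Φs i)) (mass (σ i) Q)⁻¹)

/-- The constant of the class `Ã^α`. -/
def constATilde (α : ℝ) (Φs : Fin n → ℝ≥0 → ℝ≥0) (Ψ : ℝ≥0 → ℝ≥0)
    (σ : Fin n → (Fin d → ℝ) → ℝ) (ω : (Fin d → ℝ) → ℝ) : ℝ≥0∞ :=
  ⨆ Q ∈ cubes d, (mass ω Q / volume Q)
    * ext Ψ (volume Q ^ (α / d) * ∏ i, ext (inv (Φs i)) (mass (σ i) Q / volume Q))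

/-- The constant of the class `B^α`. -/
def constB (α : ℝ) (Φs : Fin n → ℝ≥0 → ℝ≥0) (Ψ : ℝ≥0 → ℝ≥0)
    (σ : Fin n → (Fin d → ℝ) → ℝ) (ω : (Fin d → ℝ) → ℝ) : ℝ≥0∞ :=
  ⨆ Q ∈ cubes d, mass ω Q
    * ext Ψ (∏ i, mass (σ i) Q / volume Q ^ (1 - α / (n * d)))
    * ext Ψ (∏ i, ext (inv (Φs i)) ((volume Q)⁻¹ * expMeanLogInv (σ i) Q))

/-- The Fujii–Wilson `A_∞` constant. -/
def constAInfty (σ : (Fin d → ℝ) → ℝ) : ℝ≥0∞ :=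
  ⨆ Q ∈ cubes d, (mass σ Q)⁻¹ * ∫⁻ x in Q, hlMax (Q.indicator σ) x

/-- The constant of the class `W`. -/
def constW (Φ : ℝ≥0 → ℝ≥0) (Φs : Fin n → ℝ≥0 → ℝ≥0) (Ψ : ℝ≥0 → ℝ≥0)
    (σ : Fin n → (Fin d → ℝ) → ℝ) : ℝ≥0∞ :=
  ⨆ Q ∈ cubes d, ext Ψ (ext (inv Φ) (∫⁻ x in Q, (nu Φ Φs σ x : ℝ≥0∞))⁻¹)
    * ∫⁻ x in Q, ext Ψ (∏ i, ext (inv (Φs i)) (hlMax (Q.indicator (σ i)) x))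

end OrliczMax

end

open OrliczMax

/-!
The growth conditions leave only powers, up to constants. If `Φ` is of upper type `q` and
`Φ (s / t) ≤ C Φ(s) t ^ (-q)` for `s, t ≥ 1`, then taking `s = 1` and `s = t` gives `Φ(t) ≈ t ^ q`
(`ClassUTildeExp.exists_powerLike`). Hence `Φᵢ(t) ≈ t ^ pᵢ`, where `pᵢ > 1` by the condition `∇₂`,
`Ψ(t) ≈ t ^ q`, and `Φ(t) ≈ t ^ p` with `1 / p = ∑ᵢ 1 / pᵢ`; the monotonicity of `Ψ / Φ` means
`p ≤ q`. Luxemburg norms become `L^p` norms and all constants become power-type constants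
(`exists_powerGrowth`, `PowerGrowth.exists_luxNorm_bound`).

It remains to bound `∫ 𝓜_α(σ₁f₁, …, σₙfₙ) ^ q dω`. Every cube lies in a comparable cube of one of
`2 ^ d` grids, so that by monotone convergence it suffices to bound maximal functions over finite
families of grid cubes, with constants independent of the family (`lintegral_fracMax_rpow_le`). In
such a family the principal cubes, along which the values grow by more than the factor `2 ^ n`, are
sparse (`exists_sparse_lintegral_maxOver_le`), and the integral is at most a multiple of
`∑_Q ω(Q) v(Q) ^ q` over them, where
`v(Q) = |Q| ^ (α / d - n) ∏ᵢ σᵢ(Q) · ∏ᵢ ⟨fᵢ⟩_Q` and `⟨fᵢ⟩_Q` is the average with respect to `σᵢ`.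

For (i) and (ii) the weight constant bounds `ω(Q) (|Q| ^ (α / d - n) ∏ᵢ σᵢ(Q)) ^ q` by
`∏ᵢ cᵢ(Q) ^ (q / pᵢ)`, where `cᵢ(Q)` is `|Q|` times the geometric mean of `σᵢ`, or `σᵢ(Q)`. Both
are Carleson sequences with respect to `σᵢ`: for the first, the geometric mean is at most
`(|Q|⁻¹ ∫_Q σᵢ ^ (1 / 2)) ^ 2`, to which the maximal inequality in `L²` applies; for the second,
this is the Fujii–Wilson condition. Since `p ≤ q`, Hölder's inequality for sums separates the
indices `i`, and the Carleson embedding and the maximal inequality in `L^{pᵢ}(σᵢ)` finish the proof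
(`PowerSetting.lintegral_le_of_prod_carleson`). For (iii) the sequence is
`|Q| ∏ᵢ (σᵢ(Q) / |Q|) ^ (q / pᵢ)`; by the `W` condition its sums over the cubes in `R` are at most a
multiple of `κ(R) ^ (q / p)`, where `κ` has the density `∏ᵢ σᵢ ^ (p / pᵢ)`, which dominates `ν` up
to a constant. The embedding for the products of averages (`sum_mul_rpow_le_of_carleson`) is
followed by Hölder's inequality (`PowerSetting.lintegral_le_of_carleson`).
-/

noncomputable section

namespace OrliczMax

/-! ### Growth functions comparable to powers -/

/-- `Φ t` and `t ^ p` are comparable, each being at most `K` times the other. -/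
structure PowerLike (p : ℝ) (K : ℝ≥0) (Φ : ℝ≥0 → ℝ≥0) : Prop where
  le : ∀ t, Φ t ≤ K * t ^ p
  ge : ∀ t, t ^ p ≤ K * Φ t

theorem PowerLike.pos {p : ℝ} {K : ℝ≥0} {Φ : ℝ≥0 → ℝ≥0} (h : PowerLike p K Φ) : 0 < K := by
  have := h.ge 1
  rw [NNReal.one_rpow] at this
  rcases eq_or_lt_of_le (zero_le (a := K)) with h0 | h0
  · rw [← h0, zero_mul] at this
    exact absurd this (by simp)
  · exact h0

theorem IsGrowth.map_zero {Φ : ℝ≥0 → ℝ≥0} (h : IsGrowth Φ) : Φ 0 = 0 := by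
  obtain ⟨t, ht⟩ := h.surjective 0
  have h0 : Φ 0 ≤ Φ t := h.monotone zero_le
  exact le_antisymm (h0.trans_eq ht) zero_le

/-- The two conditions on the exponent `q` in the class `𝒰̃^q`, read at `s = 1` and at `s = t`,
pin the function down to `t ^ q` up to constants. -/
theorem ClassUTildeExp.exists_powerLike {q : ℝ} {Φ : ℝ≥0 → ℝ≥0} (h : ClassUTildeExp q Φ) :
    ∃ K, PowerLike q K Φ := by
  obtain ⟨C₁, hC₁, hup⟩ := h.classU.upperType
  obtain ⟨C₂, hC₂, hdiv⟩ := h.div_le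
  have hq : 0 < q := zero_lt_one.trans_le h.classU.one_le
  have h1 : 0 < Φ 1 := by
    by_contra h0
    have h0 : Φ 1 = 0 := le_antisymm (not_lt.mp h0) zero_le
    obtain ⟨t, ht⟩ := h.classU.growth.surjective 1
    rcases le_total t 1 with h' | h'
    · have := h.classU.growth.monotone h'
      rw [ht, h0] at this
      exact absurd this (by simp)
    · have := hup 1 t one_pos h'
      rw [one_mul, ht, h0, mul_zero] at this
      exact absurd this (by simp)
  refine ⟨C₁ * Φ 1 + C₂ * Φ 1 + C₂ / Φ 1 + C₁ / Φ 1, fun t => ?_, fun t => ?_⟩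
  · rcases eq_or_ne t 0 with rfl | ht
    · simp [h.classU.growth.map_zero]
    have ht : 0 < t := pos_iff_ne_zero.mpr ht
    rcases le_total 1 t with h' | h'
    · calc Φ t = Φ (1 * t) := by rw [one_mul]
        _ ≤ C₁ * t ^ q * Φ 1 := hup 1 t one_pos h'
        _ = (C₁ * Φ 1) * t ^ q := by ring
        _ ≤ _ := by gcongr; rw [add_assoc, add_assoc]; exact le_self_add
    · calc Φ t = Φ (1 / t⁻¹) := by simp
        _ ≤ C₂ * (Φ 1 / t⁻¹ ^ q) := hdiv 1 t⁻¹ le_rfl ((one_le_inv₀ ht).mpr h')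
        _ = (C₂ * Φ 1) * t ^ q := by rw [NNReal.inv_rpow, div_inv_eq_mul, mul_assoc]
        _ ≤ _ := by
          gcongr
          exact le_add_right (le_add_right le_add_self)
  · rcases eq_or_ne t 0 with rfl | ht
    · simp [NNReal.zero_rpow hq.ne']
    have ht : 0 < t := pos_iff_ne_zero.mpr ht
    have htq : 0 < t ^ q := NNReal.rpow_pos ht
    rcases le_total 1 t with h' | h'
    · have := hdiv t t h' h'
      rw [div_self ht.ne'] at this
      calc t ^ q ≤ (C₂ / Φ 1) * Φ t := by
            rw [div_mul_eq_mul_div, le_div_iff₀ h1]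
            calc t ^ q * Φ 1 ≤ t ^ q * (C₂ * (Φ t / t ^ q)) := by gcongr
              _ = C₂ * Φ t := by field_simp
        _ ≤ _ := by
          gcongr; rw [add_right_comm]
          exact le_add_self
    · have := hup t t⁻¹ ht ((one_le_inv₀ ht).mpr h')
      rw [mul_inv_cancel₀ ht.ne', NNReal.inv_rpow] at this
      calc t ^ q ≤ (C₁ / Φ 1) * Φ t := by
            rw [div_mul_eq_mul_div, le_div_iff₀ h1]
            calc t ^ q * Φ 1 ≤ t ^ q * (C₁ * (t ^ q)⁻¹ * Φ t) := by gcongr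
              _ = C₁ * Φ t := by field_simp
        _ ≤ _ := by gcongr; exact le_add_self

theorem ClassUTilde.exists_powerLike {Φ : ℝ≥0 → ℝ≥0} (h : ClassUTilde Φ) :
    ∃ q : ℝ, 1 ≤ q ∧ ∃ K, PowerLike q K Φ := by
  obtain ⟨q, hq, h⟩ := h
  exact ⟨q, hq, h.exists_powerLike⟩

/-- The integral condition in `∇₂` fails for functions comparable to `t`, since `1 / s` is not
integrable at `0`. -/
theorem Nabla2.one_ne_of_powerLike {q : ℝ} {K : ℝ≥0} {Φ : ℝ≥0 → ℝ≥0} (h : Nabla2 Φ)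
    (hq : PowerLike q K Φ) : 1 ≠ q := by
  rintro rfl
  obtain ⟨C, -, hC⟩ := h.integral_le
  have h1 := (hC 1 one_pos).trans_lt ENNReal.coe_lt_top
  have hlt : ∫⁻ s in Set.Ioc (0 : ℝ) 1, ENNReal.ofReal ‖s⁻¹‖ < ∞ := by
    calc ∫⁻ s in Set.Ioc (0 : ℝ) 1, ENNReal.ofReal ‖s⁻¹‖
        ≤ ∫⁻ s in Set.Ioc (0 : ℝ) 1,
          (K : ℝ≥0∞) * ((Φ s.toNNReal / s.toNNReal ^ 2 : ℝ≥0) : ℝ≥0∞) := by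
          refine setLIntegral_mono' measurableSet_Ioc fun s hs => ?_
          have hs0 : 0 < s.toNNReal := by simpa using hs.1
          rw [← ENNReal.coe_mul, ENNReal.ofReal, ENNReal.coe_le_coe, Real.norm_of_nonneg
            (inv_nonneg.mpr hs.1.le), Real.toNNReal_inv, inv_eq_one_div, div_le_iff₀ hs0]
          have := hq.ge s.toNNReal
          rw [NNReal.rpow_one] at this
          rw [mul_assoc, div_mul_eq_mul_div, mul_div_assoc', le_div_iff₀ (by positivity)]
          calc 1 * s.toNNReal ^ 2 = s.toNNReal * s.toNNReal := by ring
            _ ≤ K * Φ s.toNNReal * s.toNNReal := by gcongr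
            _ = _ := by ring
      _ = K * _ := lintegral_const_mul' _ _ ENNReal.coe_ne_top
      _ < ∞ := ENNReal.mul_lt_top ENNReal.coe_lt_top (by simpa using h1)
  have hint : IntervalIntegrable (fun s : ℝ => s⁻¹) volume 0 1 := by
    rw [intervalIntegrable_iff_integrableOn_Ioc_of_le zero_le_one]
    refine ⟨measurable_inv.aestronglyMeasurable, ?_⟩
    simpa only [hasFiniteIntegral_iff_norm] using hlt
  rw [intervalIntegrable_inv_iff] at hint
  simp at hint

theorem PowerLike.inv {p : ℝ} (hp : 0 < p) {K : ℝ≥0} {Φ : ℝ≥0 → ℝ≥0} (h : PowerLike p K Φ)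
    (hs : Function.Surjective Φ) : PowerLike p⁻¹ (K ^ p⁻¹) (inv Φ) := by
  have hinv : ∀ t, Φ (OrliczMax.inv Φ t) = t := fun t => Function.invFun_eq (hs t)
  refine ⟨fun t => ?_, fun t => ?_⟩
  · rw [← NNReal.mul_rpow, NNReal.le_rpow_inv_iff hp]
    simpa [hinv] using h.ge (OrliczMax.inv Φ t)
  · rw [NNReal.rpow_inv_le_iff hp, NNReal.mul_rpow, ← NNReal.rpow_mul, inv_mul_cancel₀ hp.ne',
      NNReal.rpow_one]
    simpa [hinv] using h.le (OrliczMax.inv Φ t)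

theorem PowerLike.prod {ι : Type*} [Fintype ι] {p : ι → ℝ} (hp : ∀ i, 0 ≤ p i) {K : ι → ℝ≥0}
    {Φ : ι → ℝ≥0 → ℝ≥0} (h : ∀ i, PowerLike (p i) (K i) (Φ i)) :
    PowerLike (∑ i, p i) (∏ i, K i) (fun t => ∏ i, Φ i t) := by
  have hr : ∀ t : ℝ≥0, t ^ (∑ i, p i) = ∏ i, t ^ p i := fun t => by
    apply NNReal.coe_injective
    push_cast
    exact Real.rpow_sum_of_nonneg t.2 fun i _ => hp i
  refine ⟨fun t => ?_, fun t => ?_⟩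
  · rw [hr, ← Finset.prod_mul_distrib]
    exact Finset.prod_le_prod' fun i _ => (h i).le t
  · rw [hr, ← Finset.prod_mul_distrib]
    exact Finset.prod_le_prod' fun i _ => (h i).ge t

theorem PowerLike.of_inv {p : ℝ} (hp : 0 < p) {K : ℝ≥0} {Φ : ℝ≥0 → ℝ≥0}
    (hΦ : Function.Bijective Φ) (h : PowerLike p⁻¹ K (OrliczMax.inv Φ)) :
    PowerLike p (K ^ p) Φ := by
  have hinv : ∀ t, OrliczMax.inv Φ (Φ t) = t := fun t => Function.leftInverse_invFun hΦ.1 t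
  refine ⟨fun t => ?_, fun t => ?_⟩
  · have := h.ge (Φ t)
    rwa [hinv, NNReal.rpow_inv_le_iff hp, NNReal.mul_rpow] at this
  · have := NNReal.rpow_le_rpow (h.le (Φ t)) hp.le
    rwa [hinv, NNReal.mul_rpow, ← NNReal.rpow_mul, inv_mul_cancel₀ hp.ne', NNReal.rpow_one] at this

theorem PowerLike.exponent_le {p q : ℝ} {K L : ℝ≥0} {Φ Ψ : ℝ≥0 → ℝ≥0} (hΦ : PowerLike p K Φ)
    (hΨ : PowerLike q L Ψ) (h : MonotoneOn (fun t => Ψ t / Φ t) (Set.Ioi 0)) : p ≤ q := by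
  by_contra hlt
  have hpq : 0 < p - q := by linarith
  have pos : ∀ {r : ℝ} {M : ℝ≥0} {Θ : ℝ≥0 → ℝ≥0}, PowerLike r M Θ → ∀ t, 0 < t → 0 < Θ t := by
    intro r M Θ hΘ t ht
    by_contra h0
    have := hΘ.ge t
    rw [le_antisymm (not_lt.mp h0) zero_le, mul_zero] at this
    exact absurd this (not_le.mpr (NNReal.rpow_pos ht))
  have hΨ1 : 0 < Ψ 1 := pos hΨ 1 one_pos
  have hΦ1 : 0 < Φ 1 := pos hΦ 1 one_pos
  have hc : 0 < Ψ 1 / Φ 1 := by positivity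
  have key : ∀ t : ℝ≥0, 1 ≤ t → t ^ (p - q) ≤ L * K / (Ψ 1 / Φ 1) := by
    intro t ht
    have ht0 : 0 < t := zero_lt_one.trans_le ht
    have h1 := h (Set.mem_Ioi.mpr one_pos) (Set.mem_Ioi.mpr ht0) ht
    have hΦt := pos hΦ t ht0
    have htp : 0 < t ^ p := NNReal.rpow_pos ht0
    have htq : 0 < t ^ q := NNReal.rpow_pos ht0
    simp only at h1
    rw [le_div_iff₀ hc, NNReal.rpow_sub ht0.ne']
    calc t ^ p / t ^ q * (Ψ 1 / Φ 1) ≤ t ^ p / t ^ q * (Ψ t / Φ t) := by gcongr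
      _ ≤ (K * Φ t) / t ^ q * ((L * t ^ q) / Φ t) := by
        gcongr
        · exact hΦ.ge t
        · exact hΨ.le t
      _ = L * K := by field_simp
  have hu := key ((max 1 (L * K / (Ψ 1 / Φ 1) + 1)) ^ (p - q)⁻¹)
    (NNReal.one_le_rpow (le_max_left _ _) (by positivity))
  rw [← NNReal.rpow_mul, inv_mul_cancel₀ hpq.ne', NNReal.rpow_one] at hu
  exact absurd ((le_max_right _ _).trans hu) (by simp)

theorem PowerLike.ext_le {p : ℝ} (hp : 0 < p) {K : ℝ≥0} {Φ : ℝ≥0 → ℝ≥0} (h : PowerLike p K Φ)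
    (t : ℝ≥0∞) : ext Φ t ≤ K * t ^ p := by
  unfold ext
  split_ifs with ht
  · rw [ht, ENNReal.top_rpow_of_pos hp, ENNReal.mul_top (by simpa using h.pos.ne')]
  · lift t to ℝ≥0 using ht
    rw [ENNReal.toNNReal_coe, ← ENNReal.coe_rpow_of_nonneg _ hp.le]
    exact_mod_cast h.le t

theorem rpow_le_mul_ext {p : ℝ} (hp : 0 < p) {K : ℝ≥0} (hK : 0 < K) {Φ : ℝ≥0 → ℝ≥0}
    (h : ∀ t, t ^ p ≤ K * Φ t) (t : ℝ≥0∞) : t ^ p ≤ K * ext Φ t := by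
  unfold ext
  split_ifs with ht
  · rw [ENNReal.mul_top (by simpa using hK.ne')]
    exact le_top
  · lift t to ℝ≥0 using ht
    rw [ENNReal.toNNReal_coe, ← ENNReal.coe_rpow_of_nonneg _ hp.le]
    exact_mod_cast h t

theorem PowerLike.le_ext {p : ℝ} (hp : 0 < p) {K : ℝ≥0} {Φ : ℝ≥0 → ℝ≥0} (h : PowerLike p K Φ)
    (t : ℝ≥0∞) : t ^ p ≤ K * ext Φ t :=
  rpow_le_mul_ext hp h.pos h.ge t

/-! ### The complementary function -/

/-- Young's inequality with the parameter chosen so that the second term is absorbed by `Φ`. -/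
theorem mul_sub_le_of_rpow_le {p p' : ℝ} (hp : p.HolderConjugate p') {K : ℝ≥0} (hK : 0 < K)
    {Φ : ℝ≥0 → ℝ≥0} (h : ∀ t, t ^ p ≤ K * Φ t) (s t : ℝ≥0) :
    s * t - Φ t ≤ K ^ (p' / p) * s ^ p' := by
  have hK' : 0 < K ^ p⁻¹ := NNReal.rpow_pos hK
  have h0 := hp.pos
  have h0' := hp.symm.pos
  rw [tsub_le_iff_right]
  have hy := NNReal.young_inequality_real (K ^ p⁻¹ * s) ((K ^ p⁻¹)⁻¹ * t) hp.symm
  have e1 : K ^ p⁻¹ * s * ((K ^ p⁻¹)⁻¹ * t) = s * t := by field_simp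
  rw [e1] at hy
  refine hy.trans (add_le_add ?_ ?_)
  · rw [NNReal.mul_rpow, ← NNReal.rpow_mul, show p⁻¹ * p' = p' / p by field_simp]
    exact div_le_self zero_le (by simpa using hp.symm.lt.le)
  · refine (div_le_self zero_le (by simpa using hp.lt.le)).trans ?_
    rw [NNReal.mul_rpow, NNReal.inv_rpow, ← NNReal.rpow_mul, inv_mul_cancel₀ h0.ne',
      NNReal.rpow_one, inv_mul_le_iff₀ hK]
    exact h t

theorem complementary_le {p p' : ℝ} (hp : p.HolderConjugate p') {K : ℝ≥0} (hK : 0 < K)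
    {Φ : ℝ≥0 → ℝ≥0} (h : ∀ t, t ^ p ≤ K * Φ t) (s : ℝ≥0) :
    complementary Φ s ≤ K ^ (p' / p) * s ^ p' :=
  ciSup_le' fun t => mul_sub_le_of_rpow_le hp hK h s t

/-- For `r > 0` the slope `s` of the line through `(0, -r)` that supports the graph of `Φ` has
`complementary Φ s = r`. -/
theorem complementary_surjective {p : ℝ} (hp : 1 < p) {K : ℝ≥0} {Φ : ℝ≥0 → ℝ≥0}
    (h : PowerLike p K Φ) (hc : Continuous Φ) : Function.Surjective (complementary Φ) := by
  intro r
  rcases eq_or_ne r 0 with rfl | hr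
  · refine ⟨0, ?_⟩
    simp [complementary]
  have hr : 0 < r := pos_iff_ne_zero.mpr hr
  have hK := h.pos
  have hbdd : ∀ s, BddAbove (Set.range fun t => s * t - Φ t) := fun s =>
    ⟨_, by rintro _ ⟨t, rfl⟩; exact mul_sub_le_of_rpow_le (Real.HolderConjugate.conjExponent hp)
            hK h.ge s t⟩
  set H : ℝ≥0 := r + Φ 1
  have hH : 0 < H := by positivity
  set T : ℝ≥0 := max 1 ((K * H) ^ (p - 1)⁻¹)
  have h1 : (1 : ℝ≥0) ∈ Set.Icc (r / H) T :=
    ⟨(div_le_one hH).mpr le_self_add, le_max_left _ _⟩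
  have hpos : ∀ t ∈ Set.Icc (r / H) T, 0 < t := fun t ht => (by positivity : 0 < r / H).trans_le ht.1
  obtain ⟨t₀, ht₀, hmin⟩ := (isCompact_Icc (a := r / H) (b := T)).exists_isMinOn ⟨1, h1⟩
    (f := fun t => (r + Φ t) / t)
    (ContinuousOn.div (by fun_prop) continuousOn_id fun t ht => (hpos t ht).ne')
  have ht₀' := hpos t₀ ht₀
  have hle : (r + Φ t₀) / t₀ ≤ H := by simpa [H] using hmin h1
  have hglob : ∀ t, 0 < t → (r + Φ t₀) / t₀ ≤ (r + Φ t) / t := by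
    intro t ht
    by_cases h2 : t ∈ Set.Icc (r / H) T
    · exact hmin h2
    refine hle.trans ?_
    rw [le_div_iff₀ ht]
    rw [Set.mem_Icc, not_and_or, not_le, not_le] at h2
    rcases h2 with h2 | h2
    · calc H * t ≤ H * (r / H) := by gcongr
        _ = r := by field_simp
        _ ≤ _ := le_self_add
    · have h3 : K * H ≤ t ^ (p - 1) := by
        rw [← NNReal.rpow_inv_le_iff (by linarith)]
        exact (le_max_right _ _).trans h2.le
      have h4 : t ^ p = t ^ (p - 1) * t := by
        rw [← NNReal.rpow_add_one ht.ne', sub_add_cancel]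
      have h5 : K * (H * t) ≤ K * Φ t := by
        calc K * (H * t) = K * H * t := by ring
          _ ≤ t ^ (p - 1) * t := by gcongr
          _ = t ^ p := h4.symm
          _ ≤ K * Φ t := h.ge t
      exact (le_of_mul_le_mul_left h5 hK).trans le_add_self
  refine ⟨(r + Φ t₀) / t₀, le_antisymm (ciSup_le' fun t => ?_) ?_⟩
  · rw [tsub_le_iff_right]
    rcases eq_or_ne t 0 with rfl | ht
    · simp
    · have ht := pos_iff_ne_zero.mpr ht
      exact (le_div_iff₀ ht).mp (hglob t ht)
  · refine le_trans ?_ (le_ciSup (hbdd _) t₀)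
    rw [div_mul_cancel₀ _ ht₀'.ne', add_tsub_cancel_right]

/-- The inverse of the complementary function grows at least like `t ^ (1 / p')`. -/
theorem rpow_le_inv_complementary {p p' : ℝ} (hp : p.HolderConjugate p') {K : ℝ≥0}
    {Φ : ℝ≥0 → ℝ≥0} (h : PowerLike p K Φ) (hc : Continuous Φ) (t : ℝ≥0) :
    t ^ p'⁻¹ ≤ K ^ p⁻¹ * inv (complementary Φ) t := by
  have h1 : complementary Φ (inv (complementary Φ) t) = t :=
    Function.invFun_eq (complementary_surjective hp.lt h hc t)
  have h2 := complementary_le hp h.pos h.ge (inv (complementary Φ) t)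
  rw [h1] at h2
  rw [NNReal.rpow_inv_le_iff hp.symm.pos, NNReal.mul_rpow, ← NNReal.rpow_mul]
  convert h2 using 3
  field_simp

/-! ### Luxemburg norms and power integrals -/

variable {d : ℕ} {E : Type*} [ENorm E]

theorem lintegral_rpow_le_luxNorm {p : ℝ} (hp : 0 < p) {K : ℝ≥0} {Φ : ℝ≥0 → ℝ≥0}
    (h : PowerLike p K Φ) (σ : (Fin d → ℝ) → ℝ) (f : (Fin d → ℝ) → E) :
    ∫⁻ x, ‖f x‖ₑ ^ p * ENNReal.ofReal (σ x) ≤ K * luxNorm Φ σ f ^ p := by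
  have hK : (K : ℝ≥0∞) ≠ 0 := by simpa using h.pos.ne'
  set I := ∫⁻ x, ‖f x‖ₑ ^ p * ENNReal.ofReal (σ x)
  suffices hs : (I / K) ^ p⁻¹ ≤ luxNorm Φ σ f by
    rw [mul_comm, ← ENNReal.div_le_iff_le_mul (Or.inl hK) (Or.inl ENNReal.coe_ne_top)]
    exact (ENNReal.rpow_inv_le_iff hp).mp hs
  refine le_iInf₂ fun r hr => le_iInf fun hI => ?_
  rw [ENNReal.rpow_inv_le_iff hp, ENNReal.div_le_iff_le_mul (Or.inl hK) (Or.inl ENNReal.coe_ne_top)]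
  have hr0 : (r : ℝ≥0∞) ≠ 0 := by simpa using hr.ne'
  have hrt : (K * (r : ℝ≥0∞) ^ p) ≠ ∞ :=
    ENNReal.mul_ne_top ENNReal.coe_ne_top (ENNReal.rpow_ne_top_of_nonneg hp.le ENNReal.coe_ne_top)
  calc I ≤ ∫⁻ x, (K * (r : ℝ≥0∞) ^ p) * (ext Φ (‖f x‖ₑ / r) * ENNReal.ofReal (σ x)) := by
        refine lintegral_mono fun x => ?_
        rw [← mul_assoc]
        gcongr
        calc ‖f x‖ₑ ^ p = (r : ℝ≥0∞) ^ p * (‖f x‖ₑ / r) ^ p := by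
              rw [← ENNReal.mul_rpow_of_nonneg _ _ hp.le,
                ENNReal.mul_div_cancel hr0 ENNReal.coe_ne_top]
          _ ≤ (r : ℝ≥0∞) ^ p * (K * ext Φ (‖f x‖ₑ / r)) := by gcongr; exact h.le_ext hp _
          _ = _ := by ring
    _ = (K * (r : ℝ≥0∞) ^ p) * _ := lintegral_const_mul' _ _ hrt
    _ ≤ (K * (r : ℝ≥0∞) ^ p) * 1 := by gcongr
    _ = (r : ℝ≥0∞) ^ p * K := by rw [mul_one, mul_comm]

theorem luxNorm_le_lintegral_rpow {p : ℝ} (hp : 0 < p) {K : ℝ≥0} {Φ : ℝ≥0 → ℝ≥0}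
    (h : PowerLike p K Φ) (σ : (Fin d → ℝ) → ℝ) (f : (Fin d → ℝ) → E) :
    luxNorm Φ σ f ≤ (K * ∫⁻ x, ‖f x‖ₑ ^ p * ENNReal.ofReal (σ x)) ^ p⁻¹ := by
  set b := (K * ∫⁻ x, ‖f x‖ₑ ^ p * ENNReal.ofReal (σ x)) ^ p⁻¹ with hb
  refine ENNReal.le_of_forall_pos_le_add fun ε hε hbt => ?_
  set r : ℝ≥0 := b.toNNReal + ε
  have hr : (r : ℝ≥0∞) = b + ε := by
    rw [ENNReal.coe_add, ENNReal.coe_toNNReal hbt.ne]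
  have hr0 : 0 < r := by positivity
  have hr0' : (r : ℝ≥0∞) ≠ 0 := by simpa using hr0.ne'
  have hrp : (r : ℝ≥0∞) ^ p ≠ 0 := by simp [hr0']
  have hrp' : (r : ℝ≥0∞) ^ p ≠ ∞ := ENNReal.rpow_ne_top_of_nonneg hp.le ENNReal.coe_ne_top
  rw [← hr]
  refine (iInf₂_le r hr0).trans (iInf_le _ ?_)
  calc ∫⁻ x, ext Φ (‖f x‖ₑ / r) * ENNReal.ofReal (σ x)
      ≤ ∫⁻ x, (K * ((r : ℝ≥0∞) ^ p)⁻¹) * (‖f x‖ₑ ^ p * ENNReal.ofReal (σ x)) := by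
        refine lintegral_mono fun x => ?_
        rw [← mul_assoc]
        gcongr
        refine (h.ext_le hp _).trans (le_of_eq ?_)
        rw [ENNReal.div_rpow_of_nonneg _ _ hp.le, div_eq_mul_inv]
        ring
    _ = (K * ((r : ℝ≥0∞) ^ p)⁻¹) * ∫⁻ x, ‖f x‖ₑ ^ p * ENNReal.ofReal (σ x) :=
        lintegral_const_mul' _ _ (ENNReal.mul_ne_top ENNReal.coe_ne_top (ENNReal.inv_ne_top.mpr hrp))
    _ = b ^ p / (r : ℝ≥0∞) ^ p := by
        rw [hb, ENNReal.rpow_inv_rpow hp.ne', div_eq_mul_inv]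
        ring
    _ ≤ (r : ℝ≥0∞) ^ p / (r : ℝ≥0∞) ^ p := by gcongr; rw [hr]; exact le_self_add
    _ = 1 := ENNReal.div_self hrp hrp'

end OrliczMax

namespace OrliczMax

/-! ### Finite laminar families of sets -/

variable {X : Type*}

/-- A family of sets any two of which are nested or disjoint. -/
def Laminar (D : Set (Set X)) : Prop :=
  ∀ P ∈ D, ∀ Q ∈ D, P ⊆ Q ∨ Q ⊆ P ∨ Disjoint P Q

theorem Laminar.mono {D D' : Set (Set X)} (h : Laminar D) (hD : D' ⊆ D) : Laminar D' :=
  fun P hP Q hQ => h P (hD hP) Q (hD hQ)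

theorem Laminar.exists_maximal {F : Finset (Set X)} (hF : Laminar (F : Set (Set X))) :
    ∃ G ⊆ F, (G : Set (Set X)).PairwiseDisjoint id ∧ ∀ Q ∈ F, ∃ R ∈ G, Q ⊆ R := by
  classical
  refine ⟨F.filter fun Q => Maximal (· ∈ F) Q, Finset.filter_subset _ _, ?_, fun Q hQ => ?_⟩
  · intro P hP Q hQ hne
    simp only [Finset.coe_filter, Set.mem_ofPred_eq] at hP hQ
    rcases hF P hP.1 Q hQ.1 with h | h | h
    · exact absurd (hP.2.eq_of_le hQ.1 h) hne
    · exact absurd (hQ.2.eq_of_le hP.1 h).symm hne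
    · exact h
  · obtain ⟨R, hQR, hR⟩ := F.exists_le_maximal hQ
    exact ⟨R, Finset.mem_filter.mpr ⟨hR.1, hR⟩, hQR⟩

/-- The maximal function `x ↦ max {b Q : Q ∈ F, x ∈ Q}` of a finite family of sets. -/
def maxOver (F : Finset (Set X)) (b : Set X → ℝ≥0∞) (x : X) : ℝ≥0∞ :=
  ⨆ Q ∈ F, Q.indicator (fun _ => b Q) x

theorem lt_maxOver_iff {F : Finset (Set X)} {b : Set X → ℝ≥0∞} {x : X} {t : ℝ≥0∞} :
    t < maxOver F b x ↔ ∃ Q ∈ F, x ∈ Q ∧ t < b Q := by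
  simp only [maxOver, lt_iSup_iff, exists_prop]
  refine exists_congr fun Q => and_congr_right fun _ => ?_
  by_cases hx : x ∈ Q <;> simp [hx]

theorem le_maxOver {F : Finset (Set X)} {b : Set X → ℝ≥0∞} {Q : Set X} (hQ : Q ∈ F) {x : X}
    (hx : x ∈ Q) : b Q ≤ maxOver F b x := by
  refine le_trans ?_ (le_iSup₂ (f := fun Q (_ : Q ∈ F) => Q.indicator (fun _ => b Q) x) Q hQ)
  simp [hx]

theorem maxOver_le {F : Finset (Set X)} {b : Set X → ℝ≥0∞} {x : X} {c : ℝ≥0∞}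
    (h : ∀ Q ∈ F, x ∈ Q → b Q ≤ c) : maxOver F b x ≤ c := by
  refine iSup₂_le fun Q hQ => ?_
  by_cases hx : x ∈ Q
  · simpa [hx] using h Q hQ hx
  · simp [hx]

theorem maxOver_lt_top {F : Finset (Set X)} {b : Set X → ℝ≥0∞} (hb : ∀ Q ∈ F, b Q ≠ ∞) (x : X) :
    maxOver F b x < ∞ := by
  refine (maxOver_le (c := ∑ Q ∈ F, b Q) fun Q hQ _ => ?_).trans_lt ?_
  · exact Finset.single_le_sum (f := b) (fun _ _ => zero_le) hQ
  · exact ENNReal.sum_lt_top.mpr fun Q hQ => (hb Q hQ).lt_top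

theorem maxOver_rpow_le_sum {F : Finset (Set X)} {b : Set X → ℝ≥0∞} {q : ℝ} (hq : 0 < q) (x : X) :
    maxOver F b x ^ q ≤ ∑ Q ∈ F, Q.indicator (fun _ => b Q ^ q) x := by
  rw [← ENNReal.le_rpow_inv_iff hq]
  refine maxOver_le fun Q hQ hx => ?_
  rw [ENNReal.le_rpow_inv_iff hq]
  refine le_trans ?_ (Finset.single_le_sum (fun _ _ => zero_le) hQ)
  simp [hx]

/-- A level set of `maxOver F b` is the union of pairwise disjoint members `R` of `F` with `t < b R`,
which cover all members with this property. -/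
theorem Laminar.exists_levelSet {F : Finset (Set X)} (hF : Laminar (F : Set (Set X)))
    (b : Set X → ℝ≥0∞) (t : ℝ≥0∞) :
    ∃ G ⊆ F, (G : Set (Set X)).PairwiseDisjoint id ∧ (∀ R ∈ G, t < b R) ∧
      (∀ Q ∈ F, t < b Q → ∃ R ∈ G, Q ⊆ R) ∧ {x | t < maxOver F b x} = ⋃ R ∈ G, id R := by
  classical
  obtain ⟨G, hGF, hdis, hG⟩ := (hF.mono (D' := ((F.filter fun Q => t < b Q : Finset _) : Set _))
    (Finset.coe_subset.mpr (Finset.filter_subset _ _))).exists_maximal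
  refine ⟨G, hGF.trans (Finset.filter_subset _ _), hdis,
    fun R hR => (Finset.mem_filter.mp (hGF hR)).2,
    fun Q hQ hb => hG Q (Finset.mem_filter.mpr ⟨hQ, hb⟩), ?_⟩
  ext x
  simp only [Set.mem_ofPred_eq, lt_maxOver_iff, Set.mem_iUnion, exists_prop, id]
  constructor
  · rintro ⟨Q, hQ, hx, hb⟩
    obtain ⟨R, hR, hQR⟩ := hG Q (Finset.mem_filter.mpr ⟨hQ, hb⟩)
    exact ⟨R, hR, hQR hx⟩
  · rintro ⟨R, hR, hx⟩
    exact ⟨R, (Finset.mem_filter.mp (hGF hR)).1, hx, (Finset.mem_filter.mp (hGF hR)).2⟩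

variable [MeasurableSpace X]

theorem measurable_maxOver {F : Finset (Set X)} (hF : ∀ Q ∈ F, MeasurableSet Q)
    (b : Set X → ℝ≥0∞) : Measurable (maxOver F b) :=
  Measurable.biSup _ F.countable_toSet fun Q hQ => measurable_const.indicator (hF Q hQ)

theorem lintegral_maxOver_rpow_le_sum (μ : Measure X) {F : Finset (Set X)}
    (hF : ∀ Q ∈ F, MeasurableSet Q) {b : Set X → ℝ≥0∞} {q : ℝ} (hq : 0 < q) :
    ∫⁻ x, maxOver F b x ^ q ∂μ ≤ ∑ Q ∈ F, μ Q * b Q ^ q := by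
  calc ∫⁻ x, maxOver F b x ^ q ∂μ
      ≤ ∫⁻ x, ∑ Q ∈ F, Q.indicator (fun _ => b Q ^ q) x ∂μ :=
        lintegral_mono fun x => maxOver_rpow_le_sum hq x
    _ = ∑ Q ∈ F, ∫⁻ x, Q.indicator (fun _ => b Q ^ q) x ∂μ :=
        lintegral_finsetSum' _ fun Q hQ => (measurable_const.indicator (hF Q hQ)).aemeasurable
    _ = ∑ Q ∈ F, μ Q * b Q ^ q := by
        refine Finset.sum_congr rfl fun Q hQ => ?_
        rw [lintegral_indicator (hF Q hQ), setLIntegral_const, mul_comm]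

/-- The layer cake formula for finite functions with values in `[0, ∞]`. -/
theorem lintegral_rpow_eq_lintegral_meas_ofReal_lt (μ : Measure X) {f : X → ℝ≥0∞}
    (hf : Measurable f) (hfin : ∀ x, f x < ∞) {p : ℝ} (hp : 0 < p) :
    ∫⁻ x, f x ^ p ∂μ = ENNReal.ofReal p *
      ∫⁻ t in Set.Ioi (0 : ℝ), μ {x | ENNReal.ofReal t < f x} * ENNReal.ofReal (t ^ (p - 1)) := by
  have h := lintegral_rpow_eq_lintegral_meas_lt_mul μ (f := fun x => (f x).toReal)
    (Filter.Eventually.of_forall fun x => ENNReal.toReal_nonneg) hf.ennreal_toReal.aemeasurable hp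
  calc ∫⁻ x, f x ^ p ∂μ = ∫⁻ x, ENNReal.ofReal ((f x).toReal ^ p) ∂μ := by
        refine lintegral_congr fun x => ?_
        rw [← ENNReal.ofReal_rpow_of_nonneg ENNReal.toReal_nonneg hp.le,
          ENNReal.ofReal_toReal (hfin x).ne]
    _ = _ := h
    _ = _ := by
        congr 1
        refine setLIntegral_congr_fun measurableSet_Ioi fun t ht => ?_
        have ht' : 0 ≤ t := le_of_lt ht
        simp only [ENNReal.ofReal_lt_iff_lt_toReal ht' (hfin _).ne]

/-! ### The maximal inequality -/

theorem setLIntegral_ne_top_of_rpow {μ : Measure X} {f : X → ℝ≥0∞} (hf : AEMeasurable f μ)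
    {p p' : ℝ} (hp : p.HolderConjugate p') (hfp : ∫⁻ x, f x ^ p ∂μ ≠ ∞) {Q : Set X}
    (hQ : μ Q ≠ ∞) : ∫⁻ x in Q, f x ∂μ ≠ ∞ := by
  have h := ENNReal.lintegral_mul_le_Lp_mul_Lq (μ.restrict Q) hp hf.restrict
    (aemeasurable_const (b := (1 : ℝ≥0∞)))
  simp only [Pi.mul_apply, mul_one, ENNReal.one_rpow, lintegral_const, one_mul,
    Measure.restrict_apply_univ] at h
  refine (h.trans_lt (ENNReal.mul_lt_top ?_ ?_)).ne
  · refine ENNReal.rpow_lt_top_of_nonneg (by have := hp.pos; positivity) ?_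
    exact ((setLIntegral_le_lintegral _ _).trans_lt hfp.lt_top).ne
  · exact ENNReal.rpow_lt_top_of_nonneg (by have := hp.symm.pos; positivity) hQ

/-- The weak type inequality for averages over a finite laminar family. -/
theorem meas_lt_maxOver_average_mul_le (μ : Measure X) {F : Finset (Set X)}
    (hF : Laminar (F : Set (Set X))) (hm : ∀ Q ∈ F, MeasurableSet Q) (f : X → ℝ≥0∞) (t : ℝ≥0∞) :
    μ {x | t < maxOver F (fun Q => (∫⁻ y in Q, f y ∂μ) / μ Q) x} * t
      ≤ ∫⁻ x in {x | t < maxOver F (fun Q => (∫⁻ y in Q, f y ∂μ) / μ Q) x}, f x ∂μ := by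
  obtain ⟨G, hGF, hdis, hlt, -, hE⟩ := hF.exists_levelSet (fun Q => (∫⁻ y in Q, f y ∂μ) / μ Q) t
  rw [hE, measure_biUnion_finset hdis fun R hR => hm R (hGF hR),
    lintegral_biUnion_finset hdis fun R hR => hm R (hGF hR), Finset.sum_mul]
  refine Finset.sum_le_sum fun R hR => ?_
  calc μ R * t ≤ μ R * ((∫⁻ y in R, f y ∂μ) / μ R) := by gcongr; exact (hlt R hR).le
    _ ≤ ∫⁻ y in R, f y ∂μ := ENNReal.mul_div_le

/-- The maximal inequality on `L^p(μ)` for averages over a finite laminar family, with the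
constant `p'` of Doob's inequality: it depends neither on the family nor on `μ`. -/
theorem lintegral_maxOver_average_rpow_le (μ : Measure X) {F : Finset (Set X)}
    (hF : Laminar (F : Set (Set X))) (hm : ∀ Q ∈ F, MeasurableSet Q) (hfin : ∀ Q ∈ F, μ Q ≠ ∞)
    {f : X → ℝ≥0∞} (hf : AEMeasurable f μ) {p p' : ℝ} (hp : p.HolderConjugate p') :
    ∫⁻ x, maxOver F (fun Q => (∫⁻ y in Q, f y ∂μ) / μ Q) x ^ p ∂μ
      ≤ ENNReal.ofReal p' ^ p * ∫⁻ x, f x ^ p ∂μ := by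
  have hp0 := hp.pos
  have hp0' := hp.symm.pos
  by_cases hfp : ∫⁻ x, f x ^ p ∂μ = ∞
  · rw [hfp, ENNReal.mul_top]
    · exact le_top
    · have : ENNReal.ofReal p' ≠ 0 := by simpa using hp0'
      simp [this]
  set b : Set X → ℝ≥0∞ := fun Q => (∫⁻ y in Q, f y ∂μ) / μ Q with hbdef
  have hb : ∀ Q ∈ F, b Q ≠ ∞ := by
    intro Q hQ
    by_cases h0 : μ Q = 0
    · simp [hbdef, Measure.restrict_eq_zero.mpr h0, h0]
    · exact ENNReal.div_ne_top (setLIntegral_ne_top_of_rpow hf hp hfp (hfin Q hQ)) h0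
  -- The finiteness of `I` is needed to absorb `I ^ (1 / p')` at the end.
  set M := maxOver F b
  have hM : Measurable M := measurable_maxOver hm b
  have hMfin : ∀ x, M x < ∞ := maxOver_lt_top hb
  set I := ∫⁻ x, M x ^ p ∂μ
  have hI : I ≠ ∞ := by
    refine ((lintegral_maxOver_rpow_le_sum μ hm hp0).trans_lt ?_).ne
    exact ENNReal.sum_lt_top.mpr fun Q hQ => ENNReal.mul_lt_top (hfin Q hQ).lt_top
      (ENNReal.rpow_lt_top_of_nonneg hp0.le (hb Q hQ))
  have h1 : 0 < p - 1 := hp.sub_one_pos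
  -- Insert the weak type estimate into the layer cake formula, and read the result as the
  -- layer cake formula for the exponent `p - 1` and the measure `f μ`.
  have h2 : I ≤ ENNReal.ofReal p' * ∫⁻ x, f x * M x ^ (p - 1) ∂μ := by
    calc I = ENNReal.ofReal p * ∫⁻ t in Set.Ioi (0 : ℝ),
          μ {x | ENNReal.ofReal t < M x} * ENNReal.ofReal (t ^ (p - 1)) :=
          lintegral_rpow_eq_lintegral_meas_ofReal_lt μ hM hMfin hp0
      _ ≤ ENNReal.ofReal p * ∫⁻ t in Set.Ioi (0 : ℝ), (μ.withDensity f)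
          {x | ENNReal.ofReal t < M x} * ENNReal.ofReal (t ^ (p - 1 - 1)) := by
          gcongr ENNReal.ofReal p * ?_
          refine setLIntegral_mono' measurableSet_Ioi fun t ht => ?_
          have ht : 0 < t := ht
          rw [withDensity_apply _ (measurableSet_lt measurable_const hM)]
          refine le_trans ?_ (mul_le_mul_left (meas_lt_maxOver_average_mul_le μ hF hm f _) _)
          rw [mul_assoc, ← ENNReal.ofReal_mul ht.le, ← Real.rpow_one_add' ht.le (by linarith)]
          apply le_of_eq
          congr 3
          ring
      _ = ENNReal.ofReal p' * (ENNReal.ofReal (p - 1) * ∫⁻ t in Set.Ioi (0 : ℝ), (μ.withDensity f)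
          {x | ENNReal.ofReal t < M x} * ENNReal.ofReal (t ^ (p - 1 - 1))) := by
          rw [← mul_assoc, ← ENNReal.ofReal_mul hp0'.le]
          congr 2
          rw [hp.conjugate_eq]
          field_simp
      _ = ENNReal.ofReal p' * ∫⁻ x, M x ^ (p - 1) ∂(μ.withDensity f) := by
          rw [lintegral_rpow_eq_lintegral_meas_ofReal_lt (μ.withDensity f) hM hMfin h1]
      _ = ENNReal.ofReal p' * ∫⁻ x, f x * M x ^ (p - 1) ∂μ := by
          rw [lintegral_withDensity_eq_lintegral_mul₀ hf (hM.pow_const _).aemeasurable]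
          rfl
  have h3 : ∫⁻ x, f x * M x ^ (p - 1) ∂μ ≤ (∫⁻ x, f x ^ p ∂μ) ^ (1 / p) * I ^ (1 / p') := by
    refine (ENNReal.lintegral_mul_le_Lp_mul_Lq μ hp hf (hM.pow_const _).aemeasurable).trans_eq ?_
    congr 2
    refine lintegral_congr fun x => ?_
    rw [← ENNReal.rpow_mul, hp.sub_one_mul_conj]
  have h4 := h2.trans (mul_le_mul_right h3 _)
  by_cases hI0 : I = 0
  · rw [hI0]; exact zero_le
  have h5 : I ^ (1 / p) ≤ ENNReal.ofReal p' * (∫⁻ x, f x ^ p ∂μ) ^ (1 / p) := by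
    have hI1 : I ^ (1 / p') ≠ 0 := by simp [hI0, hI]
    have hI2 : I ^ (1 / p') ≠ ∞ := ENNReal.rpow_ne_top_of_nonneg (by positivity) hI
    have h6 : I = I ^ (1 / p) * I ^ (1 / p') := by
      rw [← ENNReal.rpow_add _ _ hI0 hI, one_div, one_div, hp.inv_add_inv_eq_one, ENNReal.rpow_one]
    rw [← mul_assoc] at h4
    refine (ENNReal.mul_le_mul_iff_left hI1 hI2).mp ?_
    rw [← h6]
    exact h4
  have h7 := ENNReal.rpow_le_rpow h5 hp0.le
  rwa [ENNReal.mul_rpow_of_nonneg _ _ hp0.le, ← ENNReal.rpow_mul, ← ENNReal.rpow_mul,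
    one_div_mul_cancel hp0.ne', ENNReal.rpow_one, ENNReal.rpow_one] at h7

/-! ### The Carleson embedding -/

theorem sum_rpow_le_rpow_sum {ι : Type*} (s : Finset ι) (f : ι → ℝ≥0∞) {θ : ℝ} (hθ : 1 ≤ θ) :
    ∑ i ∈ s, f i ^ θ ≤ (∑ i ∈ s, f i) ^ θ := by
  classical
  induction s using Finset.induction_on with
  | empty => simp
  | insert i s hi ih =>
    rw [Finset.sum_insert hi, Finset.sum_insert hi]
    exact (add_le_add le_rfl ih).trans (ENNReal.add_rpow_le_rpow_add _ _ hθ)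

/-- The layer cake formula for a constant. -/
theorem ennreal_rpow_eq_lintegral {b : ℝ≥0∞} (hb : b ≠ ∞) {r : ℝ} (hr : 0 < r) :
    b ^ r = ENNReal.ofReal r * ∫⁻ t in Set.Ioi (0 : ℝ),
      {t : ℝ | ENNReal.ofReal t < b}.indicator (fun t => ENNReal.ofReal (t ^ (r - 1))) t := by
  have h := lintegral_rpow_eq_lintegral_meas_ofReal_lt (Measure.dirac ()) (f := fun _ => b)
    measurable_const (fun _ => hb.lt_top) hr
  rw [lintegral_dirac] at h
  rw [h]
  congr 1
  refine lintegral_congr fun t => ?_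
  by_cases ht : ENNReal.ofReal t < b <;> simp [ht]

/-- The Carleson embedding theorem, with a power `θ ≥ 1` of the measure in the Carleson
condition. The level sets of `b` are covered by disjoint maximal sets, to which the condition
applies; the surplus power `θ - 1` of the measure of the level set is absorbed by Chebyshev's
inequality. -/
theorem sum_mul_rpow_le_of_carleson (μ : Measure X) {F : Finset (Set X)}
    (hF : Laminar (F : Set (Set X))) (hm : ∀ Q ∈ F, MeasurableSet Q) {a b : Set X → ℝ≥0∞}
    (hb : ∀ Q ∈ F, b Q ≠ ∞) {p θ : ℝ} (hp : 0 < p) (hθ : 1 ≤ θ) {A : ℝ≥0∞} (hAtop : A ≠ ∞)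
    (hA : ∀ R ∈ F, ∀ G ⊆ F, (∀ Q ∈ G, Q ⊆ R) → ∑ Q ∈ G, a Q ≤ A * μ R ^ θ)
    (hJ : ∫⁻ x, maxOver F b x ^ p ∂μ ≠ ∞) :
    ∑ Q ∈ F, a Q * b Q ^ (p * θ)
      ≤ ENNReal.ofReal θ * A * (∫⁻ x, maxOver F b x ^ p ∂μ) ^ θ := by
  classical
  have hθ0 : 0 < θ := zero_lt_one.trans_le hθ
  set J := ∫⁻ x, maxOver F b x ^ p ∂μ with hJdef
  set E : ℝ → Set X := fun t => {x | ENNReal.ofReal t < maxOver F b x}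
  have hM := measurable_maxOver hm b
  have hE : ∀ t : ℝ, ∑ Q ∈ F with ENNReal.ofReal t < b Q, a Q ≤ A * μ (E t) ^ θ := by
    intro t
    obtain ⟨G, hGF, hdis, -, hcov, hEt⟩ := hF.exists_levelSet b (ENNReal.ofReal t)
    calc ∑ Q ∈ F with ENNReal.ofReal t < b Q, a Q
        ≤ ∑ Q ∈ F, ∑ R ∈ G, if Q ⊆ R then a Q else 0 := by
          rw [Finset.sum_filter]
          refine Finset.sum_le_sum fun Q hQ => ?_
          split_ifs with h
          · obtain ⟨R, hR, hQR⟩ := hcov Q hQ h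
            refine le_trans ?_ (Finset.single_le_sum (fun _ _ => zero_le) hR)
            rw [if_pos hQR]
          · exact zero_le
      _ = ∑ R ∈ G, ∑ Q ∈ F with Q ⊆ R, a Q := by
          rw [Finset.sum_comm]
          exact Finset.sum_congr rfl fun R _ => (Finset.sum_filter _ _).symm
      _ ≤ ∑ R ∈ G, A * μ R ^ θ := Finset.sum_le_sum fun R hR => hA R (hGF hR) _
          (Finset.filter_subset _ _) fun Q hQ => (Finset.mem_filter.mp hQ).2
      _ = A * ∑ R ∈ G, μ R ^ θ := by rw [Finset.mul_sum]
      _ ≤ A * (∑ R ∈ G, μ R) ^ θ := by gcongr; exact sum_rpow_le_rpow_sum _ _ hθ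
      _ = A * μ (E t) ^ θ := by
          have h1 := measure_biUnion_finset (μ := μ) (f := id) hdis fun R hR => hm R (hGF hR)
          rw [← hEt] at h1
          simp only [id] at h1
          rw [← h1]
  have hcheb : ∀ t : ℝ, 0 < t → μ (E t) * ENNReal.ofReal (t ^ p) ≤ J := by
    intro t ht
    rw [mul_comm]
    refine le_trans ?_ (mul_meas_ge_le_lintegral₀ (hM.pow_const p).aemeasurable (ENNReal.ofReal (t ^ p)))
    gcongr
    intro x hx
    have hx : ENNReal.ofReal t < maxOver F b x := hx
    simp only [Set.mem_ofPred_eq]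
    rw [← ENNReal.ofReal_rpow_of_nonneg ht.le hp.le]
    exact ENNReal.rpow_le_rpow hx.le hp.le
  have hpθ : 0 < p * θ := mul_pos hp hθ0
  have hmeas : ∀ Q : Set X, Measurable ({t : ℝ | ENNReal.ofReal t < b Q}.indicator
      (fun t => ENNReal.ofReal (t ^ (p * θ - 1)))) := fun Q =>
    (ENNReal.measurable_ofReal.comp (measurable_id.pow_const _)).indicator
      (measurableSet_lt ENNReal.measurable_ofReal measurable_const)
  have hconst : A * J ^ (θ - 1) ≠ ∞ :=
    ENNReal.mul_ne_top hAtop (ENNReal.rpow_ne_top_of_nonneg (by linarith) hJ)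
  calc ∑ Q ∈ F, a Q * b Q ^ (p * θ)
      = ∑ Q ∈ F, a Q * (ENNReal.ofReal (p * θ) * ∫⁻ t in Set.Ioi (0 : ℝ),
          {t : ℝ | ENNReal.ofReal t < b Q}.indicator
            (fun t => ENNReal.ofReal (t ^ (p * θ - 1))) t) :=
        Finset.sum_congr rfl fun Q hQ => by rw [← ennreal_rpow_eq_lintegral (hb Q hQ) hpθ]
    _ = ENNReal.ofReal (p * θ) * ∑ Q ∈ F, ∫⁻ t in Set.Ioi (0 : ℝ), a Q *
          {t : ℝ | ENNReal.ofReal t < b Q}.indicator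
            (fun t => ENNReal.ofReal (t ^ (p * θ - 1))) t := by
        rw [Finset.mul_sum]
        refine Finset.sum_congr rfl fun Q hQ => ?_
        rw [lintegral_const_mul _ (hmeas Q)]
        ring
    _ = ENNReal.ofReal (p * θ) * ∫⁻ t in Set.Ioi (0 : ℝ), ∑ Q ∈ F, a Q *
          {t : ℝ | ENNReal.ofReal t < b Q}.indicator
            (fun t => ENNReal.ofReal (t ^ (p * θ - 1))) t := by
        rw [lintegral_finsetSum _ fun Q _ => (hmeas Q).const_mul _]
    _ ≤ ENNReal.ofReal (p * θ) * ∫⁻ t in Set.Ioi (0 : ℝ), (A * J ^ (θ - 1)) *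
          (μ (E t) * ENNReal.ofReal (t ^ (p - 1))) := by
        gcongr ENNReal.ofReal (p * θ) * ?_
        refine setLIntegral_mono' measurableSet_Ioi fun t ht => ?_
        have ht : 0 < t := ht
        calc ∑ Q ∈ F, a Q * {t : ℝ | ENNReal.ofReal t < b Q}.indicator
              (fun t => ENNReal.ofReal (t ^ (p * θ - 1))) t
            = (∑ Q ∈ F with ENNReal.ofReal t < b Q, a Q) * ENNReal.ofReal (t ^ (p * θ - 1)) := by
              rw [Finset.sum_filter, Finset.sum_mul]
              refine Finset.sum_congr rfl fun Q _ => ?_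
              by_cases h : ENNReal.ofReal t < b Q <;> simp [h]
          _ ≤ (A * μ (E t) ^ θ) * ENNReal.ofReal (t ^ (p * θ - 1)) := by gcongr; exact hE t
          _ = A * (μ (E t) * ENNReal.ofReal (t ^ p)) ^ (θ - 1) *
                (μ (E t) * ENNReal.ofReal (t ^ (p - 1))) := by
              rw [ENNReal.mul_rpow_of_nonneg _ _ (by linarith),
                ENNReal.ofReal_rpow_of_nonneg (by positivity) (by linarith), ← Real.rpow_mul ht.le]
              have e1 : μ (E t) ^ θ = μ (E t) ^ (θ - 1) * μ (E t) := by
                conv_rhs => rw [← ENNReal.rpow_one (μ (E t)), ← ENNReal.rpow_mul, one_mul]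
                rw [← ENNReal.rpow_add_of_nonneg _ _ (by linarith) zero_le_one, sub_add_cancel]
              have e2 : ENNReal.ofReal (t ^ (p * θ - 1))
                  = ENNReal.ofReal (t ^ (p * (θ - 1))) * ENNReal.ofReal (t ^ (p - 1)) := by
                rw [← ENNReal.ofReal_mul (by positivity), ← Real.rpow_add ht]
                congr 2
                ring
              rw [e1, e2]
              ring
          _ ≤ _ := by
              gcongr
              exact hcheb t ht
    _ = ENNReal.ofReal θ * (A * J ^ (θ - 1)) * (ENNReal.ofReal p *
          ∫⁻ t in Set.Ioi (0 : ℝ), μ (E t) * ENNReal.ofReal (t ^ (p - 1))) := by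
        rw [lintegral_const_mul' _ _ hconst, ENNReal.ofReal_mul hp.le]
        ring
    _ = ENNReal.ofReal θ * (A * J ^ (θ - 1)) * J := by
        rw [hJdef, lintegral_rpow_eq_lintegral_meas_ofReal_lt μ hM (maxOver_lt_top hb) hp]
    _ = ENNReal.ofReal θ * A * J ^ θ := by
        have e1 : J ^ θ = J ^ (θ - 1) * J := by
          conv_rhs => rw [← ENNReal.rpow_one J, ← ENNReal.rpow_mul, one_mul]
          rw [← ENNReal.rpow_add_of_nonneg _ _ (by linarith) zero_le_one, sub_add_cancel]
        rw [e1]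
        ring

/-! ### Principal sets and sparse families -/

/-- Every finite family `F` contains a subfamily `S` of principal sets: along chains in `S` the
values of `v` grow by more than the factor `a`, and each `Q ∈ F` is contained in some `R ∈ S`
whose value controls that of `Q` up to the factor `a`. -/
theorem exists_principal {X : Type*} (F : Finset (Set X)) (v : Set X → ℝ≥0∞) {a : ℝ≥0∞}
    (ha : 1 ≤ a) : ∃ S ⊆ F, (∀ Q ∈ F, ∃ R ∈ S, Q ⊆ R ∧ v Q ≤ a * v R) ∧
      ∀ P ∈ S, ∀ R ∈ S, P ⊂ R → a * v R < v P := by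
  classical
  induction F using Finset.strongInduction with
  | H F ih =>
    rcases F.eq_empty_or_nonempty with rfl | hne
    · exact ⟨∅, subset_rfl, by simp, by simp⟩
    -- A minimal set `Q` is added to the principal sets of the others unless it is already covered.
    obtain ⟨Q, hQ⟩ := F.exists_minimal hne
    obtain ⟨S, hSF, hcov, hgrow⟩ := ih (F.erase Q) (Finset.erase_ssubset hQ.1)
    by_cases h : ∃ R ∈ S, Q ⊆ R ∧ v Q ≤ a * v R
    · refine ⟨S, hSF.trans (Finset.erase_subset _ _), fun P hP => ?_, hgrow⟩
      by_cases hPQ : P = Q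
      · exact hPQ ▸ h
      · exact hcov P (Finset.mem_erase.mpr ⟨hPQ, hP⟩)
    · refine ⟨insert Q S, ?_, fun P hP => ?_, fun P hP R hR hPR => ?_⟩
      · exact Finset.insert_subset hQ.1 (hSF.trans (Finset.erase_subset _ _))
      · by_cases hPQ : P = Q
        · refine ⟨Q, Finset.mem_insert_self _ _, hPQ.subset, ?_⟩
          rw [hPQ]
          exact le_mul_of_one_le_left' ha
        · obtain ⟨R, hR, h1⟩ := hcov P (Finset.mem_erase.mpr ⟨hPQ, hP⟩)
          exact ⟨R, Finset.mem_insert_of_mem hR, h1⟩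
      · rcases Finset.mem_insert.mp hR with rfl | hR
        · have hPF : P ∈ F := by
            rcases Finset.mem_insert.mp hP with rfl | hP
            · exact hQ.1
            · exact Finset.mem_of_mem_erase (hSF hP)
          exact absurd (hQ.2 hPF hPR.1) hPR.2
        · rcases Finset.mem_insert.mp hP with rfl | hP
          · by_contra hlt
            exact h ⟨R, ‹R ∈ S›, hPR.1, not_lt.mp hlt⟩
          · exact hgrow P hP R hR hPR

/-- A finite family of sets is sparse if its members `Q` have pairwise disjoint parts that carry
at least half of the measure of `Q`. -/
def IsSparse (μ : Measure X) (S : Finset (Set X)) : Prop :=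
  ∃ E : Set X → Set X, (∀ Q ∈ S, E Q ⊆ Q ∧ MeasurableSet (E Q) ∧ μ Q ≤ 2 * μ (E Q)) ∧
    (S : Set (Set X)).PairwiseDisjoint E

theorem IsSparse.mono {μ : Measure X} {S T : Finset (Set X)} (hS : IsSparse μ S) (hT : T ⊆ S) :
    IsSparse μ T := by
  obtain ⟨E, hE, hdis⟩ := hS
  exact ⟨E, fun Q hQ => hE Q (hT hQ), hdis.subset (Finset.coe_subset.mpr hT)⟩

theorem IsSparse.sum_mul_le {μ : Measure X} {S : Finset (Set X)} (hS : IsSparse μ S) {R : Set X}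
    (hR : ∀ Q ∈ S, Q ⊆ R) {c : Set X → ℝ≥0∞} {h : X → ℝ≥0∞} (hc : ∀ Q ∈ S, ∀ x ∈ Q, c Q ≤ h x) :
    ∑ Q ∈ S, μ Q * c Q ≤ 2 * ∫⁻ x in R, h x ∂μ := by
  obtain ⟨E, hE, hdis⟩ := hS
  calc ∑ Q ∈ S, μ Q * c Q ≤ ∑ Q ∈ S, 2 * ∫⁻ x in E Q, h x ∂μ := by
        refine Finset.sum_le_sum fun Q hQ => ?_
        obtain ⟨hsub, hmeas, hle⟩ := hE Q hQ
        calc μ Q * c Q ≤ 2 * μ (E Q) * c Q := by gcongr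
          _ = 2 * ∫⁻ _ in E Q, c Q ∂μ := by rw [setLIntegral_const, mul_assoc, mul_comm (μ _)]
          _ ≤ 2 * ∫⁻ x in E Q, h x ∂μ := by
            gcongr 2 * ?_
            exact setLIntegral_mono' hmeas fun x hx => hc Q hQ x (hsub hx)
    _ = 2 * ∫⁻ x in ⋃ Q ∈ S, E Q, h x ∂μ := by
        rw [← Finset.mul_sum, lintegral_biUnion_finset hdis fun Q hQ => (hE Q hQ).2.1]
    _ ≤ 2 * ∫⁻ x in R, h x ∂μ := by
        gcongr 2 * ?_
        exact lintegral_mono_set (Set.iUnion₂_subset fun Q hQ => (hE Q hQ).1.trans (hR Q hQ))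

/-- Principal sets form a sparse family if disjoint subsets of `R` with values above `a * v R`
fill at most half of `R`. -/
theorem isSparse_of_principal {μ : Measure X} {S : Finset (Set X)} (hS : Laminar (S : Set (Set X)))
    (hm : ∀ Q ∈ S, MeasurableSet Q) (hfin : ∀ Q ∈ S, μ Q ≠ ∞) {v : Set X → ℝ≥0∞} {a : ℝ≥0∞}
    (hgrow : ∀ P ∈ S, ∀ R ∈ S, P ⊂ R → a * v R < v P)
    (hhalf : ∀ R ∈ S, ∀ G ⊆ S, (G : Set (Set X)).PairwiseDisjoint id →
      (∀ P ∈ G, P ⊆ R ∧ a * v R < v P) → 2 * ∑ P ∈ G, μ P ≤ μ R) : IsSparse μ S := by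
  classical
  have hUm : ∀ R : Set X, MeasurableSet (⋃ P ∈ S.filter (· ⊂ R), P) := fun R =>
    Finset.measurableSet_biUnion _ fun P hP => hm P (Finset.mem_filter.mp hP).1
  -- The part of `R` outside the smaller members of the family.
  refine ⟨fun R => R \ ⋃ P ∈ S.filter (· ⊂ R), P,
    fun R hR => ⟨Set.sdiff_subset, (hm R hR).diff (hUm R), ?_⟩, ?_⟩
  · obtain ⟨G, hGF, hdis, hG⟩ := (hS.mono (D' := ((S.filter (· ⊂ R) : Finset _) : Set _))
      (Finset.coe_subset.mpr (Finset.filter_subset _ _))).exists_maximal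
    have h1 : 2 * μ (⋃ P ∈ S.filter (· ⊂ R), P) ≤ μ R := by
      refine le_trans ?_ (hhalf R hR G (hGF.trans (Finset.filter_subset _ _)) hdis fun P hP => ?_)
      · gcongr
        refine (measure_mono (Set.iUnion₂_subset fun P hP => ?_)).trans
          (measure_biUnion_finset_le G id)
        obtain ⟨P', hP', hPP'⟩ := hG P hP
        exact hPP'.trans (Set.subset_biUnion_of_mem (u := id) hP')
      · have := Finset.mem_filter.mp (hGF hP)
        exact ⟨this.2.1, hgrow P this.1 R hR this.2⟩
    set U := ⋃ P ∈ S.filter (· ⊂ R), P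
    have h2 : μ R ≤ μ (R \ U) + μ U :=
      (measure_mono (by rw [Set.sdiff_union_self]; exact Set.subset_union_left)).trans
        (measure_union_le _ _)
    refine (ENNReal.add_le_add_iff_right (hfin R hR)).mp ?_
    calc μ R + μ R = 2 * μ R := (two_mul _).symm
      _ ≤ 2 * (μ (R \ U) + μ U) := by gcongr
      _ = 2 * μ (R \ U) + 2 * μ U := mul_add _ _ _
      _ ≤ 2 * μ (R \ U) + μ R := by gcongr
  · intro P hP R hR hne
    have key : ∀ P ∈ S, ∀ R ∈ S, P ⊂ R →
        Disjoint (P \ ⋃ P' ∈ S.filter (· ⊂ P), P') (R \ ⋃ P' ∈ S.filter (· ⊂ R), P') := by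
      intro P hP R hR hPR
      rw [Set.disjoint_left]
      intro x hx hx'
      exact hx'.2 (Set.mem_biUnion (Finset.mem_coe.mpr (Finset.mem_filter.mpr ⟨hP, hPR⟩)) hx.1)
    rcases hS P hP R hR with h | h | h
    · exact key P hP R hR (h.ssubset_of_ne hne)
    · exact (key R hR P hP (h.ssubset_of_ne hne.symm)).symm
    · exact h.mono Set.sdiff_subset Set.sdiff_subset

end OrliczMax

namespace OrliczMax

/-! ### Adjacent grids -/

variable {d n : ℕ}

/-- The offset of a grid in one coordinate, as a multiple of the side length: `0` or `1 / 3`. -/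
def gridShift (b : Bool) : ℝ := if b then 1 / 3 else 0

/-- The lower corner of `gridCube β k m`. -/
def gridCorner (β : Fin d → Bool) (k : ℤ) (m : Fin d → ℤ) (i : Fin d) : ℝ :=
  4 ^ k * (m i + gridShift (β i))

/-- The half-open cube of side `4 ^ k` and position `m` in the grid with offset `β`. With the
ratio `4` between consecutive scales, the offset `1 / 3` is compatible with nesting, because
`4 / 3 = 1 + 1 / 3`. -/
def gridCube (β : Fin d → Bool) (k : ℤ) (m : Fin d → ℤ) : Set (Fin d → ℝ) :=
  Set.univ.pi fun i => Set.Ico (gridCorner β k m i) (gridCorner β k m i + 4 ^ k)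

/-- The cubes of all scales with offset `β`. -/
def grid (β : Fin d → Bool) : Set (Set (Fin d → ℝ)) :=
  Set.range fun km : ℤ × (Fin d → ℤ) => gridCube β km.1 km.2

theorem exists_int_add_gridShift (b : Bool) (j : ℕ) (m : ℤ) :
    ∃ M : ℤ, (4 : ℝ) ^ j * (m + gridShift b) = M + gridShift b := by
  induction j with
  | zero => exact ⟨m, by simp⟩
  | succ j ih =>
    obtain ⟨M, hM⟩ := ih
    cases b with
    | false =>
      refine ⟨4 * M, ?_⟩
      simp only [gridShift, Bool.false_eq_true, if_false] at hM ⊢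
      push_cast
      rw [pow_succ]
      linarith
    | true =>
      refine ⟨4 * M + 1, ?_⟩
      simp only [gridShift, if_true] at hM ⊢
      push_cast
      rw [pow_succ]
      linarith

theorem gridCube_subset_of_le {β : Fin d → Bool} {k k' : ℤ} (hk : k ≤ k') {m m' : Fin d → ℤ}
    (h : ¬ Disjoint (gridCube β k m) (gridCube β k' m')) : gridCube β k m ⊆ gridCube β k' m' := by
  obtain ⟨x, hx, hx'⟩ := Set.not_disjoint_iff.mp h
  obtain ⟨j, rfl⟩ : ∃ j : ℕ, k' = k + j := ⟨(k' - k).toNat, by omega⟩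
  refine Set.pi_mono fun i _ => ?_
  have hx := hx i (Set.mem_univ i)
  have hx' := hx' i (Set.mem_univ i)
  obtain ⟨M, hM⟩ := exists_int_add_gridShift (β i) j (m' i)
  have hr : (0 : ℝ) < 4 ^ k := by positivity
  have e1 : gridCorner β (k + j) m' i = 4 ^ k * (M + gridShift (β i)) := by
    rw [gridCorner, ← hM, zpow_add₀ (by norm_num), zpow_natCast]
    ring
  have e2 : (4 : ℝ) ^ (k + j : ℤ) = 4 ^ k * ((4 ^ j : ℤ) : ℝ) := by
    rw [zpow_add₀ (by norm_num), zpow_natCast]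
    push_cast
    ring
  simp only [e1, e2] at hx' ⊢
  simp only [gridCorner] at hx ⊢
  have h1 : (m i : ℝ) < (M + 4 ^ j : ℤ) := by
    have := hx.1.trans_lt hx'.2
    have : (4 : ℝ) ^ k * m i < 4 ^ k * (M + 4 ^ j : ℤ) := by push_cast at this ⊢; linarith
    exact lt_of_mul_lt_mul_left this hr.le
  have h2 : (M : ℝ) < (m i + 1 : ℤ) := by
    have := hx'.1.trans_lt hx.2
    have : (4 : ℝ) ^ k * M < 4 ^ k * (m i + 1 : ℤ) := by push_cast at this ⊢; linarith
    exact lt_of_mul_lt_mul_left this hr.le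
  have h3 : (m i : ℝ) + 1 ≤ M + 4 ^ j := by
    have : m i + 1 ≤ M + 4 ^ j := by exact_mod_cast h1
    exact_mod_cast this
  have h4 : (M : ℝ) ≤ m i := by
    have : M < m i + 1 := by exact_mod_cast h2
    exact_mod_cast (by omega : M ≤ m i)
  refine Set.Ico_subset_Ico ?_ ?_
  · gcongr
  · push_cast
    have := mul_le_mul_of_nonneg_left h3 hr.le
    linarith

theorem laminar_grid (β : Fin d → Bool) : Laminar (grid β) := by
  rintro _ ⟨⟨k, m⟩, rfl⟩ _ ⟨⟨k', m'⟩, rfl⟩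
  by_cases h : Disjoint (gridCube β k m) (gridCube β k' m')
  · exact Or.inr (Or.inr h)
  rcases le_total k k' with hk | hk
  · exact Or.inl (gridCube_subset_of_le hk h)
  · exact Or.inr (Or.inl (gridCube_subset_of_le hk fun h' => h h'.symm))

theorem measurableSet_gridCube (β : Fin d → Bool) (k : ℤ) (m : Fin d → ℤ) :
    MeasurableSet (gridCube β k m) :=
  MeasurableSet.univ_pi fun _ => measurableSet_Ico

theorem volume_gridCube (β : Fin d → Bool) (k : ℤ) (m : Fin d → ℤ) :
    volume (gridCube β k m) = ENNReal.ofReal (4 ^ k) ^ d := by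
  simp [gridCube, Real.volume_pi_Ico]

theorem volume_Icc_add (a : Fin d → ℝ) (l : ℝ) :
    volume (Set.Icc a fun i => a i + l) = ENNReal.ofReal l ^ d := by
  simp [Real.volume_Icc_pi]

/-- A grid cube and its closure, one of the cubes over which suprema are taken. -/
theorem exists_cube_of_mem_grid {β : Fin d → Bool} {P : Set (Fin d → ℝ)} (hP : P ∈ grid β) :
    ∃ Q ∈ cubes d, P ⊆ Q ∧ P =ᵐ[volume] Q := by
  obtain ⟨⟨k, m⟩, rfl⟩ := hP
  refine ⟨_, ⟨gridCorner β k m, 4 ^ k, by positivity, rfl⟩, ?_, ?_⟩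
  · rw [← Set.pi_univ_Icc]
    exact Set.pi_mono fun i _ => Set.Ico_subset_Icc_self
  · exact Measure.univ_pi_Ico_ae_eq_Icc

theorem cubes_volume {Q : Set (Fin d → ℝ)} (hQ : Q ∈ cubes d) :
    volume Q ≠ 0 ∧ volume Q ≠ ∞ := by
  obtain ⟨a, l, hl, rfl⟩ := hQ
  rw [volume_Icc_add]
  exact ⟨pow_ne_zero _ (by simpa using hl), ENNReal.pow_ne_top ENNReal.ofReal_ne_top⟩

/-- In one dimension, an interval shorter than a third of the side length lies in an interval of
one of the two grids, since their end points are at least a third apart. -/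
theorem exists_gridShift_floor (u v : ℝ) (hv : v < 1 / 3) :
    ∃ (b : Bool) (m : ℤ), m + gridShift b ≤ u ∧ u + v < m + gridShift b + 1 := by
  by_cases h : u + v < ⌊u⌋ + 1
  · exact ⟨false, ⌊u⌋, by simpa [gridShift] using Int.floor_le u, by simpa [gridShift] using h⟩
  · have h1 : ⌊u⌋ ≤ ⌊u - 1 / 3⌋ := Int.le_floor.mpr (by linarith)
    have h2 : (⌊u⌋ : ℝ) ≤ ⌊u - 1 / 3⌋ := by exact_mod_cast h1
    have h3 := Int.floor_le (u - 1 / 3)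
    have h4 := Int.lt_floor_add_one u
    refine ⟨true, ⌊u - 1 / 3⌋, ?_, ?_⟩ <;> simp only [gridShift, if_true] <;> linarith

/-- Every cube lies in a comparable cube of one of the `2 ^ d` grids: a cube of side `l` in a grid
cube of side `r`, a power of `4` with `3 * l < r ≤ 12 * l`. -/
theorem exists_gridCube_superset {Q : Set (Fin d → ℝ)} (hQ : Q ∈ cubes d) :
    ∃ β : Fin d → Bool, ∃ P ∈ grid β, Q ⊆ P ∧ volume P ≤ 12 ^ d * volume Q := by
  obtain ⟨a, l, hl, rfl⟩ := hQ
  obtain ⟨k, hk⟩ := exists_mem_Ico_zpow (x := 3 * l) (y := (4 : ℝ)) (by positivity) (by norm_num)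
  set r : ℝ := 4 ^ (k + 1)
  have hr : 0 < r := by positivity
  have hk1 : r ≤ 12 * l := by
    have : r = 4 ^ k * 4 := zpow_add_one₀ (by norm_num) k
    linarith [hk.1]
  have hk2 : l / r < 1 / 3 := by rw [div_lt_iff₀ hr]; linarith [hk.2]
  choose β m h1 h2 using fun i => exists_gridShift_floor (a i / r) (l / r) hk2
  refine ⟨β, _, ⟨(k + 1, m), rfl⟩, ?_, ?_⟩
  · intro x hx i _
    have h1 := (le_div_iff₀ hr).mp (h1 i)
    have h2 := h2 i
    rw [← add_div, div_lt_iff₀ hr] at h2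
    have h3 := hx.1 i
    have h4 := hx.2 i
    simp only [gridCorner]
    constructor
    · linarith
    · linarith
  · rw [volume_gridCube, volume_Icc_add, ← mul_pow]
    gcongr
    calc ENNReal.ofReal r ≤ ENNReal.ofReal (12 * l) := ENNReal.ofReal_le_ofReal hk1
      _ = 12 * ENNReal.ofReal l := by rw [ENNReal.ofReal_mul (by norm_num)]; simp

/-! ### Reduction of the maximal function to finite families of grid cubes -/

/-- The quantity `|Q|^{-γ} ∏ᵢ ∫_Q hᵢ`, whose supremum with `γ = n - α / d` is the fractional
maximal function. -/
def cubeValue (γ : ℝ) (h : Fin n → (Fin d → ℝ) → ℝ≥0∞) (Q : Set (Fin d → ℝ)) : ℝ≥0∞ :=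
  volume Q ^ (-γ) * ∏ i, ∫⁻ y in Q, h i y

theorem rpow_mul_prod_div_eq_cubeValue {E : Type*} [ENorm E] (α : ℝ)
    (f : Fin n → (Fin d → ℝ) → E) {Q : Set (Fin d → ℝ)} (h0 : volume Q ≠ 0) (ht : volume Q ≠ ∞) :
    volume Q ^ (α / d) * ∏ i, (∫⁻ y in Q, ‖f i y‖ₑ) / volume Q
      = cubeValue (n - α / d) (fun i y => ‖f i y‖ₑ) Q := by
  simp only [cubeValue, div_eq_mul_inv, Finset.prod_mul_distrib, Finset.prod_const,
    Finset.card_univ, Fintype.card_fin]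
  rw [neg_sub, sub_eq_add_neg, ENNReal.rpow_add _ _ h0 ht, ENNReal.rpow_neg, ENNReal.rpow_natCast,
    ENNReal.inv_pow]
  ring

theorem cubeValue_congr {γ : ℝ} {h : Fin n → (Fin d → ℝ) → ℝ≥0∞} {P Q : Set (Fin d → ℝ)}
    (hPQ : P =ᵐ[volume] Q) : cubeValue γ h P = cubeValue γ h Q := by
  simp only [cubeValue, measure_congr hPQ, setLIntegral_congr hPQ]

theorem mem_grid_volume {β : Fin d → Bool} {P : Set (Fin d → ℝ)} (hP : P ∈ grid β) :
    MeasurableSet P ∧ volume P ≠ 0 ∧ volume P ≠ ∞ := by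
  obtain ⟨⟨k, m⟩, rfl⟩ := hP
  refine ⟨measurableSet_gridCube _ _ _, ?_, ?_⟩ <;> rw [volume_gridCube]
  · exact pow_ne_zero _ (by simp only [ne_eq, ENNReal.ofReal_eq_zero, not_le]; positivity)
  · exact ENNReal.pow_ne_top ENNReal.ofReal_ne_top

/-- The maximal function dominates its version for a finite family of grid cubes. -/
theorem maxOver_cubeValue_le_fracMax {E : Type*} [ENorm E] (α : ℝ) (f : Fin n → (Fin d → ℝ) → E)
    {β : Fin d → Bool} {F : Finset (Set (Fin d → ℝ))} (hF : (F : Set (Set (Fin d → ℝ))) ⊆ grid β)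
    (x : Fin d → ℝ) :
    maxOver F (cubeValue (n - α / d) fun i y => ‖f i y‖ₑ) x ≤ fracMax α f x := by
  refine maxOver_le fun P hP hx => ?_
  obtain ⟨Q, hQ, hPQ, hae⟩ := exists_cube_of_mem_grid (hF hP)
  rw [cubeValue_congr hae, ← rpow_mul_prod_div_eq_cubeValue α f (cubes_volume hQ).1
    (cubes_volume hQ).2]
  refine le_trans ?_ (le_iSup₂ (f := fun Q (_ : Q ∈ cubes d) => Q.indicator (fun _ => volume Q ^
    (α / d) * ∏ i, (∫⁻ y in Q, ‖f i y‖ₑ) / volume Q) x) Q hQ)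
  rw [Set.indicator_of_mem (hPQ hx)]

theorem cubeValue_le_of_subset {γ : ℝ} (hγ : 0 ≤ γ) (hγn : γ ≤ n) {c : ℝ≥0∞} (hc : 1 ≤ c)
    {P Q : Set (Fin d → ℝ)} (hPt : volume P ≠ ∞) (hQ0 : volume Q ≠ 0) (hQP : Q ⊆ P)
    (hvol : volume P ≤ c * volume Q) (h : Fin n → (Fin d → ℝ) → ℝ≥0∞) :
    cubeValue γ h Q ≤ c ^ n * cubeValue γ h P := by
  have hP0 : volume P ≠ 0 := fun h0 => hQ0 (measure_mono_null hQP h0)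
  have hQt : volume Q ≠ ∞ := ne_top_of_le_ne_top hPt (measure_mono hQP)
  have h1 : volume P ^ γ ≤ c ^ n * volume Q ^ γ := by
    calc volume P ^ γ ≤ (c * volume Q) ^ γ := ENNReal.rpow_le_rpow hvol hγ
      _ = c ^ γ * volume Q ^ γ := ENNReal.mul_rpow_of_nonneg _ _ hγ
      _ ≤ c ^ n * volume Q ^ γ := by
        rw [← ENNReal.rpow_natCast _ n]
        exact mul_le_mul_left (ENNReal.rpow_le_rpow_of_exponent_le hc hγn) _
  have hvol' : volume Q ^ (-γ) ≤ c ^ n * volume P ^ (-γ) := by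
    rw [ENNReal.rpow_neg, ENNReal.rpow_neg, ← div_eq_mul_inv,
      ENNReal.le_div_iff_mul_le (Or.inl (by simp [hP0, hPt])) (Or.inl
        (ENNReal.rpow_ne_top_of_nonneg hγ hPt)), mul_comm, ← div_eq_mul_inv,
      ENNReal.div_le_iff_le_mul (Or.inl (by simp [hQ0, hQt])) (Or.inl
        (ENNReal.rpow_ne_top_of_nonneg hγ hQt))]
    exact h1
  rw [cubeValue, cubeValue, ← mul_assoc]
  refine mul_le_mul' hvol' (Finset.prod_le_prod' fun i _ => lintegral_mono_set hQP)

theorem fracMax_le_iSup_grid {E : Type*} [ENorm E] {α : ℝ} (hα : 0 ≤ α) (hαn : 0 ≤ n - α / d)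
    (f : Fin n → (Fin d → ℝ) → E) (x : Fin d → ℝ) :
    fracMax α f x ≤ (12 ^ d) ^ n * ⨆ β : Fin d → Bool, ⨆ km : ℤ × (Fin d → ℤ),
      (gridCube β km.1 km.2).indicator
        (fun _ => cubeValue (n - α / d) (fun i y => ‖f i y‖ₑ) (gridCube β km.1 km.2)) x := by
  refine iSup₂_le fun Q hQ => ?_
  by_cases hx : x ∈ Q
  swap
  · simp [hx]
  obtain ⟨hQ0, hQt⟩ := cubes_volume hQ
  rw [Set.indicator_of_mem hx, rpow_mul_prod_div_eq_cubeValue α f hQ0 hQt]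
  obtain ⟨β, P, ⟨km, rfl⟩, hQP, hvol⟩ := exists_gridCube_superset hQ
  have h1 : cubeValue (n - α / d) (fun i y => ‖f i y‖ₑ) Q
      ≤ (12 ^ d) ^ n * cubeValue (n - α / d) (fun i y => ‖f i y‖ₑ) (gridCube β km.1 km.2) :=
    cubeValue_le_of_subset hαn (sub_le_self _ (div_nonneg hα (Nat.cast_nonneg d)))
      (one_le_pow₀ (by norm_num)) (mem_grid_volume (β := β) (Set.mem_range_self km)).2.2 hQ0 hQP
      hvol _
  refine h1.trans ?_
  have h2 := le_iSup₂ (f := fun (β : Fin d → Bool) (km : ℤ × (Fin d → ℤ)) =>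
    (gridCube β km.1 km.2).indicator
      (fun _ => cubeValue (n - α / d) (fun i y => ‖f i y‖ₑ) (gridCube β km.1 km.2)) x) β km
  simp only [Set.indicator_of_mem (hQP hx)] at h2
  gcongr

/-- A bound for all finite families of cubes from the grids is a bound for the maximal
function. -/
theorem lintegral_fracMax_rpow_le {E : Type*} [ENorm E] {α : ℝ} (hα : 0 ≤ α)
    (hαn : 0 ≤ n - α / d) (f : Fin n → (Fin d → ℝ) → E) {w : (Fin d → ℝ) → ℝ≥0∞}
    (hw : AEMeasurable w) {q : ℝ} (hq : 0 < q) {B : ℝ≥0∞}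
    (hB : ∀ (β : Fin d → Bool) (F : Finset (Set (Fin d → ℝ))),
      (F : Set (Set (Fin d → ℝ))) ⊆ grid β →
        ∫⁻ x, maxOver F (cubeValue (n - α / d) fun i y => ‖f i y‖ₑ) x ^ q
          ∂(volume.withDensity w) ≤ B) :
    ∫⁻ x, fracMax α f x ^ q * w x ≤ ((12 ^ d) ^ n) ^ q * 2 ^ d * B := by
  classical
  set v := cubeValue (n - α / d) fun i y => ‖f i y‖ₑ
  set g : (Fin d → Bool) → Finset (ℤ × (Fin d → ℤ)) → (Fin d → ℝ) → ℝ≥0∞ :=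
    fun β s => maxOver (s.image fun km => gridCube β km.1 km.2) v
  have hgF : ∀ (β : Fin d → Bool) (s : Finset (ℤ × (Fin d → ℤ))),
      ((s.image fun km => gridCube β km.1 km.2 : Finset _) : Set (Set (Fin d → ℝ))) ⊆ grid β := by
    intro β s
    rw [Finset.coe_image]
    exact Set.image_subset_range _ _
  have hgm : ∀ β s, Measurable (g β s) := fun β s =>
    measurable_maxOver (fun Q hQ => (mem_grid_volume (hgF β s hQ)).1) _
  have hgsup : ∀ β x, (⨆ km : ℤ × (Fin d → ℤ), (gridCube β km.1 km.2).indicator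
      (fun _ => v (gridCube β km.1 km.2)) x) = ⨆ s, g β s x := by
    intro β x
    rw [iSup_eq_iSup_finset]
    refine iSup_congr fun s => ?_
    simp only [g, maxOver, Finset.mem_image, iSup_exists, iSup_and]
    refine le_antisymm (iSup₂_le fun km hkm => ?_) (iSup_le fun Q => iSup_le fun km =>
      iSup_le fun hkm => iSup_le fun hQ => ?_)
    · exact le_iSup_of_le (gridCube β km.1 km.2) (le_iSup_of_le km (le_iSup_of_le hkm
        (le_iSup_of_le rfl le_rfl)))
    · subst hQ
      exact le_iSup₂_of_le km hkm le_rfl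
  have hmono : ∀ β, Monotone (g β) := by
    intro β s t hst x
    refine maxOver_le fun Q hQ hx => le_maxOver (Finset.image_subset_image hst hQ) hx
  have hpt : ∀ x, fracMax α f x ^ q ≤ ((12 ^ d) ^ n) ^ q * ∑ β, ⨆ s, g β s x ^ q := by
    intro x
    calc fracMax α f x ^ q ≤ ((12 ^ d) ^ n * ⨆ β, ⨆ s, g β s x) ^ q := by
          refine ENNReal.rpow_le_rpow ?_ hq.le
          refine (fracMax_le_iSup_grid hα hαn f x).trans_eq ?_
          simp only [← hgsup, v]
      _ = ((12 ^ d) ^ n) ^ q * ⨆ β, ⨆ s, g β s x ^ q := by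
          rw [ENNReal.mul_rpow_of_nonneg _ _ hq.le]
          congr 1
          have := fun (ι : Type) (u : ι → ℝ≥0∞) => (ENNReal.orderIsoRpow q hq).map_iSup u
          simp only [ENNReal.orderIsoRpow_apply] at this
          simp only [this]
      _ ≤ _ := by
          gcongr
          exact iSup_le fun β => Finset.single_le_sum (f := fun β => ⨆ s, g β s x ^ q)
            (fun _ _ => zero_le) (Finset.mem_univ β)
  have hC : (((12 : ℝ≥0∞) ^ d) ^ n) ^ q ≠ ∞ := ENNReal.rpow_ne_top_of_nonneg hq.le
    (ENNReal.pow_ne_top (ENNReal.pow_ne_top (by norm_num)))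
  have hsm : ∀ β, Measurable fun x => ⨆ s, g β s x ^ q := fun β =>
    Measurable.iSup fun s => (hgm β s).pow_const _
  calc ∫⁻ x, fracMax α f x ^ q * w x
      ≤ ∫⁻ x, ((12 ^ d) ^ n) ^ q * ∑ β, w x * ⨆ s, g β s x ^ q := by
        refine lintegral_mono fun x => ?_
        rw [← Finset.mul_sum, mul_left_comm, mul_comm]
        gcongr
        exact hpt x
    _ = ((12 ^ d) ^ n) ^ q * ∑ β, ∫⁻ x, w x * ⨆ s, g β s x ^ q := by
        rw [lintegral_const_mul' _ _ hC]
        congr 1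
        exact lintegral_finsetSum' _ fun β _ => hw.mul (hsm β).aemeasurable
    _ = ((12 ^ d) ^ n) ^ q * ∑ β, ⨆ s, ∫⁻ x, g β s x ^ q ∂(volume.withDensity w) := by
        congr 1
        refine Finset.sum_congr rfl fun β _ => ?_
        rw [← lintegral_iSup_directed (fun s => ((hgm β s).pow_const _).aemeasurable),
          lintegral_withDensity_eq_lintegral_mul₀ hw (hsm β).aemeasurable]
        · rfl
        · exact Monotone.directed_le fun s t hst x => ENNReal.rpow_le_rpow (hmono β hst x) hq.le
    _ ≤ ((12 ^ d) ^ n) ^ q * ∑ β : Fin d → Bool, B := by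
        gcongr with β
        exact iSup_le fun s => hB β _ (hgF β s)
    _ = _ := by
        rw [Finset.sum_const, Finset.card_univ, Fintype.card_fun, Fintype.card_bool,
          Fintype.card_fin, nsmul_eq_mul, mul_assoc]
        push_cast
        rfl

end OrliczMax

namespace OrliczMax

/-! ### Sparse domination of the multilinear maximal function -/

variable {d n : ℕ}

/-- Hölder's inequality for finite sums and several factors. -/
theorem sum_prod_rpow_le {ι κ : Type*} [Fintype κ] (S : Finset ι) (f : κ → ι → ℝ≥0∞) {θ : κ → ℝ}
    (hθ : ∑ i, θ i = 1) (hθ0 : ∀ i, 0 ≤ θ i) :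
    ∑ Q ∈ S, ∏ i, f i Q ^ θ i ≤ ∏ i, (∑ Q ∈ S, f i Q) ^ θ i := by
  let _ : MeasurableSpace S := ⊤
  have h := ENNReal.lintegral_prod_norm_pow_le (μ := (Measure.count : Measure S)) Finset.univ
    (f := fun i (Q : S) => f i Q) (fun i _ => (measurable_from_top).aemeasurable) hθ
    fun i _ => hθ0 i
  simp only [lintegral_count, tsum_fintype] at h
  rw [Finset.sum_coe_sort S (fun Q => ∏ i, f i Q ^ θ i)] at h
  refine h.trans_eq (Finset.prod_congr rfl fun i _ => ?_)
  rw [Finset.sum_coe_sort S (fun Q => f i Q)]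

/-- Disjoint cubes in `R` on which `cubeValue` exceeds `2 ^ n` times its value on `R` fill at most
half of `R`: by the comparison of values `2 |P| ≤ |R| ∏ᵢ (∫_P hᵢ / ∫_R hᵢ) ^ (1 / n)`, and the
sum over `P` is estimated by Hölder's inequality. -/
theorem two_mul_sum_volume_le (hn : 1 ≤ n) {γ : ℝ} (hγn : γ ≤ n)
    {h : Fin n → (Fin d → ℝ) → ℝ≥0∞} {R : Set (Fin d → ℝ)} (hR0 : volume R ≠ 0)
    (hRt : volume R ≠ ∞) (hh : ∀ i, ∫⁻ y in R, h i y ≠ ∞) {G : Finset (Set (Fin d → ℝ))}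
    (hdis : (G : Set (Set (Fin d → ℝ))).PairwiseDisjoint id)
    (hG : ∀ P ∈ G, MeasurableSet P ∧ volume P ≠ 0 ∧ volume P ≠ ∞)
    (hv : ∀ P ∈ G, P ⊆ R ∧ 2 ^ n * cubeValue γ h R < cubeValue γ h P) :
    2 * ∑ P ∈ G, volume P ≤ volume R := by
  have hn0 : (n : ℝ) ≠ 0 := by exact_mod_cast (by omega : n ≠ 0)
  have hnpos : (0 : ℝ) < n := by positivity
  set x : Fin n → Set (Fin d → ℝ) → ℝ≥0∞ := fun i P => (∫⁻ y in P, h i y) / ∫⁻ y in R, h i y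
  have key : ∀ P ∈ G, 2 * volume P ≤ volume R * ∏ i, x i P ^ (n : ℝ)⁻¹ := by
    intro P hP
    obtain ⟨hPm, hP0, hPt⟩ := hG P hP
    obtain ⟨hPR, hlt⟩ := hv P hP
    have hH : ∀ i, ∫⁻ y in R, h i y ≠ 0 := by
      intro i h0
      have h1 : ∫⁻ y in P, h i y = 0 :=
        le_antisymm ((lintegral_mono_set hPR).trans_eq h0) zero_le
      have h2 : cubeValue γ h P = 0 := by
        rw [cubeValue, Finset.prod_eq_zero (Finset.mem_univ i) h1, mul_zero]
      rw [h2] at hlt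
      exact not_lt_zero hlt
    have e1 : volume P ^ n ≤ volume P ^ γ * volume R ^ (n - γ) := by
      rw [← ENNReal.rpow_natCast, ← add_sub_cancel γ (n : ℝ), ENNReal.rpow_add _ _ hP0 hPt,
        add_sub_cancel]
      gcongr
    have e2 : volume R ^ (n - γ) = volume R ^ n * volume R ^ (-γ) := by
      rw [sub_eq_add_neg, ENNReal.rpow_add _ _ hR0 hRt, ENNReal.rpow_natCast]
    have e3 : volume P ^ γ * volume P ^ (-γ) = 1 := by
      rw [← ENNReal.rpow_add _ _ hP0 hPt, add_neg_cancel, ENNReal.rpow_zero]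
    have e4 : (2 * volume P) ^ n * ∏ i, ∫⁻ y in R, h i y
        ≤ volume R ^ n * ∏ i, ∫⁻ y in P, h i y := by
      calc (2 * volume P) ^ n * ∏ i, ∫⁻ y in R, h i y
          = volume P ^ n * (2 ^ n * ∏ i, ∫⁻ y in R, h i y) := by rw [mul_pow]; ring
        _ ≤ (volume P ^ γ * volume R ^ (n - γ)) * (2 ^ n * ∏ i, ∫⁻ y in R, h i y) := by gcongr
        _ = (volume P ^ γ * volume R ^ n) * (2 ^ n * cubeValue γ h R) := by
          rw [e2, cubeValue]; ring
        _ ≤ (volume P ^ γ * volume R ^ n) * cubeValue γ h P := by gcongr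
        _ = (volume P ^ γ * volume P ^ (-γ)) * (volume R ^ n * ∏ i, ∫⁻ y in P, h i y) := by
          rw [cubeValue]; ring
        _ = _ := by rw [e3, one_mul]
    have hprod0 : ∏ i, ∫⁻ y in R, h i y ≠ 0 := Finset.prod_ne_zero_iff.mpr fun i _ => hH i
    have hprodt : ∏ i, ∫⁻ y in R, h i y ≠ ∞ := ENNReal.prod_ne_top fun i _ => hh i
    have e5 : (2 * volume P) ^ n ≤ volume R ^ n * ∏ i, x i P := by
      have : ∏ i, x i P = (∏ i, ∫⁻ y in P, h i y) / ∏ i, ∫⁻ y in R, h i y := by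
        simp only [x, div_eq_mul_inv, Finset.prod_mul_distrib]
        congr 1
        exact (ENNReal.prod_inv_distrib fun i _ j _ _ => Or.inl (hH i)).symm
      rw [this, ← mul_div_assoc, ENNReal.le_div_iff_mul_le (Or.inl hprod0) (Or.inl hprodt)]
      exact e4
    have e6 := ENNReal.rpow_le_rpow e5 (inv_nonneg.mpr hnpos.le)
    rwa [ENNReal.mul_rpow_of_nonneg _ _ (inv_nonneg.mpr hnpos.le), ← ENNReal.rpow_natCast,
      ← ENNReal.rpow_natCast, ENNReal.rpow_rpow_inv hn0, ENNReal.rpow_rpow_inv hn0,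
      ← ENNReal.prod_rpow_of_nonneg (inv_nonneg.mpr hnpos.le)] at e6
  have hx : ∀ i, ∑ P ∈ G, x i P ≤ 1 := by
    intro i
    simp only [x, div_eq_mul_inv]
    rw [← Finset.sum_mul, ← div_eq_mul_inv]
    refine ENNReal.div_le_of_le_mul ?_
    rw [one_mul]
    have h1 := lintegral_biUnion_finset (μ := volume) (t := id) hdis (fun P hP => (hG P hP).1) (h i)
    simp only [id] at h1
    rw [← h1]
    exact lintegral_mono_set (Set.iUnion₂_subset fun P hP => (hv P hP).1)
  calc 2 * ∑ P ∈ G, volume P = ∑ P ∈ G, 2 * volume P := Finset.mul_sum _ _ _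
    _ ≤ ∑ P ∈ G, volume R * ∏ i, x i P ^ (n : ℝ)⁻¹ := Finset.sum_le_sum key
    _ = volume R * ∑ P ∈ G, ∏ i, x i P ^ (n : ℝ)⁻¹ := (Finset.mul_sum _ _ _).symm
    _ ≤ volume R * ∏ i, (∑ P ∈ G, x i P) ^ (n : ℝ)⁻¹ := by
        gcongr
        exact sum_prod_rpow_le G x (by simp [hn0]) fun _ => inv_nonneg.mpr hnpos.le
    _ ≤ volume R * 1 := by
        gcongr
        exact Finset.prod_le_one' fun i _ => ENNReal.rpow_le_one (hx i) (inv_nonneg.mpr hnpos.le)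
    _ = volume R := mul_one _

/-- The maximal function of a finite family of grid cubes is dominated by a sum over a sparse
subfamily. -/
theorem exists_sparse_lintegral_maxOver_le (hn : 1 ≤ n) {γ : ℝ} (hγn : γ ≤ n)
    {h : Fin n → (Fin d → ℝ) → ℝ≥0∞} {β : Fin d → Bool} {F : Finset (Set (Fin d → ℝ))}
    (hF : (F : Set (Set (Fin d → ℝ))) ⊆ grid β) (hh : ∀ Q ∈ F, ∀ i, ∫⁻ y in Q, h i y ≠ ∞)
    (ν : Measure (Fin d → ℝ)) {q : ℝ} (hq : 0 < q) :
    ∃ S ⊆ F, IsSparse volume S ∧ ∫⁻ x, maxOver F (cubeValue γ h) x ^ q ∂ν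
      ≤ (2 ^ n) ^ q * ∑ Q ∈ S, ν Q * cubeValue γ h Q ^ q := by
  obtain ⟨S, hSF, hcov, hgrow⟩ := exists_principal F (cubeValue γ h)
    (one_le_pow₀ (by norm_num) : (1 : ℝ≥0∞) ≤ 2 ^ n)
  have hS : (S : Set (Set (Fin d → ℝ))) ⊆ grid β := (Finset.coe_subset.mpr hSF).trans hF
  have hSm : ∀ Q ∈ S, MeasurableSet Q := fun Q hQ => (mem_grid_volume (hS hQ)).1
  refine ⟨S, hSF, ?_, ?_⟩
  · refine isSparse_of_principal ((laminar_grid β).mono hS) hSm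
      (fun Q hQ => (mem_grid_volume (hS hQ)).2.2) hgrow fun R hR G hG hdis hv => ?_
    exact two_mul_sum_volume_le hn hγn (mem_grid_volume (hS hR)).2.1
      (mem_grid_volume (hS hR)).2.2 (hh R (hSF hR)) hdis
      (fun P hP => mem_grid_volume (hS (hG hP))) hv
  · have hC : ((2 : ℝ≥0∞) ^ n) ^ q ≠ ∞ :=
      ENNReal.rpow_ne_top_of_nonneg hq.le (ENNReal.pow_ne_top (by norm_num))
    calc ∫⁻ x, maxOver F (cubeValue γ h) x ^ q ∂ν
        ≤ ∫⁻ x, (2 ^ n) ^ q * maxOver S (cubeValue γ h) x ^ q ∂ν := by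
          refine lintegral_mono fun x => ?_
          rw [← ENNReal.mul_rpow_of_nonneg _ _ hq.le]
          refine ENNReal.rpow_le_rpow (maxOver_le fun Q hQ hx => ?_) hq.le
          obtain ⟨R, hR, hQR, hle⟩ := hcov Q hQ
          refine hle.trans ?_
          gcongr
          exact le_maxOver hR (hQR hx)
      _ = (2 ^ n) ^ q * ∫⁻ x, maxOver S (cubeValue γ h) x ^ q ∂ν := lintegral_const_mul' _ _ hC
      _ ≤ _ := by gcongr; exact lintegral_maxOver_rpow_le_sum ν hSm hq

/-! ### Two weight estimates with power functions -/

theorem cubeValue_eq_mul_prod_average {γ : ℝ} {h g : Fin n → (Fin d → ℝ) → ℝ≥0∞}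
    {μ : Fin n → Measure (Fin d → ℝ)} {Q : Set (Fin d → ℝ)}
    (hhg : ∀ i, ∫⁻ y in Q, h i y = ∫⁻ y in Q, g i y ∂(μ i)) (hμ : ∀ i, μ i Q ≠ 0 ∧ μ i Q ≠ ∞) :
    cubeValue γ h Q = (volume Q ^ (-γ) * ∏ i, μ i Q) * ∏ i, (∫⁻ y in Q, g i y ∂(μ i)) / μ i Q := by
  rw [cubeValue, mul_assoc, ← Finset.prod_mul_distrib]
  congr 1
  refine Finset.prod_congr rfl fun i _ => ?_
  rw [hhg, ENNReal.mul_div_cancel (hμ i).1 (hμ i).2]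

/-- The data of a multilinear estimate from `∏ᵢ L^{pᵢ}(μᵢ)` over a finite family `F` of grid
cubes: exponents with `1 / p = ∑ᵢ 1 / pᵢ` and `p ≤ q`, and functions `hᵢ = gᵢ dμᵢ / dx` with
`gᵢ ∈ L^{pᵢ}(μᵢ)`. -/
structure PowerSetting (γ p q : ℝ) (P P' : Fin n → ℝ) (h g : Fin n → (Fin d → ℝ) → ℝ≥0∞)
    (μ : Fin n → Measure (Fin d → ℝ)) (β : Fin d → Bool) (F : Finset (Set (Fin d → ℝ))) :
    Prop where
  one_le : 1 ≤ n
  le_card : γ ≤ n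
  conj : ∀ i, (P i).HolderConjugate (P' i)
  pos : 0 < p
  sum_inv : p⁻¹ = ∑ i, (P i)⁻¹
  le_exponent : p ≤ q
  subset_grid : (F : Set (Set (Fin d → ℝ))) ⊆ grid β
  measure : ∀ Q ∈ F, ∀ i, μ i Q ≠ 0 ∧ μ i Q ≠ ∞
  aemeasurable : ∀ i, AEMeasurable (g i) (μ i)
  lintegral_ne_top : ∀ i, ∫⁻ x, g i x ^ P i ∂(μ i) ≠ ∞
  lintegral_eq : ∀ Q ∈ F, ∀ i, ∫⁻ y in Q, h i y = ∫⁻ y in Q, g i y ∂(μ i)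

namespace PowerSetting

variable {γ p q : ℝ} {P P' : Fin n → ℝ} {h g : Fin n → (Fin d → ℝ) → ℝ≥0∞}
  {μ : Fin n → Measure (Fin d → ℝ)} {β : Fin d → Bool} {F S : Finset (Set (Fin d → ℝ))}

theorem mono (H : PowerSetting γ p q P P' h g μ β F) (hS : S ⊆ F) :
    PowerSetting γ p q P P' h g μ β S :=
  { H with
    subset_grid := (Finset.coe_subset.mpr hS).trans H.subset_grid
    measure := fun Q hQ => H.measure Q (hS hQ)
    lintegral_eq := fun Q hQ => H.lintegral_eq Q (hS hQ) }

theorem measurableSet (H : PowerSetting γ p q P P' h g μ β F) :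
    ∀ Q ∈ F, MeasurableSet Q := fun _ hQ => (mem_grid_volume (H.subset_grid hQ)).1

theorem laminar (H : PowerSetting γ p q P P' h g μ β F) :
    Laminar (F : Set (Set (Fin d → ℝ))) := (laminar_grid β).mono H.subset_grid

theorem exponent_pos (H : PowerSetting γ p q P P' h g μ β F) : 0 < q :=
  H.pos.trans_le H.le_exponent

theorem average_ne_top (H : PowerSetting γ p q P P' h g μ β F) {Q : Set (Fin d → ℝ)} (hQ : Q ∈ F)
    (i : Fin n) : (∫⁻ y in Q, g i y ∂(μ i)) / μ i Q ≠ ∞ :=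
  ENNReal.div_ne_top (setLIntegral_ne_top_of_rpow (H.aemeasurable i) (H.conj i)
    (H.lintegral_ne_top i) (H.measure Q hQ i).2) (H.measure Q hQ i).1

theorem lintegral_maxOver_average (H : PowerSetting γ p q P P' h g μ β F) (i : Fin n) :
    ∫⁻ x, maxOver F (fun Q => (∫⁻ y in Q, g i y ∂(μ i)) / μ i Q) x ^ P i ∂(μ i)
      ≤ ENNReal.ofReal (P' i) ^ P i * ∫⁻ x, g i x ^ P i ∂(μ i) :=
  lintegral_maxOver_average_rpow_le (μ i) H.laminar H.measurableSet
    (fun Q hQ => (H.measure Q hQ i).2) (H.aemeasurable i) (H.conj i)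

theorem maximal_bound_ne_top (H : PowerSetting γ p q P P' h g μ β F) (i : Fin n) :
    ENNReal.ofReal (P' i) ^ P i * ∫⁻ x, g i x ^ P i ∂(μ i) ≠ ∞ :=
  ENNReal.mul_ne_top (ENNReal.rpow_ne_top_of_nonneg (H.conj i).pos.le ENNReal.ofReal_ne_top)
    (H.lintegral_ne_top i)

theorem sum_theta (H : PowerSetting γ p q P P' h g μ β F) : ∑ i, p * (P i)⁻¹ = 1 := by
  rw [← Finset.mul_sum, ← H.sum_inv, mul_inv_cancel₀ H.pos.ne']

theorem exists_sparse (H : PowerSetting γ p q P P' h g μ β F) (ν : Measure (Fin d → ℝ)) :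
    ∃ S ⊆ F, IsSparse volume S ∧ ∫⁻ x, maxOver F (cubeValue γ h) x ^ q ∂ν
      ≤ (2 ^ n) ^ q * ∑ Q ∈ S, (ν Q * (volume Q ^ (-γ) * ∏ i, μ i Q) ^ q) *
        (∏ i, (∫⁻ y in Q, g i y ∂(μ i)) / μ i Q) ^ q := by
  obtain ⟨S, hS, hsp, hle⟩ := exists_sparse_lintegral_maxOver_le H.one_le H.le_card
    (h := h) H.subset_grid (fun Q hQ i => by
      rw [H.lintegral_eq Q hQ i]
      exact setLIntegral_ne_top_of_rpow (H.aemeasurable i) (H.conj i) (H.lintegral_ne_top i)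
        (H.measure Q hQ i).2) ν H.exponent_pos
  refine ⟨S, hS, hsp, hle.trans_eq ?_⟩
  congr 1
  refine Finset.sum_congr rfl fun Q hQ => ?_
  rw [cubeValue_eq_mul_prod_average (H.lintegral_eq Q (hS hQ)) (H.measure Q (hS hQ)),
    ENNReal.mul_rpow_of_nonneg _ _ H.exponent_pos.le, mul_assoc]

/-- If the testing quantity of a cube is controlled by a product of Carleson sequences, one for
each `μᵢ`, then Hölder's inequality separates the factors. -/
theorem lintegral_le_of_prod_carleson (H : PowerSetting γ p q P P' h g μ β F)
    (ν : Measure (Fin d → ℝ)) {K : ℝ≥0∞} {c : Fin n → Set (Fin d → ℝ) → ℝ≥0∞} {A : Fin n → ℝ≥0∞}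
    (hA : ∀ i, A i ≠ ∞)
    (htest : ∀ Q ∈ F, ν Q * (volume Q ^ (-γ) * ∏ i, μ i Q) ^ q ≤ K * ∏ i, c i Q ^ (q * (P i)⁻¹))
    (hcarl : ∀ i, ∀ S ⊆ F, IsSparse volume S → ∀ R ∈ F, (∀ Q ∈ S, Q ⊆ R) →
      ∑ Q ∈ S, c i Q ≤ A i * μ i R) :
    ∫⁻ x, maxOver F (cubeValue γ h) x ^ q ∂ν
      ≤ (2 ^ n) ^ q * (K * ∏ i, (A i * (ENNReal.ofReal (P' i) ^ P i *
        ∫⁻ x, g i x ^ P i ∂(μ i))) ^ (q * (P i)⁻¹)) := by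
  obtain ⟨S, hS, hsp, hle⟩ := H.exists_sparse ν
  have HS := H.mono hS
  have hq := H.exponent_pos
  have hPpos : ∀ i, 0 < P i := fun i => (H.conj i).pos
  refine hle.trans (mul_le_mul_right ?_ _)
  set b : Fin n → Set (Fin d → ℝ) → ℝ≥0∞ := fun i Q => (∫⁻ y in Q, g i y ∂(μ i)) / μ i Q
  have hθ : 1 ≤ q / p := (one_le_div H.pos).mpr H.le_exponent
  have hθe : ∀ i, q * (P i)⁻¹ = p * (P i)⁻¹ * (q / p) := fun i => by
    have := H.pos.ne'
    field_simp
  have hsplit : ∀ z : Fin n → ℝ≥0∞,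
      ∏ i, z i ^ (q * (P i)⁻¹) = (∏ i, z i ^ (p * (P i)⁻¹)) ^ (q / p) := by
    intro z
    rw [← ENNReal.prod_rpow_of_nonneg (by linarith)]
    refine Finset.prod_congr rfl fun i _ => ?_
    rw [← ENNReal.rpow_mul, ← hθe]
  have hsum : ∀ i, ∑ Q ∈ S, c i Q * b i Q ^ P i
      ≤ A i * (ENNReal.ofReal (P' i) ^ P i * ∫⁻ x, g i x ^ P i ∂(μ i)) := by
    intro i
    have hb := HS.lintegral_maxOver_average i
    have := sum_mul_rpow_le_of_carleson (μ i) HS.laminar HS.measurableSet (a := c i) (b := b i)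
      (fun Q hQ => HS.average_ne_top hQ i) (hPpos i) le_rfl (hA i)
      (fun R hR G hG hGR => by
        rw [ENNReal.rpow_one]
        exact hcarl i G (hG.trans hS) (hsp.mono hG) R (hS hR) hGR)
      (ne_top_of_le_ne_top (H.maximal_bound_ne_top i) hb)
    rw [mul_one, ENNReal.ofReal_one, one_mul, ENNReal.rpow_one] at this
    exact this.trans (mul_le_mul_right hb _)
  calc ∑ Q ∈ S, (ν Q * (volume Q ^ (-γ) * ∏ i, μ i Q) ^ q) * (∏ i, b i Q) ^ q
      ≤ ∑ Q ∈ S, K * (∏ i, (c i Q * b i Q ^ P i) ^ (p * (P i)⁻¹)) ^ (q / p) := by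
        refine Finset.sum_le_sum fun Q hQ => ?_
        rw [← hsplit]
        refine (mul_le_mul_left (htest Q (hS hQ)) _).trans_eq ?_
        rw [mul_assoc, ← ENNReal.prod_rpow_of_nonneg hq.le, ← Finset.prod_mul_distrib]
        congr 1
        refine Finset.prod_congr rfl fun i _ => ?_
        have := hPpos i
        rw [ENNReal.mul_rpow_of_nonneg _ _ (by positivity), ← ENNReal.rpow_mul]
        congr 2
        field_simp
    _ = K * ∑ Q ∈ S, (∏ i, (c i Q * b i Q ^ P i) ^ (p * (P i)⁻¹)) ^ (q / p) :=
        (Finset.mul_sum _ _ _).symm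
    _ ≤ K * (∑ Q ∈ S, ∏ i, (c i Q * b i Q ^ P i) ^ (p * (P i)⁻¹)) ^ (q / p) := by
        gcongr
        exact sum_rpow_le_rpow_sum _ _ hθ
    _ ≤ K * (∏ i, (∑ Q ∈ S, c i Q * b i Q ^ P i) ^ (p * (P i)⁻¹)) ^ (q / p) := by
        gcongr
        exact sum_prod_rpow_le S (fun i Q => c i Q * b i Q ^ P i) H.sum_theta
          fun i => mul_nonneg H.pos.le (inv_nonneg.mpr (hPpos i).le)
    _ = K * ∏ i, (∑ Q ∈ S, c i Q * b i Q ^ P i) ^ (q * (P i)⁻¹) := by rw [hsplit]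
    _ ≤ _ := by
        gcongr with i
        · have := hPpos i
          positivity
        · exact hsum i

/-- If the testing quantity of a cube is controlled by a sequence that satisfies the Carleson
condition of order `q / p` for a measure `κ` dominated by the geometric mean of the `μᵢ`, then the
Carleson embedding applies to the products of averages. -/
theorem lintegral_le_of_carleson (H : PowerSetting γ p q P P' h g μ β F)
    (ν κ : Measure (Fin d → ℝ)) {K A L : ℝ≥0∞} (hA : A ≠ ∞) (hL : L ≠ ∞)
    {c : Set (Fin d → ℝ) → ℝ≥0∞}
    (htest : ∀ Q ∈ F, ν Q * (volume Q ^ (-γ) * ∏ i, μ i Q) ^ q ≤ K * c Q)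
    (hcarl : ∀ S ⊆ F, IsSparse volume S → ∀ R ∈ F, (∀ Q ∈ S, Q ⊆ R) →
      ∑ Q ∈ S, c Q ≤ A * κ R ^ (q / p))
    (hκ : ∀ M : Fin n → (Fin d → ℝ) → ℝ≥0∞, (∀ i, Measurable (M i)) →
      ∫⁻ x, ∏ i, M i x ^ p ∂κ ≤ L * ∏ i, (∫⁻ x, M i x ^ P i ∂(μ i)) ^ (p * (P i)⁻¹)) :
    ∫⁻ x, maxOver F (cubeValue γ h) x ^ q ∂ν
      ≤ (2 ^ n) ^ q * (K * (ENNReal.ofReal (q / p) * A * (L * ∏ i, (ENNReal.ofReal (P' i) ^ P i *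
        ∫⁻ x, g i x ^ P i ∂(μ i)) ^ (p * (P i)⁻¹)) ^ (q / p))) := by
  obtain ⟨S, hS, hsp, hle⟩ := H.exists_sparse ν
  have HS := H.mono hS
  have hq := H.exponent_pos
  have hp := H.pos
  have hPpos : ∀ i, 0 < P i := fun i => (H.conj i).pos
  have hPp : ∀ i, 0 ≤ p * (P i)⁻¹ := fun i => mul_nonneg hp.le (inv_nonneg.mpr (hPpos i).le)
  refine hle.trans (mul_le_mul_right ?_ _)
  set b : Fin n → Set (Fin d → ℝ) → ℝ≥0∞ := fun i Q => (∫⁻ y in Q, g i y ∂(μ i)) / μ i Q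
  have hθ : 1 ≤ q / p := (one_le_div hp).mpr H.le_exponent
  have hJ : ∫⁻ x, maxOver S (fun Q => ∏ i, b i Q) x ^ p ∂κ
      ≤ L * ∏ i, (ENNReal.ofReal (P' i) ^ P i * ∫⁻ x, g i x ^ P i ∂(μ i)) ^ (p * (P i)⁻¹) := by
    calc ∫⁻ x, maxOver S (fun Q => ∏ i, b i Q) x ^ p ∂κ
        ≤ ∫⁻ x, ∏ i, maxOver S (b i) x ^ p ∂κ := by
          refine lintegral_mono fun x => ?_
          rw [ENNReal.prod_rpow_of_nonneg hp.le]
          exact ENNReal.rpow_le_rpow (maxOver_le fun Q hQ hx =>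
            Finset.prod_le_prod' fun i _ => le_maxOver hQ hx) hp.le
      _ ≤ L * ∏ i, (∫⁻ x, maxOver S (b i) x ^ P i ∂(μ i)) ^ (p * (P i)⁻¹) :=
          hκ _ fun i => measurable_maxOver HS.measurableSet _
      _ ≤ _ := by
          gcongr with i
          · exact hPp i
          · exact HS.lintegral_maxOver_average i
  have hJt := ENNReal.mul_ne_top hL (ENNReal.prod_ne_top fun i (_ : i ∈ Finset.univ) =>
    ENNReal.rpow_ne_top_of_nonneg (hPp i) (H.maximal_bound_ne_top i))
  have hC := sum_mul_rpow_le_of_carleson κ HS.laminar HS.measurableSet (a := c)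
    (b := fun Q => ∏ i, b i Q)
    (fun Q hQ => ENNReal.prod_ne_top fun i _ => HS.average_ne_top hQ i) hp hθ hA
    (fun R hR G hG hGR => hcarl G (hG.trans hS) (hsp.mono hG) R (hS hR) hGR)
    (ne_top_of_le_ne_top hJt hJ)
  rw [mul_div_cancel₀ _ hp.ne'] at hC
  calc ∑ Q ∈ S, (ν Q * (volume Q ^ (-γ) * ∏ i, μ i Q) ^ q) * (∏ i, b i Q) ^ q
      ≤ ∑ Q ∈ S, K * (c Q * (∏ i, b i Q) ^ q) := by
        refine Finset.sum_le_sum fun Q hQ => ?_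
        rw [← mul_assoc]
        exact mul_le_mul_left (htest Q (hS hQ)) _
    _ = K * ∑ Q ∈ S, c Q * (∏ i, b i Q) ^ q := (Finset.mul_sum _ _ _).symm
    _ ≤ _ := by
        gcongr
        refine hC.trans ?_
        gcongr

end PowerSetting

end OrliczMax

namespace OrliczMax

/-! ### Weights and Carleson sequences -/

variable {d n : ℕ}

/-- The measure with density `σ`. -/
def weightMeasure (σ : (Fin d → ℝ) → ℝ) : Measure (Fin d → ℝ) :=
  volume.withDensity fun x => ENNReal.ofReal (σ x)

theorem weightMeasure_apply (σ : (Fin d → ℝ) → ℝ) {Q : Set (Fin d → ℝ)} (hQ : MeasurableSet Q) :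
    weightMeasure σ Q = mass σ Q := withDensity_apply _ hQ

theorem mass_congr (σ : (Fin d → ℝ) → ℝ) {P Q : Set (Fin d → ℝ)} (h : P =ᵐ[volume] Q) :
    mass σ P = mass σ Q := setLIntegral_congr h

theorem cubes_isCompact {Q : Set (Fin d → ℝ)} (hQ : Q ∈ cubes d) : IsCompact Q := by
  obtain ⟨a, l, -, rfl⟩ := hQ
  exact isCompact_Icc

theorem IsWeight.aemeasurable {σ : (Fin d → ℝ) → ℝ} (hσ : IsWeight σ) :
    AEMeasurable fun x => ENNReal.ofReal (σ x) :=
  hσ.locallyIntegrable.aestronglyMeasurable.aemeasurable.ennreal_ofReal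

theorem IsWeight.integrableOn {σ : (Fin d → ℝ) → ℝ} (hσ : IsWeight σ) {Q : Set (Fin d → ℝ)}
    (hQ : Q ∈ cubes d) : IntegrableOn σ Q :=
  hσ.locallyIntegrable.integrableOn_isCompact (cubes_isCompact hQ)

theorem IsWeight.mass_ne_top {σ : (Fin d → ℝ) → ℝ} (hσ : IsWeight σ) {Q : Set (Fin d → ℝ)}
    (hQ : Q ∈ cubes d) : mass σ Q ≠ ∞ :=
  ((lintegral_mono fun _ => Real.ofReal_le_enorm _).trans_lt (hσ.integrableOn hQ).2).ne

theorem lintegral_ne_zero_of_ae_pos {w : (Fin d → ℝ) → ℝ≥0∞} (hw : AEMeasurable w)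
    (hpos : ∀ᵐ x, 0 < w x) {Q : Set (Fin d → ℝ)} (hQ : volume Q ≠ 0) : ∫⁻ x in Q, w x ≠ 0 := by
  rw [Ne, lintegral_eq_zero_iff' hw.restrict]
  intro h0
  have h1 : ∀ᵐ _ ∂(volume.restrict Q), False := by
    filter_upwards [h0, ae_restrict_of_ae hpos] with x hx hx'
    exact hx'.ne' hx
  rw [Filter.eventually_false_iff_eq_bot, ae_eq_bot, Measure.restrict_eq_zero] at h1
  exact hQ h1

theorem IsWeight.mass_ne_zero {σ : (Fin d → ℝ) → ℝ} (hσ : IsWeight σ) {Q : Set (Fin d → ℝ)}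
    (hQ : volume Q ≠ 0) : mass σ Q ≠ 0 :=
  lintegral_ne_zero_of_ae_pos hσ.aemeasurable
    (hσ.pos.mono fun _ hx => ENNReal.ofReal_pos.mpr hx) hQ

theorem IsWeight.weightMeasure_grid {σ : (Fin d → ℝ) → ℝ} (hσ : IsWeight σ)
    {β : Fin d → Bool} {P : Set (Fin d → ℝ)} (hP : P ∈ grid β) :
    weightMeasure σ P ≠ 0 ∧ weightMeasure σ P ≠ ∞ := by
  obtain ⟨Q, hQ, -, hae⟩ := exists_cube_of_mem_grid hP
  rw [weightMeasure_apply σ (mem_grid_volume hP).1]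
  refine ⟨hσ.mass_ne_zero (mem_grid_volume hP).2.1, ?_⟩
  rw [mass_congr σ hae]
  exact hσ.mass_ne_top hQ

theorem IsWeight.lintegral_weightMeasure {σ : (Fin d → ℝ) → ℝ} (hσ : IsWeight σ)
    {g : (Fin d → ℝ) → ℝ≥0∞} (hg : AEMeasurable g) :
    ∫⁻ x, g x ∂(weightMeasure σ) = ∫⁻ x, g x * ENNReal.ofReal (σ x) := by
  rw [weightMeasure, lintegral_withDensity_eq_lintegral_mul₀ hσ.aemeasurable hg]
  simp only [Pi.mul_apply, mul_comm]

/-- The integral of `|σ f|` over `Q` is the integral of `|f|` with respect to `σ dx`. -/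
theorem IsWeight.setLIntegral_enorm_mul {σ : (Fin d → ℝ) → ℝ} (hσ : IsWeight σ)
    {f : (Fin d → ℝ) → ℂ} (hf : AEStronglyMeasurable f volume) {Q : Set (Fin d → ℝ)}
    (hQ : MeasurableSet Q) :
    ∫⁻ y in Q, ‖(σ y : ℂ) * f y‖ₑ = ∫⁻ y in Q, ‖f y‖ₑ ∂(weightMeasure σ) := by
  rw [weightMeasure, restrict_withDensity hQ,
    lintegral_withDensity_eq_lintegral_mul₀ hσ.aemeasurable.restrict hf.enorm.restrict]
  refine lintegral_congr_ae (ae_restrict_of_ae (hσ.pos.mono fun x hx => ?_))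
  simp only [Pi.mul_apply, enorm_mul]
  congr 1
  rw [← ofReal_norm, Complex.norm_real, Real.norm_of_nonneg hx.le]

/-- Averages over half-open grid cubes are dominated by the maximal function. -/
theorem average_le_hlMax {E : Type*} [ENorm E] (f : (Fin d → ℝ) → E) {β : Fin d → Bool}
    {P : Set (Fin d → ℝ)} (hP : P ∈ grid β) {x : Fin d → ℝ} (hx : x ∈ P) :
    (∫⁻ y in P, ‖f y‖ₑ) / volume P ≤ hlMax f x := by
  have h1 := maxOver_cubeValue_le_fracMax (n := 1) 0 (fun _ => f) (F := {P}) (β := β)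
    (by simpa using hP) x
  refine le_trans ?_ h1
  refine le_trans (le_of_eq ?_) (le_maxOver (Finset.mem_singleton_self P) hx)
  simp [cubeValue, div_eq_mul_inv, mul_comm, ENNReal.rpow_neg]

theorem weightMeasure_div_le_hlMax (σ : (Fin d → ℝ) → ℝ) {β : Fin d → Bool}
    {P : Set (Fin d → ℝ)} (hP : P ∈ grid β) {R : Set (Fin d → ℝ)} (hPR : P ⊆ R) {x : Fin d → ℝ}
    (hx : x ∈ P) : weightMeasure σ P / volume P ≤ hlMax (R.indicator σ) x := by
  refine le_trans ?_ (average_le_hlMax _ hP hx)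
  rw [weightMeasure_apply σ (mem_grid_volume hP).1]
  gcongr
  refine setLIntegral_mono' (mem_grid_volume hP).1 fun y hy => ?_
  rw [Set.indicator_of_mem (hPR hy)]
  exact Real.ofReal_le_enorm _

/-- The Fujii–Wilson condition makes `σ(Q)` a Carleson sequence over sparse families. -/
theorem sum_weightMeasure_le_constAInfty {σ : (Fin d → ℝ) → ℝ} (hσ : IsWeight σ)
    {β : Fin d → Bool} {S : Finset (Set (Fin d → ℝ))} (hS : (S : Set (Set (Fin d → ℝ))) ⊆ grid β)
    (hsp : IsSparse volume S) {R : Set (Fin d → ℝ)} (hR : R ∈ grid β) (hSR : ∀ Q ∈ S, Q ⊆ R) :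
    ∑ Q ∈ S, weightMeasure σ Q ≤ 2 * constAInfty σ * weightMeasure σ R := by
  obtain ⟨R', hR', hRR', hae⟩ := exists_cube_of_mem_grid hR
  calc ∑ Q ∈ S, weightMeasure σ Q
      = ∑ Q ∈ S, volume Q * (weightMeasure σ Q / volume Q) := Finset.sum_congr rfl fun Q hQ => by
        rw [ENNReal.mul_div_cancel (mem_grid_volume (hS hQ)).2.1 (mem_grid_volume (hS hQ)).2.2]
    _ ≤ 2 * ∫⁻ x in R', hlMax (R'.indicator σ) x :=
        hsp.sum_mul_le (fun Q hQ => (hSR Q hQ).trans hRR') fun Q hQ x hx =>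
          weightMeasure_div_le_hlMax σ (hS hQ) ((hSR Q hQ).trans hRR') hx
    _ ≤ 2 * (constAInfty σ * mass σ R') := by
        gcongr
        have h1 : (mass σ R')⁻¹ * ∫⁻ x in R', hlMax (R'.indicator σ) x ≤ constAInfty σ :=
          le_iSup₂ (f := fun Q (_ : Q ∈ cubes d) =>
            (mass σ Q)⁻¹ * ∫⁻ x in Q, hlMax (Q.indicator σ) x) R' hR'
        rwa [ENNReal.inv_mul_le_iff (hσ.mass_ne_zero (cubes_volume hR').1) (hσ.mass_ne_top hR'),
          mul_comm] at h1
    _ = 2 * constAInfty σ * weightMeasure σ R := by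
        rw [weightMeasure_apply σ (mem_grid_volume hR).1, mass_congr σ hae, mul_assoc]

/-- The sequence `|Q| (|Q|⁻¹ ∫_Q σ^{1/2})²` over a sparse family is a Carleson sequence, by the
maximal inequality in `L²`. -/
theorem sum_volume_mul_sq_average_le {s : (Fin d → ℝ) → ℝ≥0∞} (hs : AEMeasurable s)
    {β : Fin d → Bool} {S : Finset (Set (Fin d → ℝ))} (hS : (S : Set (Set (Fin d → ℝ))) ⊆ grid β)
    (hsp : IsSparse volume S) {R : Set (Fin d → ℝ)} (hR : MeasurableSet R)
    (hSR : ∀ Q ∈ S, Q ⊆ R) :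
    ∑ Q ∈ S, volume Q * ((∫⁻ y in Q, s y ^ (2⁻¹ : ℝ)) / volume Q) ^ (2 : ℝ)
      ≤ 8 * ∫⁻ y in R, s y := by
  set f : (Fin d → ℝ) → ℝ≥0∞ := R.indicator fun y => s y ^ (2⁻¹ : ℝ)
  have hf : AEMeasurable f := (hs.pow_const _).indicator hR
  have hfQ : ∀ Q ∈ S, ∫⁻ y in Q, s y ^ (2⁻¹ : ℝ) = ∫⁻ y in Q, f y := fun Q hQ =>
    setLIntegral_congr_fun (mem_grid_volume (hS hQ)).1 fun y hy => by
      simp only [f, Set.indicator_of_mem (hSR Q hQ hy)]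
  have h22 : (2 : ℝ).HolderConjugate 2 := Real.HolderConjugate.two_two
  calc ∑ Q ∈ S, volume Q * ((∫⁻ y in Q, s y ^ (2⁻¹ : ℝ)) / volume Q) ^ (2 : ℝ)
      = ∑ Q ∈ S, volume Q * ((∫⁻ y in Q, f y) / volume Q) ^ (2 : ℝ) :=
        Finset.sum_congr rfl fun Q hQ => by rw [hfQ Q hQ]
    _ ≤ 2 * ∫⁻ x in Set.univ,
          maxOver S (fun Q => (∫⁻ y in Q, f y) / volume Q) x ^ (2 : ℝ) :=
        hsp.sum_mul_le (fun Q _ => Set.subset_univ Q) fun Q hQ x hx =>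
          ENNReal.rpow_le_rpow (le_maxOver (b := fun Q => (∫⁻ y in Q, f y) / volume Q) hQ hx)
            (by norm_num)
    _ ≤ 2 * (ENNReal.ofReal 2 ^ (2 : ℝ) * ∫⁻ x, f x ^ (2 : ℝ)) := by
        rw [Measure.restrict_univ]
        gcongr
        exact lintegral_maxOver_average_rpow_le volume ((laminar_grid β).mono hS)
          (fun Q hQ => (mem_grid_volume (hS hQ)).1) (fun Q hQ => (mem_grid_volume (hS hQ)).2.2)
          hf h22
    _ = 8 * ∫⁻ y in R, s y := by
        rw [← mul_assoc, ← lintegral_indicator hR]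
        congr 1
        · rw [ENNReal.ofReal_ofNat, ENNReal.rpow_ofNat]
          norm_num
        · refine lintegral_congr fun x => ?_
          by_cases hx : x ∈ R
          · simp only [f, Set.indicator_of_mem hx]
            rw [ENNReal.rpow_inv_rpow (by norm_num)]
          · simp [f, Set.indicator_of_notMem hx]

/-- Jensen's inequality: the geometric mean of `σ` is at most the square of the mean of
`σ^{1/2}`. If `log (1 / σ)` is not integrable on `Q`, the left side is `∞⁻¹ = 0`. -/
theorem inv_expMeanLogInv_le {σ : (Fin d → ℝ) → ℝ} (hσ : IsWeight σ) {Q : Set (Fin d → ℝ)}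
    (hQ : Q ∈ cubes d) :
    (expMeanLogInv σ Q)⁻¹
      ≤ ((∫⁻ y in Q, ENNReal.ofReal (σ y) ^ (2⁻¹ : ℝ)) / volume Q) ^ (2 : ℝ) := by
  unfold expMeanLogInv
  split_ifs with hint
  swap
  · simp
  obtain ⟨hQ0, hQt⟩ := cubes_volume hQ
  set f : (Fin d → ℝ) → ℝ := fun x => -2⁻¹ * Real.log (1 / σ x)
  have hf : IntegrableOn f Q := hint.const_mul _
  have hexp : ∀ x, 0 < σ x → Real.exp (f x) = σ x ^ (2⁻¹ : ℝ) := by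
    intro x hx
    rw [Real.rpow_def_of_pos hx]
    congr 1
    simp only [f, one_div, Real.log_inv]
    ring
  have hpos : ∀ᵐ x ∂(volume.restrict Q), 0 < σ x := ae_restrict_of_ae hσ.pos
  have hexpint : IntegrableOn (fun x => Real.exp (f x)) Q := by
    refine Integrable.mono' (g := fun x => 1 + σ x)
      ((integrableOn_const hQt).add (hσ.integrableOn hQ))
      (Real.continuous_exp.comp_aestronglyMeasurable hf.aestronglyMeasurable) ?_
    filter_upwards [hpos] with x hx
    rw [Real.norm_of_nonneg (Real.exp_pos _).le, hexp x hx]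
    rcases le_total (σ x) 1 with h1 | h1
    · exact (Real.rpow_le_one hx.le h1 (by norm_num)).trans (by linarith)
    · calc σ x ^ (2⁻¹ : ℝ) ≤ σ x ^ (1 : ℝ) :=
            Real.rpow_le_rpow_of_exponent_le h1 (by norm_num)
        _ ≤ 1 + σ x := by rw [Real.rpow_one]; linarith
  have hJ : Real.exp (⨍ x in Q, f x) ≤ ⨍ x in Q, Real.exp (f x) :=
    convexOn_exp.map_set_average_le Real.continuous_exp.continuousOn isClosed_univ hQ0 hQt
      (Filter.Eventually.of_forall fun _ => Set.mem_univ _) hf hexpint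
  have e1 : ⨍ x in Q, f x = -2⁻¹ * ⨍ x in Q, Real.log (1 / σ x) := by
    simp only [f, setAverage_eq, integral_const_mul, smul_eq_mul]
    ring
  have e2 : ENNReal.ofReal (⨍ x in Q, Real.exp (f x))
      = (∫⁻ y in Q, ENNReal.ofReal (σ y) ^ (2⁻¹ : ℝ)) / volume Q := by
    rw [ofReal_setAverage hexpint (Filter.Eventually.of_forall fun _ => (Real.exp_pos _).le)]
    congr 1
    refine lintegral_congr_ae ?_
    filter_upwards [hpos] with x hx
    rw [hexp x hx, ENNReal.ofReal_rpow_of_pos hx]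
  rw [← e2, ← ENNReal.ofReal_inv_of_pos (Real.exp_pos _), ← Real.exp_neg]
  calc ENNReal.ofReal (Real.exp (-⨍ x in Q, Real.log (1 / σ x)))
      = ENNReal.ofReal (Real.exp (⨍ x in Q, f x)) ^ (2 : ℝ) := by
        rw [ENNReal.ofReal_rpow_of_pos (Real.exp_pos _), ← Real.exp_mul, e1]
        congr 2
        ring
    _ ≤ _ := by gcongr

end OrliczMax

namespace OrliczMax

/-! ### Passage from growth functions to powers -/

variable {d n : ℕ}

/-- The growth functions of the theorem, compared with powers: `Ψ` with `t ^ q`, each `Φᵢ` with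
`t ^ pᵢ`, where `1 < pᵢ`, and `Φ` with `t ^ p`, where `1 / p = ∑ᵢ 1 / pᵢ` and `p ≤ q`. -/
structure PowerGrowth (p q : ℝ) (P P' : Fin n → ℝ) (K : ℝ≥0) (k : Fin n → ℝ≥0)
    (Φs : Fin n → ℝ≥0 → ℝ≥0) (Ψ Φ : ℝ≥0 → ℝ≥0) : Prop where
  one_le : 1 ≤ n
  conj : ∀ i, (P i).HolderConjugate (P' i)
  pos : 0 < p
  sum_inv : p⁻¹ = ∑ i, (P i)⁻¹
  le_exponent : p ≤ q
  powerLike : PowerLike q K Ψ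
  surjective : Function.Surjective Ψ
  powerLike_factor : ∀ i, PowerLike (P i) (k i) (Φs i)
  continuous_factor : ∀ i, Continuous (Φs i)
  surjective_factor : ∀ i, Function.Surjective (Φs i)
  bijective : Function.Bijective Φ
  powerLike_inv : PowerLike p⁻¹ (∏ i, k i ^ (P i)⁻¹) (OrliczMax.inv Φ)

theorem exists_powerGrowth (hn : 1 ≤ n) {Φs : Fin n → ℝ≥0 → ℝ≥0} {Ψ Φ : ℝ≥0 → ℝ≥0}
    (hΦs : ∀ i, ClassUTilde (Φs i) ∧ Nabla2 (Φs i)) (hΨ : ClassUTilde Ψ)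
    (hΦ : Function.Bijective Φ)
    (hΦ_inv : ∀ t, OrliczMax.inv Φ t = ∏ i, OrliczMax.inv (Φs i) t)
    (hΨΦ : MonotoneOn (fun t => Ψ t / Φ t) (Set.Ioi 0)) :
    ∃ p q P P' K k, PowerGrowth (n := n) p q P P' K k Φs Ψ Φ := by
  choose P hP1 k hk using fun i => (hΦs i).1.exists_powerLike
  obtain ⟨q, hq, K, hK⟩ := hΨ.exists_powerLike
  have hP : ∀ i, 1 < P i := fun i =>
    lt_of_le_of_ne (hP1 i) ((hΦs i).2.one_ne_of_powerLike (hk i))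
  have hP0 : ∀ i, 0 < P i := fun i => one_pos.trans (hP i)
  have : Nonempty (Fin n) := ⟨⟨0, by omega⟩⟩
  have hsum : 0 < ∑ i, (P i)⁻¹ :=
    Finset.sum_pos (fun i _ => inv_pos.mpr (hP0 i)) Finset.univ_nonempty
  have hinv : PowerLike (∑ i, (P i)⁻¹) (∏ i, k i ^ (P i)⁻¹) (OrliczMax.inv Φ) := by
    rw [show OrliczMax.inv Φ = fun t => ∏ i, OrliczMax.inv (Φs i) t from funext hΦ_inv]
    exact PowerLike.prod (fun i => (inv_pos.mpr (hP0 i)).le)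
      fun i => (hk i).inv (hP0 i) (hΦs i).2.growth.surjective
  rw [← inv_inv (∑ i, (P i)⁻¹)] at hinv
  refine ⟨(∑ i, (P i)⁻¹)⁻¹, q, P, fun i => (P i).conjExponent, K, k, hn,
    fun i => Real.HolderConjugate.conjExponent (hP i), inv_pos.mpr hsum, inv_inv _, ?_, hK, ?_, hk,
    fun i => (hΦs i).2.growth.continuous, fun i => (hΦs i).2.growth.surjective, hΦ, hinv⟩
  · exact (PowerLike.of_inv (inv_pos.mpr hsum) hΦ hinv).exponent_le hK hΨΦ
  · obtain ⟨_, -, h⟩ := hΨ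
    exact h.classU.growth.surjective

theorem prod_div_rpow_eq {α : ℝ} (hn : 1 ≤ n) (v : ℝ≥0∞)
    (m : Fin n → ℝ≥0∞) :
    ∏ i, m i / v ^ (1 - α / (n * d)) = v ^ (-(n - α / d)) * ∏ i, m i := by
  have hn0 : (n : ℝ) ≠ 0 := by exact_mod_cast (by omega : n ≠ 0)
  simp only [div_eq_mul_inv, Finset.prod_mul_distrib, Finset.prod_const, Finset.card_univ,
    Fintype.card_fin]
  rw [mul_comm]
  congr 1
  rw [← ENNReal.rpow_neg, ← ENNReal.rpow_natCast, ← ENNReal.rpow_mul]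
  congr 1
  rw [mul_inv]
  field_simp

theorem rpow_sum_of_nonneg {ι : Type*} (s : Finset ι) (x : ℝ≥0∞) {θ : ι → ℝ} (hθ : ∀ i, 0 ≤ θ i) :
    ∏ i ∈ s, x ^ θ i = x ^ ∑ i ∈ s, θ i := by
  classical
  induction s using Finset.induction_on with
  | empty => simp
  | insert i s hi ih =>
    rw [Finset.prod_insert hi, Finset.sum_insert hi, ih,
      ENNReal.rpow_add_of_nonneg _ _ (hθ i) (Finset.sum_nonneg fun i _ => hθ i)]

namespace PowerGrowth

variable {p q : ℝ} {P P' : Fin n → ℝ} {K : ℝ≥0} {k : Fin n → ℝ≥0}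
  {Φs : Fin n → ℝ≥0 → ℝ≥0} {Ψ Φ : ℝ≥0 → ℝ≥0}

theorem exponent_pos (H : PowerGrowth p q P P' K k Φs Ψ Φ) : 0 < q :=
  H.pos.trans_le H.le_exponent

theorem exponent_factor_pos (H : PowerGrowth p q P P' K k Φs Ψ Φ) (i : Fin n) : 0 < P i :=
  (H.conj i).pos

theorem mul_inv_nonneg (H : PowerGrowth p q P P' K k Φs Ψ Φ) (i : Fin n) : 0 ≤ q * (P i)⁻¹ :=
  mul_nonneg H.exponent_pos.le (inv_nonneg.mpr (H.exponent_factor_pos i).le)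

theorem theta_nonneg (H : PowerGrowth p q P P' K k Φs Ψ Φ) (i : Fin n) : 0 ≤ p * (P i)⁻¹ :=
  mul_nonneg H.pos.le (inv_nonneg.mpr (H.exponent_factor_pos i).le)

theorem sum_theta (H : PowerGrowth p q P P' K k Φs Ψ Φ) : ∑ i, p * (P i)⁻¹ = 1 := by
  rw [← Finset.mul_sum, ← H.sum_inv, mul_inv_cancel₀ H.pos.ne']

theorem theta_mul (H : PowerGrowth p q P P' K k Φs Ψ Φ) (i : Fin n) :
    p * (P i)⁻¹ * (q / p) = q * (P i)⁻¹ := by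
  have := H.pos.ne'
  field_simp

/-- The constant that arises when `Ψ` of a product of inverse functions is compared with the
corresponding product of powers. -/
def const (q : ℝ) (P : Fin n → ℝ) (K : ℝ≥0) (k : Fin n → ℝ≥0) : ℝ≥0 :=
  (∏ i, k i ^ (P i)⁻¹) ^ q * K

theorem rpow_mul_prod_rpow_le_ext (H : PowerGrowth p q P P' K k Φs Ψ Φ) {r : Fin n → ℝ}
    {φ : Fin n → ℝ≥0 → ℝ≥0}
    (hφ : ∀ i (t : ℝ≥0∞), t ^ r i ≤ (k i ^ (P i)⁻¹ : ℝ≥0) * ext (φ i) t) (v : ℝ≥0∞)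
    (z : Fin n → ℝ≥0∞) :
    v ^ q * ∏ i, z i ^ (q * r i) ≤ const q P K k * ext Ψ (v * ∏ i, ext (φ i) (z i)) := by
  have hq := H.exponent_pos
  have h1 : v * ∏ i, z i ^ r i
      ≤ (∏ i, k i ^ (P i)⁻¹ : ℝ≥0) * (v * ∏ i, ext (φ i) (z i)) := by
    calc v * ∏ i, z i ^ r i ≤ v * ∏ i, ((k i ^ (P i)⁻¹ : ℝ≥0) : ℝ≥0∞) * ext (φ i) (z i) := by
          gcongr with i
          exact hφ i (z i)
      _ = _ := by
          rw [Finset.prod_mul_distrib, ENNReal.ofNNReal_finsetProd]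
          ring
  calc v ^ q * ∏ i, z i ^ (q * r i) = (v * ∏ i, z i ^ r i) ^ q := by
        rw [ENNReal.mul_rpow_of_nonneg _ _ hq.le, ← ENNReal.prod_rpow_of_nonneg hq.le]
        congr 1
        refine Finset.prod_congr rfl fun i _ => ?_
        rw [← ENNReal.rpow_mul, mul_comm]
    _ ≤ ((∏ i, k i ^ (P i)⁻¹ : ℝ≥0) * (v * ∏ i, ext (φ i) (z i))) ^ q := by gcongr
    _ = ((∏ i, k i ^ (P i)⁻¹ : ℝ≥0) : ℝ≥0∞) ^ q * (v * ∏ i, ext (φ i) (z i)) ^ q :=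
        ENNReal.mul_rpow_of_nonneg _ _ hq.le
    _ ≤ ((∏ i, k i ^ (P i)⁻¹ : ℝ≥0) : ℝ≥0∞) ^ q *
          (K * ext Ψ (v * ∏ i, ext (φ i) (z i))) := by
        gcongr
        exact H.powerLike.le_ext hq _
    _ = _ := by
        rw [const, ENNReal.coe_mul, ENNReal.coe_rpow_of_nonneg _ hq.le, mul_assoc]

theorem rpow_le_ext_inv (H : PowerGrowth p q P P' K k Φs Ψ Φ) (i : Fin n) (t : ℝ≥0∞) :
    t ^ (P i)⁻¹ ≤ (k i ^ (P i)⁻¹ : ℝ≥0) * ext (OrliczMax.inv (Φs i)) t :=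
  ((H.powerLike_factor i).inv (H.exponent_factor_pos i) (H.surjective_factor i)).le_ext
    (inv_pos.mpr (H.exponent_factor_pos i)) t

theorem rpow_le_ext_inv_complementary (H : PowerGrowth p q P P' K k Φs Ψ Φ) (i : Fin n)
    (t : ℝ≥0∞) :
    t ^ (P' i)⁻¹ ≤ (k i ^ (P i)⁻¹ : ℝ≥0) * ext (OrliczMax.inv (complementary (Φs i))) t :=
  rpow_le_mul_ext (inv_pos.mpr (H.conj i).symm.pos)
    (NNReal.rpow_pos (H.powerLike_factor i).pos)
    (rpow_le_inv_complementary (H.conj i) (H.powerLike_factor i) (H.continuous_factor i)) t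

theorem prod_rpow_le_ext (H : PowerGrowth p q P P' K k Φs Ψ Φ) (z : Fin n → ℝ≥0∞) :
    ∏ i, z i ^ (q * (P i)⁻¹)
      ≤ const q P K k * ext Ψ (∏ i, ext (OrliczMax.inv (Φs i)) (z i)) := by
  simpa using H.rpow_mul_prod_rpow_le_ext H.rpow_le_ext_inv 1 z

/-- The composition `Ψ ∘ Φ⁻¹` is comparable to `t ^ (q / p)`. -/
theorem rpow_div_le_ext (H : PowerGrowth p q P P' K k Φs Ψ Φ) (t : ℝ≥0∞) :
    t ^ (q / p) ≤ const q P K k * ext Ψ (ext (OrliczMax.inv Φ) t) := by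
  have hq := H.exponent_pos
  calc t ^ (q / p) = (t ^ p⁻¹) ^ q := by rw [← ENNReal.rpow_mul]; congr 1; ring
    _ ≤ ((∏ i, k i ^ (P i)⁻¹ : ℝ≥0) * ext (OrliczMax.inv Φ) t) ^ q := by
        gcongr
        exact H.powerLike_inv.le_ext (inv_pos.mpr H.pos) t
    _ = ((∏ i, k i ^ (P i)⁻¹ : ℝ≥0) : ℝ≥0∞) ^ q * ext (OrliczMax.inv Φ) t ^ q :=
        ENNReal.mul_rpow_of_nonneg _ _ hq.le
    _ ≤ ((∏ i, k i ^ (P i)⁻¹ : ℝ≥0) : ℝ≥0∞) ^ q * (K * ext Ψ (ext (OrliczMax.inv Φ) t)) := by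
        gcongr
        exact H.powerLike.le_ext hq _
    _ = _ := by
        rw [const, ENNReal.coe_mul, ENNReal.coe_rpow_of_nonneg _ hq.le, mul_assoc]

theorem lintegral_rpow_weightMeasure_le (H : PowerGrowth p q P P' K k Φs Ψ Φ) {σ : Fin n → (Fin d → ℝ) → ℝ}
    (hσ : ∀ i, IsWeight (σ i)) {f : Fin n → (Fin d → ℝ) → ℂ}
    (hf : ∀ i, MemOrlicz (Φs i) (σ i) (f i)) (i : Fin n) :
    ∫⁻ x, ‖f i x‖ₑ ^ P i ∂(weightMeasure (σ i)) ≤ k i * luxNorm (Φs i) (σ i) (f i) ^ P i := by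
  rw [(hσ i).lintegral_weightMeasure ((hf i).1.enorm.pow_const _)]
  exact lintegral_rpow_le_luxNorm (H.exponent_factor_pos i) (H.powerLike_factor i) _ _

/-- Bounds for power integrals are bounds for Luxemburg norms. -/
theorem exists_luxNorm_bound (H : PowerGrowth p q P P' K k Φs Ψ Φ) {C : ℝ≥0∞} (hC : C ≠ ∞) :
    ∃ D : ℝ≥0, 0 < D ∧ ∀ (σ : Fin n → (Fin d → ℝ) → ℝ) (ω : (Fin d → ℝ) → ℝ)
      (f : Fin n → (Fin d → ℝ) → ℂ), (∀ i, IsWeight (σ i)) →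
      (∀ i, MemOrlicz (Φs i) (σ i) (f i)) → ∀ (M : (Fin d → ℝ) → ℝ≥0∞) (Y : ℝ≥0∞),
        ∫⁻ x, M x ^ q * ENNReal.ofReal (ω x) ≤ C * Y *
          ∏ i, (∫⁻ x, ‖f i x‖ₑ ^ P i ∂(weightMeasure (σ i))) ^ (q * (P i)⁻¹) →
        luxNorm Ψ ω M ≤ D * ext (OrliczMax.inv Ψ) Y * ∏ i, luxNorm (Φs i) (σ i) (f i) := by
  have hq := H.exponent_pos
  have hq' : 0 < q⁻¹ := inv_pos.mpr hq
  set C' : ℝ≥0∞ := (K * (C * ∏ i, (k i : ℝ≥0∞) ^ (q * (P i)⁻¹))) ^ q⁻¹ * (K ^ q⁻¹ : ℝ≥0)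
  have hC' : C' ≠ ∞ := by
    refine ENNReal.mul_ne_top (ENNReal.rpow_ne_top_of_nonneg hq'.le (ENNReal.mul_ne_top
      ENNReal.coe_ne_top (ENNReal.mul_ne_top hC (ENNReal.prod_ne_top fun i _ =>
        ENNReal.rpow_ne_top_of_nonneg (H.mul_inv_nonneg i) ENNReal.coe_ne_top)))) ENNReal.coe_ne_top
  -- The summand `1` makes the constant positive.
  refine ⟨C'.toNNReal + 1, by positivity, fun σ ω f hσ hf M Y hM => ?_⟩
  have hCle : C' ≤ ((C'.toNNReal + 1 : ℝ≥0) : ℝ≥0∞) := by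
    rw [ENNReal.coe_add, ENNReal.coe_toNNReal hC']
    exact le_self_add
  have hprod : ∏ i, (∫⁻ x, ‖f i x‖ₑ ^ P i ∂(weightMeasure (σ i))) ^ (q * (P i)⁻¹)
      ≤ (∏ i, (k i : ℝ≥0∞) ^ (q * (P i)⁻¹)) * (∏ i, luxNorm (Φs i) (σ i) (f i)) ^ q := by
    rw [← ENNReal.prod_rpow_of_nonneg hq.le, ← Finset.prod_mul_distrib]
    refine Finset.prod_le_prod' fun i _ => ?_
    refine (ENNReal.rpow_le_rpow (H.lintegral_rpow_weightMeasure_le hσ hf i) (H.mul_inv_nonneg i)).trans_eq ?_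
    rw [ENNReal.mul_rpow_of_nonneg _ _ (H.mul_inv_nonneg i), ← ENNReal.rpow_mul]
    congr 2
    have := (H.exponent_factor_pos i).ne'
    field_simp
  calc luxNorm Ψ ω M ≤ (K * ∫⁻ x, M x ^ q * ENNReal.ofReal (ω x)) ^ q⁻¹ :=
        luxNorm_le_lintegral_rpow hq H.powerLike ω M
    _ ≤ (K * (C * Y * ((∏ i, (k i : ℝ≥0∞) ^ (q * (P i)⁻¹)) *
          (∏ i, luxNorm (Φs i) (σ i) (f i)) ^ q))) ^ q⁻¹ := by
        gcongr
        exact hM.trans (mul_le_mul_right hprod _)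
    _ = ((K * (C * ∏ i, (k i : ℝ≥0∞) ^ (q * (P i)⁻¹))) * Y *
          (∏ i, luxNorm (Φs i) (σ i) (f i)) ^ q) ^ q⁻¹ := by
        congr 1
        ring
    _ = (K * (C * ∏ i, (k i : ℝ≥0∞) ^ (q * (P i)⁻¹))) ^ q⁻¹ * Y ^ q⁻¹ *
          ∏ i, luxNorm (Φs i) (σ i) (f i) := by
        rw [ENNReal.mul_rpow_of_nonneg _ _ hq'.le, ENNReal.mul_rpow_of_nonneg _ _ hq'.le,
          ENNReal.rpow_rpow_inv hq.ne']
    _ ≤ (K * (C * ∏ i, (k i : ℝ≥0∞) ^ (q * (P i)⁻¹))) ^ q⁻¹ *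
          ((K ^ q⁻¹ : ℝ≥0) * ext (OrliczMax.inv Ψ) Y) * ∏ i, luxNorm (Φs i) (σ i) (f i) := by
        gcongr
        exact (H.powerLike.inv hq H.surjective).le_ext hq' Y
    _ = C' * ext (OrliczMax.inv Ψ) Y * ∏ i, luxNorm (Φs i) (σ i) (f i) := by
        simp only [C']
        ring
    _ ≤ _ := by gcongr

theorem powerSetting (H : PowerGrowth p q P P' K k Φs Ψ Φ) {α : ℝ} (hα : 0 ≤ α)
    {σ : Fin n → (Fin d → ℝ) → ℝ} (hσ : ∀ i, IsWeight (σ i)) {f : Fin n → (Fin d → ℝ) → ℂ}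
    (hf : ∀ i, MemOrlicz (Φs i) (σ i) (f i)) {β : Fin d → Bool} {F : Finset (Set (Fin d → ℝ))}
    (hF : (F : Set (Set (Fin d → ℝ))) ⊆ grid β) :
    PowerSetting (n - α / d) p q P P' (fun i y => ‖(σ i y : ℂ) * f i y‖ₑ) (fun i y => ‖f i y‖ₑ)
      (fun i => weightMeasure (σ i)) β F where
  one_le := H.one_le
  le_card := sub_le_self _ (div_nonneg hα (Nat.cast_nonneg d))
  conj := H.conj
  pos := H.pos
  sum_inv := H.sum_inv
  le_exponent := H.le_exponent
  subset_grid := hF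
  measure _ hQ i := (hσ i).weightMeasure_grid (hF hQ)
  aemeasurable i := (hf i).1.enorm.mono_ac (withDensity_absolutelyContinuous _ _)
  lintegral_ne_top i := ne_top_of_le_ne_top (ENNReal.mul_ne_top ENNReal.coe_ne_top
    (ENNReal.rpow_ne_top_of_nonneg (H.exponent_factor_pos i).le (hf i).2.ne))
    (H.lintegral_rpow_weightMeasure_le hσ hf i)
  lintegral_eq _ hQ i := (hσ i).setLIntegral_enorm_mul (hf i).1 (mem_grid_volume (hF hQ)).1

/-- The testing condition on a cube that a finite constant `Y` of type `A` or `B` expresses. -/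
theorem test_le (H : PowerGrowth p q P P' K k Φs Ψ Φ) {w X Y : ℝ≥0∞} {y c : Fin n → ℝ≥0∞}
    (hY : Y ≠ ∞) (hy : ∀ i, y i ≠ 0) (hyc : ∀ i, (y i)⁻¹ ≤ c i)
    (h : w * ext Ψ X * ext Ψ (∏ i, ext (OrliczMax.inv (Φs i)) (y i)) ≤ Y) :
    w * X ^ q ≤ (K * const q P K k * Y) * ∏ i, c i ^ (q * (P i)⁻¹) := by
  have hq := H.exponent_pos
  have h1 : (w * X ^ q) * ∏ i, y i ^ (q * (P i)⁻¹) ≤ K * const q P K k * Y := by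
    calc (w * X ^ q) * ∏ i, y i ^ (q * (P i)⁻¹)
        ≤ (w * (K * ext Ψ X)) *
          (const q P K k * ext Ψ (∏ i, ext (OrliczMax.inv (Φs i)) (y i))) := by
          gcongr
          · exact H.powerLike.le_ext hq X
          · exact H.prod_rpow_le_ext y
      _ = K * const q P K k *
            (w * ext Ψ X * ext Ψ (∏ i, ext (OrliczMax.inv (Φs i)) (y i))) := by ring
      _ ≤ _ := by gcongr
  have hy' : ∀ i, y i ^ (q * (P i)⁻¹) ≠ 0 := fun i h0 =>
    hy i ((ENNReal.rpow_eq_zero_iff_of_pos (mul_pos hq (inv_pos.mpr (H.exponent_factor_pos i)))).mp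
      h0)
  have hKY : (K * const q P K k * Y : ℝ≥0∞) ≠ ∞ :=
    ENNReal.mul_ne_top (ENNReal.mul_ne_top ENNReal.coe_ne_top ENNReal.coe_ne_top) hY
  -- If `y i = ∞` for some `i`, finiteness of the right side of `h1` forces `w * X ^ q = 0`, so that
  -- dividing by the product is harmless.
  refine ((ENNReal.le_div_iff_mul_le (Or.inl (Finset.prod_ne_zero_iff.mpr fun i _ => hy' i))
    (Or.inr hKY)).mpr h1).trans ?_
  rw [div_eq_mul_inv, ENNReal.prod_inv_distrib fun i _ j _ _ => Or.inl (hy' i)]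
  gcongr with i
  rw [← ENNReal.inv_rpow]
  exact ENNReal.rpow_le_rpow (hyc i) (H.mul_inv_nonneg i)

end PowerGrowth

end OrliczMax

namespace OrliczMax

/-! ### The three weighted estimates -/

variable {d n : ℕ}

namespace PowerGrowth

variable {p q : ℝ} {P P' : Fin n → ℝ} {K : ℝ≥0} {k : Fin n → ℝ≥0}
  {Φs : Fin n → ℝ≥0 → ℝ≥0} {Ψ Φ : ℝ≥0 → ℝ≥0}

/-- The constant in the passage to grids and to sparse families. -/
def gridConst (n d : ℕ) (q : ℝ) : ℝ≥0∞ := ((12 ^ d) ^ n) ^ q * 2 ^ d * (2 ^ n) ^ q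

theorem gridConst_ne_top (n d : ℕ) {q : ℝ} (hq : 0 ≤ q) : gridConst n d q ≠ ∞ :=
  ENNReal.mul_ne_top (ENNReal.mul_ne_top (ENNReal.rpow_ne_top_of_nonneg hq
    (ENNReal.pow_ne_top (ENNReal.pow_ne_top (by norm_num)))) (ENNReal.pow_ne_top (by norm_num)))
    (ENNReal.rpow_ne_top_of_nonneg hq (ENNReal.pow_ne_top (by norm_num)))

theorem lintegral_fracMax_le (H : PowerGrowth p q P P' K k Φs Ψ Φ) (hd : 1 ≤ d) {α : ℝ}
    (hα : 0 ≤ α) (hαn : α < n * d) {ω : (Fin d → ℝ) → ℝ} (hω : IsWeight ω)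
    (f : Fin n → (Fin d → ℝ) → ℂ) {B : ℝ≥0∞}
    (hB : ∀ (β : Fin d → Bool) (F : Finset (Set (Fin d → ℝ))),
      (F : Set (Set (Fin d → ℝ))) ⊆ grid β →
        ∫⁻ x, maxOver F (cubeValue (n - α / d) fun i y => ‖f i y‖ₑ) x ^ q ∂(weightMeasure ω)
          ≤ (2 ^ n) ^ q * B) :
    ∫⁻ x, fracMax α f x ^ q * ENNReal.ofReal (ω x) ≤ gridConst n d q * B := by
  have hd0 : (0 : ℝ) < d := by exact_mod_cast hd
  have h0 : 0 ≤ (n : ℝ) - α / d := by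
    rw [sub_nonneg, div_le_iff₀ hd0]
    exact hαn.le
  refine (lintegral_fracMax_rpow_le hα h0 f hω.aemeasurable H.exponent_pos hB).trans_eq ?_
  rw [gridConst]
  ring

/-- The value of a constant `⨆ Q ∈ cubes d, …` of type `A` or `B` on the closure of a grid cube,
as a testing condition on the grid cube itself. -/
theorem test_grid_le (H : PowerGrowth p q P P' K k Φs Ψ Φ) {α : ℝ}
    {σ : Fin n → (Fin d → ℝ) → ℝ} {ω : (Fin d → ℝ) → ℝ} {β : Fin d → Bool}
    {Q Q' : Set (Fin d → ℝ)} (hQ : Q ∈ grid β) (hae : Q =ᵐ[volume] Q') {Y : ℝ≥0∞} (hY : Y ≠ ∞)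
    {y c : Fin n → ℝ≥0∞} (hy : ∀ i, y i ≠ 0) (hyc : ∀ i, (y i)⁻¹ ≤ c i)
    (h : mass ω Q' * ext Ψ (∏ i, mass (σ i) Q' / volume Q' ^ (1 - α / (n * d)))
      * ext Ψ (∏ i, ext (OrliczMax.inv (Φs i)) (y i)) ≤ Y) :
    weightMeasure ω Q * (volume Q ^ (-(n - α / d)) * ∏ i, weightMeasure (σ i) Q) ^ q
      ≤ (K * const q P K k * Y) * ∏ i, c i ^ (q * (P i)⁻¹) := by
  have h1 := H.test_le hY hy hyc h
  rw [prod_div_rpow_eq H.one_le, ← measure_congr hae, ← mass_congr ω hae,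
    ← weightMeasure_apply ω (mem_grid_volume hQ).1] at h1
  simpa only [weightMeasure_apply _ (mem_grid_volume hQ).1, mass_congr _ hae] using h1

/-- Here `cᵢ(Q)` is `|Q|` times the squared mean of `σᵢ ^ (1 / 2)`, which exceeds the inverse of the
argument of `Φᵢ⁻¹` in the constant. -/
theorem luxNorm_fracMax_le_constB (H : PowerGrowth p q P P' K k Φs Ψ Φ) (hd : 1 ≤ d) :
    ∃ C : ℝ≥0, 0 < C ∧ ∀ (α : ℝ), 0 ≤ α → α < n * d →
      ∀ (σ : Fin n → (Fin d → ℝ) → ℝ) (ω : (Fin d → ℝ) → ℝ),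
        (∀ i, IsWeight (σ i)) → IsWeight ω → constB α Φs Ψ σ ω < ∞ →
        ∀ f : Fin n → (Fin d → ℝ) → ℂ, (∀ i, MemOrlicz (Φs i) (σ i) (f i)) →
          luxNorm Ψ ω (fracMax α (fun i x => (σ i x : ℂ) * f i x))
            ≤ C * ext (OrliczMax.inv Ψ) (constB α Φs Ψ σ ω)
              * ∏ i, luxNorm (Φs i) (σ i) (f i) := by
  set e : Fin n → ℝ≥0∞ := fun i => (8 * ENNReal.ofReal (P' i) ^ P i) ^ (q * (P i)⁻¹)
  have he : ∀ i, e i ≠ ∞ := fun i => ENNReal.rpow_ne_top_of_nonneg (H.mul_inv_nonneg i)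
    (ENNReal.mul_ne_top (by norm_num)
      (ENNReal.rpow_ne_top_of_nonneg (H.exponent_factor_pos i).le ENNReal.ofReal_ne_top))
  obtain ⟨D, hD, hbound⟩ := H.exists_luxNorm_bound (d := d)
    (C := gridConst n d q * (K * const q P K k * ∏ i, e i))
    (ENNReal.mul_ne_top (gridConst_ne_top n d H.exponent_pos.le) (ENNReal.mul_ne_top
      (ENNReal.mul_ne_top ENNReal.coe_ne_top ENNReal.coe_ne_top)
      (ENNReal.prod_ne_top fun i _ => he i)))
  refine ⟨D, hD, fun α hα hαn σ ω hσ hω hfin f hf => hbound σ ω f hσ hf _ _ ?_⟩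
  set I : Fin n → ℝ≥0∞ := fun i => ∫⁻ x, ‖f i x‖ₑ ^ P i ∂(weightMeasure (σ i))
  set Y := constB α Φs Ψ σ ω
  have key := H.lintegral_fracMax_le hd hα hαn hω (fun i x => (σ i x : ℂ) * f i x)
    (B := (K * const q P K k * Y) * ∏ i, (8 * (ENNReal.ofReal (P' i) ^ P i * I i)) ^
      (q * (P i)⁻¹)) fun β F hF => by
    have HF := H.powerSetting hα hσ hf hF
    refine HF.lintegral_le_of_prod_carleson (weightMeasure ω) (A := fun _ => 8)
      (c := fun i Q => volume Q *
        ((∫⁻ y in Q, ENNReal.ofReal (σ i y) ^ (2⁻¹ : ℝ)) / volume Q) ^ (2 : ℝ))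
      (fun _ => by norm_num) (fun Q hQ => ?_) fun i S hS hsp R hR hSR => ?_
    · obtain ⟨Q', hQ', -, hae⟩ := exists_cube_of_mem_grid (hF hQ)
      obtain ⟨hv0, hvt⟩ := cubes_volume hQ'
      refine H.test_grid_le (hF hQ) hae hfin.ne
        (y := fun i => (volume Q')⁻¹ * expMeanLogInv (σ i) Q') (fun i => ?_) (fun i => ?_) ?_
      · refine mul_ne_zero (ENNReal.inv_ne_zero.mpr hvt) ?_
        unfold expMeanLogInv
        split_ifs
        · exact (ENNReal.ofReal_pos.mpr (Real.exp_pos _)).ne'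
        · exact ENNReal.top_ne_zero
      · rw [ENNReal.mul_inv (Or.inl (ENNReal.inv_ne_zero.mpr hvt))
          (Or.inl (ENNReal.inv_ne_top.mpr hv0)), inv_inv, measure_congr hae,
          setLIntegral_congr hae]
        gcongr
        exact inv_expMeanLogInv_le (hσ i) hQ'
      · exact le_iSup₂ (f := fun Q (_ : Q ∈ cubes d) => mass ω Q
          * ext Ψ (∏ i, mass (σ i) Q / volume Q ^ (1 - α / (n * d)))
          * ext Ψ (∏ i, ext (OrliczMax.inv (Φs i)) ((volume Q)⁻¹ * expMeanLogInv (σ i) Q))) Q' hQ'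
    · rw [weightMeasure_apply _ (HF.measurableSet R hR)]
      exact sum_volume_mul_sq_average_le (hσ i).aemeasurable
        ((Finset.coe_subset.mpr hS).trans hF) hsp (HF.measurableSet R hR) hSR
  refine key.trans_eq ?_
  have : ∀ i, (8 * (ENNReal.ofReal (P' i) ^ P i * I i)) ^ (q * (P i)⁻¹)
      = e i * I i ^ (q * (P i)⁻¹) := fun i => by
    rw [← mul_assoc, ENNReal.mul_rpow_of_nonneg _ _ (H.mul_inv_nonneg i)]
  simp only [this, Finset.prod_mul_distrib]
  ring

/-- The product of the powers of the `A_∞` constants is at most the sum of their `q / p`-th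
powers. -/
theorem prod_rpow_le_sum_ext (H : PowerGrowth p q P P' K k Φs Ψ Φ) (a : Fin n → ℝ≥0∞) :
    ∏ i, a i ^ (q * (P i)⁻¹)
      ≤ const q P K k * ∑ i, ext Ψ (ext (OrliczMax.inv Φ) (a i)) := by
  have hqp : 0 < q / p := div_pos H.exponent_pos H.pos
  calc ∏ i, a i ^ (q * (P i)⁻¹) = ∏ i, (a i ^ (q / p)) ^ (p * (P i)⁻¹) := by
        refine Finset.prod_congr rfl fun i _ => ?_
        rw [← ENNReal.rpow_mul, mul_comm (q / p), H.theta_mul]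
    _ ≤ ∏ i, (∑ j, a j ^ (q / p)) ^ (p * (P i)⁻¹) := by
        refine Finset.prod_le_prod' fun i _ => ENNReal.rpow_le_rpow ?_ (H.theta_nonneg i)
        exact Finset.single_le_sum (f := fun j => a j ^ (q / p)) (fun _ _ => zero_le)
          (Finset.mem_univ i)
    _ = ∑ j, a j ^ (q / p) := by
        rw [rpow_sum_of_nonneg _ _ H.theta_nonneg, H.sum_theta, ENNReal.rpow_one]
    _ ≤ ∑ j, const q P K k * ext Ψ (ext (OrliczMax.inv Φ) (a j)) :=
        Finset.sum_le_sum fun j _ => H.rpow_div_le_ext (a j)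
    _ = _ := (Finset.mul_sum _ _ _).symm

/-- Here `cᵢ(Q) = σᵢ(Q)`, a Carleson sequence with constant `2 [σᵢ]`. -/
theorem luxNorm_fracMax_le_constA (H : PowerGrowth p q P P' K k Φs Ψ Φ) (hd : 1 ≤ d) :
    ∃ C : ℝ≥0, 0 < C ∧ ∀ (α : ℝ), 0 ≤ α → α < n * d →
      ∀ (σ : Fin n → (Fin d → ℝ) → ℝ) (ω : (Fin d → ℝ) → ℝ),
        (∀ i, IsWeight (σ i)) → IsWeight ω →
        constA α Φs Ψ σ ω < ∞ → (∀ i, constAInfty (σ i) < ∞) →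
        ∀ f : Fin n → (Fin d → ℝ) → ℂ, (∀ i, MemOrlicz (Φs i) (σ i) (f i)) →
          luxNorm Ψ ω (fracMax α (fun i x => (σ i x : ℂ) * f i x))
            ≤ C * ext (OrliczMax.inv Ψ) (constA α Φs Ψ σ ω
                * ∑ i, ext Ψ (ext (OrliczMax.inv Φ) (constAInfty (σ i))))
              * ∏ i, luxNorm (Φs i) (σ i) (f i) := by
  set e : Fin n → ℝ≥0∞ := fun i => (2 * ENNReal.ofReal (P' i) ^ P i) ^ (q * (P i)⁻¹)
  have he : ∀ i, e i ≠ ∞ := fun i => ENNReal.rpow_ne_top_of_nonneg (H.mul_inv_nonneg i)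
    (ENNReal.mul_ne_top (by norm_num)
      (ENNReal.rpow_ne_top_of_nonneg (H.exponent_factor_pos i).le ENNReal.ofReal_ne_top))
  obtain ⟨D, hD, hbound⟩ := H.exists_luxNorm_bound (d := d)
    (C := gridConst n d q * (K * const q P K k * const q P K k * ∏ i, e i))
    (ENNReal.mul_ne_top (gridConst_ne_top n d H.exponent_pos.le) (ENNReal.mul_ne_top
      (ENNReal.mul_ne_top (ENNReal.mul_ne_top ENNReal.coe_ne_top ENNReal.coe_ne_top)
        ENNReal.coe_ne_top) (ENNReal.prod_ne_top fun i _ => he i)))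
  refine ⟨D, hD, fun α hα hαn σ ω hσ hω hfin hinf f hf => hbound σ ω f hσ hf _ _ ?_⟩
  set I : Fin n → ℝ≥0∞ := fun i => ∫⁻ x, ‖f i x‖ₑ ^ P i ∂(weightMeasure (σ i))
  set Y := constA α Φs Ψ σ ω
  have key := H.lintegral_fracMax_le hd hα hαn hω (fun i x => (σ i x : ℂ) * f i x)
    (B := (K * const q P K k * Y) * ∏ i, (2 * constAInfty (σ i) *
      (ENNReal.ofReal (P' i) ^ P i * I i)) ^ (q * (P i)⁻¹)) fun β F hF => by
    have HF := H.powerSetting hα hσ hf hF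
    refine HF.lintegral_le_of_prod_carleson (weightMeasure ω)
      (A := fun i => 2 * constAInfty (σ i)) (c := fun i Q => weightMeasure (σ i) Q)
      (fun i => ENNReal.mul_ne_top (by norm_num) (hinf i).ne) (fun Q hQ => ?_)
      fun i S hS hsp R hR hSR => ?_
    · obtain ⟨Q', hQ', -, hae⟩ := exists_cube_of_mem_grid (hF hQ)
      refine H.test_grid_le (hF hQ) hae hfin.ne (y := fun i => (mass (σ i) Q')⁻¹)
        (fun i => ENNReal.inv_ne_zero.mpr ((hσ i).mass_ne_top hQ')) (fun i => ?_) ?_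
      · rw [inv_inv, weightMeasure_apply _ (HF.measurableSet Q hQ), mass_congr _ hae]
      · exact le_iSup₂ (f := fun Q (_ : Q ∈ cubes d) => mass ω Q
          * ext Ψ (∏ i, mass (σ i) Q / volume Q ^ (1 - α / (n * d)))
          * ext Ψ (∏ i, ext (OrliczMax.inv (Φs i)) (mass (σ i) Q)⁻¹)) Q' hQ'
    · exact sum_weightMeasure_le_constAInfty (hσ i) ((Finset.coe_subset.mpr hS).trans hF) hsp
        (hF hR) hSR
  refine key.trans ?_
  have : ∀ i, (2 * constAInfty (σ i) * (ENNReal.ofReal (P' i) ^ P i * I i)) ^ (q * (P i)⁻¹)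
      = e i * constAInfty (σ i) ^ (q * (P i)⁻¹) * I i ^ (q * (P i)⁻¹) := fun i => by
    rw [← ENNReal.mul_rpow_of_nonneg _ _ (H.mul_inv_nonneg i),
      ← ENNReal.mul_rpow_of_nonneg _ _ (H.mul_inv_nonneg i)]
    congr 1
    ring
  simp only [this, Finset.prod_mul_distrib]
  calc gridConst n d q * ((K * const q P K k * Y) * ((∏ i, e i) *
        (∏ i, constAInfty (σ i) ^ (q * (P i)⁻¹)) * ∏ i, I i ^ (q * (P i)⁻¹)))
      ≤ gridConst n d q * ((K * const q P K k * Y) * ((∏ i, e i) *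
        (const q P K k * ∑ i, ext Ψ (ext (OrliczMax.inv Φ) (constAInfty (σ i)))) *
          ∏ i, I i ^ (q * (P i)⁻¹))) := by
        gcongr
        exact H.prod_rpow_le_sum_ext _
    _ = _ := by ring

/-! ### The estimate with the constant `W` -/

/-- The geometric mean of the weights with exponents `p / pᵢ`. -/
def geomMean (p : ℝ) (P : Fin n → ℝ) (σ : Fin n → (Fin d → ℝ) → ℝ) (x : Fin d → ℝ) : ℝ≥0∞ :=
  ∏ i, ENNReal.ofReal (σ i x) ^ (p * (P i)⁻¹)

theorem aemeasurable_geomMean {σ : Fin n → (Fin d → ℝ) → ℝ} (hσ : ∀ i, IsWeight (σ i)) :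
    AEMeasurable (geomMean p P σ) :=
  Finset.univ.aemeasurable_fun_prod fun i _ => (hσ i).aemeasurable.pow_const _

theorem setLIntegral_geomMean_ne_top (H : PowerGrowth p q P P' K k Φs Ψ Φ)
    {σ : Fin n → (Fin d → ℝ) → ℝ} (hσ : ∀ i, IsWeight (σ i)) {Q : Set (Fin d → ℝ)}
    (hQ : Q ∈ cubes d) : ∫⁻ x in Q, geomMean p P σ x ≠ ∞ :=
  ne_top_of_le_ne_top (ENNReal.prod_ne_top fun i _ =>
    ENNReal.rpow_ne_top_of_nonneg (H.theta_nonneg i) ((hσ i).mass_ne_top hQ))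
    (ENNReal.lintegral_prod_norm_pow_le Finset.univ (fun i _ => (hσ i).aemeasurable.restrict)
      H.sum_theta fun i _ => H.theta_nonneg i)

theorem setLIntegral_geomMean_ne_zero {σ : Fin n → (Fin d → ℝ) → ℝ} (hσ : ∀ i, IsWeight (σ i))
    {Q : Set (Fin d → ℝ)} (hQ : volume Q ≠ 0) : ∫⁻ x in Q, geomMean p P σ x ≠ 0 := by
  refine lintegral_ne_zero_of_ae_pos (aemeasurable_geomMean hσ) ?_ hQ
  filter_upwards [ae_all_iff.mpr fun i => (hσ i).pos] with x hx
  refine pos_iff_ne_zero.mpr (Finset.prod_ne_zero_iff.mpr fun i _ => ?_)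
  exact (ENNReal.rpow_pos (ENNReal.ofReal_pos.mpr (hx i)) ENNReal.ofReal_ne_top).ne'

/-- The function `ν` of the theorem is at most a multiple of the geometric mean of the weights. -/
theorem nu_le_geomMean (H : PowerGrowth p q P P' K k Φs Ψ Φ) {σ : Fin n → (Fin d → ℝ) → ℝ}
    {x : Fin d → ℝ} (hx : ∀ i, 0 < σ i x) :
    (nu Φ Φs σ x : ℝ≥0∞)
      ≤ ((∏ i, k i ^ (P i)⁻¹) ^ p * (∏ i, k i ^ (P i)⁻¹) ^ p : ℝ≥0) * geomMean p P σ x := by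
  set Λ : ℝ≥0 := ∏ i, k i ^ (P i)⁻¹
  set s : Fin n → ℝ≥0 := fun i => (σ i x).toNNReal
  have hs : ∀ i, 0 < s i := fun i => Real.toNNReal_pos.mpr (hx i)
  set z : ℝ≥0 := ∏ i, OrliczMax.inv (Φs i) (s i)⁻¹
  have hp := H.pos
  set a : ℝ≥0 := ∏ i, s i ^ (p * (P i)⁻¹)
  have ha : 0 < a := Finset.prod_pos fun i _ => NNReal.rpow_pos (hs i)
  have h1 : a⁻¹ ≤ Λ ^ p * Λ ^ p * Φ z := by
    have hz : ∏ i, ((s i)⁻¹) ^ (P i)⁻¹ ≤ Λ * z := by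
      rw [← Finset.prod_mul_distrib]
      exact Finset.prod_le_prod' fun i _ => ((H.powerLike_factor i).inv (H.exponent_factor_pos i)
        (H.surjective_factor i)).ge _
    calc a⁻¹ = (∏ i, ((s i)⁻¹) ^ (P i)⁻¹) ^ p := by
          rw [← NNReal.finsetProd_rpow, ← Finset.prod_inv_distrib]
          refine Finset.prod_congr rfl fun i _ => ?_
          rw [NNReal.inv_rpow, NNReal.inv_rpow, ← NNReal.rpow_mul, mul_comm]
      _ ≤ (Λ * z) ^ p := NNReal.rpow_le_rpow hz hp.le
      _ = Λ ^ p * z ^ p := NNReal.mul_rpow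
      _ ≤ Λ ^ p * (Λ ^ p * Φ z) := by
          gcongr
          exact (H.powerLike_inv.of_inv hp H.bijective).ge z
      _ = _ := by ring
  have hΦz : 0 < Φ z := by
    by_contra h0
    rw [le_antisymm (not_lt.mp h0) zero_le, mul_zero] at h1
    exact absurd h1 (not_le.mpr (inv_pos.mpr ha))
  have h2 : (Φ z)⁻¹ ≤ Λ ^ p * Λ ^ p * a := by
    rw [inv_le_iff_one_le_mul₀ hΦz]
    rw [inv_le_iff_one_le_mul₀ ha] at h1
    calc 1 ≤ Λ ^ p * Λ ^ p * Φ z * a := h1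
      _ = _ := by ring
  have h3 : geomMean p P σ x = (a : ℝ≥0∞) := by
    simp only [geomMean, a, ENNReal.ofNNReal_finsetProd]
    refine Finset.prod_congr rfl fun i _ => ?_
    rw [ENNReal.coe_rpow_of_nonneg _ (H.theta_nonneg i)]
    rfl
  rw [h3, ← ENNReal.coe_mul, ENNReal.coe_le_coe]
  exact h2

/-- Hölder's inequality for the measure whose density is the geometric mean of the weights. -/
theorem lintegral_prod_geomMean_le (H : PowerGrowth p q P P' K k Φs Ψ Φ)
    {σ : Fin n → (Fin d → ℝ) → ℝ} (hσ : ∀ i, IsWeight (σ i)) (M : Fin n → (Fin d → ℝ) → ℝ≥0∞)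
    (hM : ∀ i, Measurable (M i)) :
    ∫⁻ x, ∏ i, M i x ^ p ∂(volume.withDensity (geomMean p P σ))
      ≤ ∏ i, (∫⁻ x, M i x ^ P i ∂(weightMeasure (σ i))) ^ (p * (P i)⁻¹) := by
  rw [lintegral_withDensity_eq_lintegral_mul₀ (aemeasurable_geomMean hσ)
    (Finset.univ.measurable_fun_prod fun i _ => (hM i).pow_const _).aemeasurable]
  calc ∫⁻ x, (geomMean p P σ * fun x => ∏ i, M i x ^ p) x
      = ∫⁻ x, ∏ i, (M i x ^ P i * ENNReal.ofReal (σ i x)) ^ (p * (P i)⁻¹) := by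
        refine lintegral_congr fun x => ?_
        rw [Pi.mul_apply, geomMean, ← Finset.prod_mul_distrib]
        refine Finset.prod_congr rfl fun i _ => ?_
        rw [ENNReal.mul_rpow_of_nonneg _ _ (H.theta_nonneg i), ← ENNReal.rpow_mul, mul_comm]
        congr 2
        have := (H.exponent_factor_pos i).ne'
        field_simp
    _ ≤ ∏ i, (∫⁻ x, M i x ^ P i * ENNReal.ofReal (σ i x)) ^ (p * (P i)⁻¹) :=
        ENNReal.lintegral_prod_norm_pow_le Finset.univ
          (fun i _ => ((hM i).pow_const _).aemeasurable.mul (hσ i).aemeasurable)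
          H.sum_theta fun i _ => H.theta_nonneg i
    _ = _ := by
        refine Finset.prod_congr rfl fun i _ => ?_
        rw [(hσ i).lintegral_weightMeasure ((hM i).pow_const _).aemeasurable]

/-- The constant that relates `[σ]_W` to its version for powers. -/
def constWFactor (p q : ℝ) (P : Fin n → ℝ) (K : ℝ≥0) (k : Fin n → ℝ≥0) : ℝ≥0 :=
  const q P K k * const q P K k *
    ((∏ i, k i ^ (P i)⁻¹) ^ p * (∏ i, k i ^ (P i)⁻¹) ^ p) ^ (q / p)

/-- The finiteness of `[σ]_W` as an inequality between powers, with `ν` replaced by the geometric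
mean of the weights. -/
theorem setLIntegral_prod_hlMax_le (H : PowerGrowth p q P P' K k Φs Ψ Φ)
    {σ : Fin n → (Fin d → ℝ) → ℝ} (hσ : ∀ i, IsWeight (σ i)) {Q : Set (Fin d → ℝ)}
    (hQ : Q ∈ cubes d) :
    ∫⁻ x in Q, ∏ i, hlMax (Q.indicator (σ i)) x ^ (q * (P i)⁻¹)
      ≤ constWFactor p q P K k * constW Φ Φs Ψ σ *
        (∫⁻ x in Q, geomMean p P σ x) ^ (q / p) := by
  have hqp : 0 < q / p := div_pos H.exponent_pos H.pos
  set Λ : ℝ≥0 := (∏ i, k i ^ (P i)⁻¹) ^ p * (∏ i, k i ^ (P i)⁻¹) ^ p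
  have hΛ : (Λ : ℝ≥0∞) ≠ 0 := by
    have h1 : 0 < ∏ i, k i ^ (P i)⁻¹ := H.powerLike_inv.pos
    have : 0 < Λ := mul_pos (NNReal.rpow_pos h1) (NNReal.rpow_pos h1)
    simpa using this.ne'
  set G := ∫⁻ x in Q, geomMean p P σ x
  have hG0 : G ≠ 0 := setLIntegral_geomMean_ne_zero hσ (cubes_volume hQ).1
  have hGt : G ≠ ∞ := H.setLIntegral_geomMean_ne_top hσ hQ
  set N := ∫⁻ x in Q, (nu Φ Φs σ x : ℝ≥0∞)
  have hN : N ≤ Λ * G := by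
    rw [← lintegral_const_mul' _ _ ENNReal.coe_ne_top]
    refine lintegral_mono_ae (ae_restrict_of_ae ?_)
    filter_upwards [ae_all_iff.mpr fun i => (hσ i).pos] with x hx
    exact H.nu_le_geomMean hx
  set T := ∫⁻ x in Q, ∏ i, hlMax (Q.indicator (σ i)) x ^ (q * (P i)⁻¹)
  have hT : T ≤ const q P K k * ∫⁻ x in Q,
      ext Ψ (∏ i, ext (OrliczMax.inv (Φs i)) (hlMax (Q.indicator (σ i)) x)) := by
    rw [← lintegral_const_mul' _ _ ENNReal.coe_ne_top]
    exact lintegral_mono fun x => H.prod_rpow_le_ext _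
  have hW : ext Ψ (ext (OrliczMax.inv Φ) N⁻¹) * ∫⁻ x in Q,
      ext Ψ (∏ i, ext (OrliczMax.inv (Φs i)) (hlMax (Q.indicator (σ i)) x)) ≤ constW Φ Φs Ψ σ :=
    le_iSup₂ (f := fun Q (_ : Q ∈ cubes d) =>
      ext Ψ (ext (OrliczMax.inv Φ) (∫⁻ x in Q, (nu Φ Φs σ x : ℝ≥0∞))⁻¹) * ∫⁻ x in Q,
        ext Ψ (∏ i, ext (OrliczMax.inv (Φs i)) (hlMax (Q.indicator (σ i)) x))) Q hQ
  have h1 : ((Λ * G) ^ (q / p))⁻¹ * T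
      ≤ const q P K k * const q P K k * constW Φ Φs Ψ σ := by
    calc ((Λ * G) ^ (q / p))⁻¹ * T ≤ (N⁻¹) ^ (q / p) * T := by
          rw [← ENNReal.inv_rpow]
          gcongr
      _ ≤ (const q P K k * ext Ψ (ext (OrliczMax.inv Φ) N⁻¹)) * (const q P K k * ∫⁻ x in Q,
            ext Ψ (∏ i, ext (OrliczMax.inv (Φs i)) (hlMax (Q.indicator (σ i)) x))) :=
          mul_le_mul' (H.rpow_div_le_ext _) hT
      _ = const q P K k * const q P K k * (ext Ψ (ext (OrliczMax.inv Φ) N⁻¹) * ∫⁻ x in Q,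
            ext Ψ (∏ i, ext (OrliczMax.inv (Φs i)) (hlMax (Q.indicator (σ i)) x))) := by ring
      _ ≤ _ := by gcongr
  have hΛG0 : (Λ * G) ^ (q / p) ≠ 0 := by
    simp only [ne_eq, ENNReal.rpow_eq_zero_iff_of_pos hqp]
    exact mul_ne_zero hΛ hG0
  have hΛGt : (Λ * G) ^ (q / p) ≠ ∞ :=
    ENNReal.rpow_ne_top_of_nonneg hqp.le (ENNReal.mul_ne_top ENNReal.coe_ne_top hGt)
  rw [ENNReal.inv_mul_le_iff hΛG0 hΛGt, ENNReal.mul_rpow_of_nonneg _ _ hqp.le] at h1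
  refine h1.trans_eq ?_
  have h2 : (constWFactor p q P K k : ℝ≥0∞)
      = const q P K k * const q P K k * (Λ : ℝ≥0∞) ^ (q / p) := by
    rw [← ENNReal.coe_mul, ← ENNReal.coe_rpow_of_nonneg _ hqp.le, ← ENNReal.coe_mul]
    rfl
  rw [h2]
  ring

/-- The testing condition that the constant `Ã` expresses, on a grid cube. -/
theorem test_constATilde_le (H : PowerGrowth p q P P' K k Φs Ψ Φ) {α : ℝ}
    {σ : Fin n → (Fin d → ℝ) → ℝ} {ω : (Fin d → ℝ) → ℝ} (hσ : ∀ i, IsWeight (σ i))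
    {β : Fin d → Bool} {Q : Set (Fin d → ℝ)} (hQ : Q ∈ grid β) :
    weightMeasure ω Q * (volume Q ^ (-(n - α / d)) * ∏ i, weightMeasure (σ i) Q) ^ q
      ≤ (const q P K k * constATilde α (fun i => complementary (Φs i)) Ψ σ ω) *
        (volume Q * ∏ i, (weightMeasure (σ i) Q / volume Q) ^ (q * (P i)⁻¹)) := by
  have hq := H.exponent_pos
  obtain ⟨Q', hQ', -, hae⟩ := exists_cube_of_mem_grid hQ
  obtain ⟨hQm, hv0, hvt⟩ := mem_grid_volume hQ
  set Y := constATilde α (fun i => complementary (Φs i)) Ψ σ ω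
  set v := volume Q
  set u : Fin n → ℝ≥0∞ := fun i => weightMeasure (σ i) Q / v
  have hu0 : ∀ i, u i ≠ 0 := fun i =>
    (ENNReal.div_pos ((hσ i).weightMeasure_grid hQ).1 hvt).ne'
  have hut : ∀ i, u i ≠ ∞ := fun i => ENNReal.div_ne_top ((hσ i).weightMeasure_grid hQ).2 hv0
  have hY : (weightMeasure ω Q / v) * ext Ψ (v ^ (α / d) *
      ∏ i, ext (OrliczMax.inv (complementary (Φs i))) (u i)) ≤ Y := by
    have h1 := le_iSup₂ (f := fun Q (_ : Q ∈ cubes d) => (mass ω Q / volume Q)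
      * ext Ψ (volume Q ^ (α / d) * ∏ i, ext (OrliczMax.inv (complementary (Φs i)))
        (mass (σ i) Q / volume Q))) Q' hQ'
    simp only [← mass_congr _ hae, ← measure_congr hae, ← weightMeasure_apply _ hQm] at h1
    exact h1
  have e1 : v ^ (-(n - α / d)) * ∏ i, weightMeasure (σ i) Q = v ^ (α / d) * ∏ i, u i := by
    simp only [u, div_eq_mul_inv, Finset.prod_mul_distrib, Finset.prod_const, Finset.card_univ,
      Fintype.card_fin]
    rw [neg_sub, sub_eq_add_neg, ENNReal.rpow_add _ _ hv0 hvt, ENNReal.rpow_neg,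
      ENNReal.rpow_natCast, ENNReal.inv_pow]
    ring
  -- Split `u ^ q` by means of `1 / pᵢ' + 1 / pᵢ = 1`.
  have e2 : (∏ i, u i) ^ q = (∏ i, u i ^ (q * (P' i)⁻¹)) * ∏ i, u i ^ (q * (P i)⁻¹) := by
    rw [← ENNReal.prod_rpow_of_nonneg hq.le, ← Finset.prod_mul_distrib]
    refine Finset.prod_congr rfl fun i _ => ?_
    rw [← ENNReal.rpow_add _ _ (hu0 i) (hut i), ← mul_add, add_comm,
      (H.conj i).inv_add_inv_eq_one, mul_one]
  have e3 : weightMeasure ω Q = (weightMeasure ω Q / v) * v :=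
    (ENNReal.div_mul_cancel hv0 hvt).symm
  calc weightMeasure ω Q * (v ^ (-(n - α / d)) * ∏ i, weightMeasure (σ i) Q) ^ q
      = (weightMeasure ω Q / v) * ((v ^ (α / d)) ^ q * ∏ i, u i ^ (q * (P' i)⁻¹)) *
          (v * ∏ i, u i ^ (q * (P i)⁻¹)) := by
        rw [e1, ENNReal.mul_rpow_of_nonneg _ _ hq.le, e2]
        conv_lhs => rw [e3]
        ring
    _ ≤ (weightMeasure ω Q / v) * (const q P K k * ext Ψ (v ^ (α / d) *
          ∏ i, ext (OrliczMax.inv (complementary (Φs i))) (u i))) *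
          (v * ∏ i, u i ^ (q * (P i)⁻¹)) := by
        exact mul_le_mul_left (mul_le_mul_right
          (H.rpow_mul_prod_rpow_le_ext H.rpow_le_ext_inv_complementary _ u) _) _
    _ = const q P K k * ((weightMeasure ω Q / v) * ext Ψ (v ^ (α / d) *
          ∏ i, ext (OrliczMax.inv (complementary (Φs i))) (u i))) *
          (v * ∏ i, u i ^ (q * (P i)⁻¹)) := by ring
    _ ≤ _ := by gcongr

/-- The Carleson sequence is `|Q| ∏ᵢ (σᵢ(Q) / |Q|) ^ (q / pᵢ)`, whose terms are controlled by the
maximal functions in the constant `W`. -/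
theorem luxNorm_fracMax_le_constW (H : PowerGrowth p q P P' K k Φs Ψ Φ) (hd : 1 ≤ d) :
    ∃ C : ℝ≥0, 0 < C ∧ ∀ (α : ℝ), 0 ≤ α → α < n * d →
      ∀ (σ : Fin n → (Fin d → ℝ) → ℝ) (ω : (Fin d → ℝ) → ℝ),
        (∀ i, IsWeight (σ i)) → IsWeight ω →
        constATilde α (fun i => complementary (Φs i)) Ψ σ ω < ∞ → constW Φ Φs Ψ σ < ∞ →
        ∀ f : Fin n → (Fin d → ℝ) → ℂ, (∀ i, MemOrlicz (Φs i) (σ i) (f i)) →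
          luxNorm Ψ ω (fracMax α (fun i x => (σ i x : ℂ) * f i x))
            ≤ C * ext (OrliczMax.inv Ψ) (constW Φ Φs Ψ σ
                * constATilde α (fun i => complementary (Φs i)) Ψ σ ω)
              * ∏ i, luxNorm (Φs i) (σ i) (f i) := by
  have hqp : 0 < q / p := div_pos H.exponent_pos H.pos
  set e : Fin n → ℝ≥0∞ := fun i => (ENNReal.ofReal (P' i) ^ P i) ^ (q * (P i)⁻¹)
  have he : ∀ i, e i ≠ ∞ := fun i => ENNReal.rpow_ne_top_of_nonneg (H.mul_inv_nonneg i)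
    (ENNReal.rpow_ne_top_of_nonneg (H.exponent_factor_pos i).le ENNReal.ofReal_ne_top)
  obtain ⟨D, hD, hbound⟩ := H.exists_luxNorm_bound (d := d)
    (C := gridConst n d q * (const q P K k * ENNReal.ofReal (q / p) *
      (2 * constWFactor p q P K k) * ∏ i, e i))
    (ENNReal.mul_ne_top (gridConst_ne_top n d H.exponent_pos.le) (ENNReal.mul_ne_top
      (ENNReal.mul_ne_top (ENNReal.mul_ne_top ENNReal.coe_ne_top ENNReal.ofReal_ne_top)
        (ENNReal.mul_ne_top (by norm_num) ENNReal.coe_ne_top))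
      (ENNReal.prod_ne_top fun i _ => he i)))
  refine ⟨D, hD, fun α hα hαn σ ω hσ hω hfin hW f hf => hbound σ ω f hσ hf _ _ ?_⟩
  set I : Fin n → ℝ≥0∞ := fun i => ∫⁻ x, ‖f i x‖ₑ ^ P i ∂(weightMeasure (σ i))
  set Y := constATilde α (fun i => complementary (Φs i)) Ψ σ ω
  set W := constW Φ Φs Ψ σ
  have key := H.lintegral_fracMax_le hd hα hαn hω (fun i x => (σ i x : ℂ) * f i x)
    (B := (const q P K k * Y) * (ENNReal.ofReal (q / p) * (2 * (constWFactor p q P K k * W)) *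
      (1 * ∏ i, (ENNReal.ofReal (P' i) ^ P i * I i) ^ (p * (P i)⁻¹)) ^ (q / p)))
    fun β F hF => by
    have HF := H.powerSetting hα hσ hf hF
    refine HF.lintegral_le_of_carleson (weightMeasure ω) (volume.withDensity (geomMean p P σ))
      (c := fun Q => volume Q * ∏ i, (weightMeasure (σ i) Q / volume Q) ^ (q * (P i)⁻¹))
      (ENNReal.mul_ne_top (by norm_num) (ENNReal.mul_ne_top ENNReal.coe_ne_top hW.ne))
      ENNReal.one_ne_top (fun Q hQ => H.test_constATilde_le hσ (hF hQ))
      (fun S hS hsp R hR hSR => ?_) fun M hM => ?_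
    · obtain ⟨R', hR', hRR', hae⟩ := exists_cube_of_mem_grid (hF hR)
      have hle := hsp.sum_mul_le (fun Q hQ => (hSR Q hQ).trans hRR')
        (c := fun Q => ∏ i, (weightMeasure (σ i) Q / volume Q) ^ (q * (P i)⁻¹))
        (h := fun x => ∏ i, hlMax (R'.indicator (σ i)) x ^ (q * (P i)⁻¹))
        fun Q hQ x hx => Finset.prod_le_prod' fun i _ => ENNReal.rpow_le_rpow
          (weightMeasure_div_le_hlMax (σ i) (hF (hS hQ)) ((hSR Q hQ).trans hRR') hx)
          (H.mul_inv_nonneg i)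
      refine hle.trans ?_
      rw [withDensity_apply _ (HF.measurableSet R hR), setLIntegral_congr hae, mul_assoc]
      gcongr
      exact H.setLIntegral_prod_hlMax_le hσ hR'
    · rw [one_mul]
      exact H.lintegral_prod_geomMean_le hσ M hM
  refine key.trans_eq ?_
  have hsplit : (1 * ∏ i, (ENNReal.ofReal (P' i) ^ P i * I i) ^ (p * (P i)⁻¹)) ^ (q / p)
      = (∏ i, e i) * ∏ i, I i ^ (q * (P i)⁻¹) := by
    rw [one_mul, ← ENNReal.prod_rpow_of_nonneg hqp.le, ← Finset.prod_mul_distrib]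
    refine Finset.prod_congr rfl fun i _ => ?_
    rw [← ENNReal.rpow_mul, H.theta_mul, ENNReal.mul_rpow_of_nonneg _ _ (H.mul_inv_nonneg i)]
  rw [hsplit]
  ring

end PowerGrowth

end OrliczMax

end

theorem mainTheorem11 (n d : ℕ) (hn : 1 ≤ n) (hd : 1 ≤ d)
    (Φs : Fin n → ℝ≥0 → ℝ≥0) (Ψ Φ : ℝ≥0 → ℝ≥0)
    (hΦs : ∀ i, ClassUTilde (Φs i) ∧ Nabla2 (Φs i))
    (hΨ : ClassUTilde Ψ)
    (hΦ : Function.Bijective Φ)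
    (hΦ_inv : ∀ t, OrliczMax.inv Φ t = ∏ i, OrliczMax.inv (Φs i) t)
    (hΨΦ : MonotoneOn (fun t => Ψ t / Φ t) (Set.Ioi 0)) :
    (∃ C₁ : ℝ≥0, 0 < C₁ ∧
      ∀ (α : ℝ), 0 ≤ α → α < n * d →
      ∀ (σ : Fin n → (Fin d → ℝ) → ℝ) (ω : (Fin d → ℝ) → ℝ),
        (∀ i, IsWeight (σ i)) → IsWeight ω →
        constB α Φs Ψ σ ω < ∞ →
        ∀ f : Fin n → (Fin d → ℝ) → ℂ, (∀ i, MemOrlicz (Φs i) (σ i) (f i)) →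
          luxNorm Ψ ω (fracMax α (fun i x => (σ i x : ℂ) * f i x))
            ≤ C₁ * OrliczMax.ext (OrliczMax.inv Ψ) (constB α Φs Ψ σ ω)
              * ∏ i, luxNorm (Φs i) (σ i) (f i)) ∧
    (∃ C₂ : ℝ≥0, 0 < C₂ ∧
      ∀ (α : ℝ), 0 ≤ α → α < n * d →
      ∀ (σ : Fin n → (Fin d → ℝ) → ℝ) (ω : (Fin d → ℝ) → ℝ),
        (∀ i, IsWeight (σ i)) → IsWeight ω →
        constA α Φs Ψ σ ω < ∞ → (∀ i, constAInfty (σ i) < ∞) →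
        ∀ f : Fin n → (Fin d → ℝ) → ℂ, (∀ i, MemOrlicz (Φs i) (σ i) (f i)) →
          luxNorm Ψ ω (fracMax α (fun i x => (σ i x : ℂ) * f i x))
            ≤ C₂ * OrliczMax.ext (OrliczMax.inv Ψ) (constA α Φs Ψ σ ω
                * ∑ i, OrliczMax.ext Ψ (OrliczMax.ext (OrliczMax.inv Φ) (constAInfty (σ i))))
              * ∏ i, luxNorm (Φs i) (σ i) (f i)) ∧
    (∃ C₃ : ℝ≥0, 0 < C₃ ∧
      ∀ (α : ℝ), 0 ≤ α → α < n * d →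
      ∀ (σ : Fin n → (Fin d → ℝ) → ℝ) (ω : (Fin d → ℝ) → ℝ),
        (∀ i, IsWeight (σ i)) → IsWeight ω →
        constATilde α (fun i => complementary (Φs i)) Ψ σ ω < ∞ →
        constW Φ Φs Ψ σ < ∞ →
        ∀ f : Fin n → (Fin d → ℝ) → ℂ, (∀ i, MemOrlicz (Φs i) (σ i) (f i)) →
          luxNorm Ψ ω (fracMax α (fun i x => (σ i x : ℂ) * f i x))
            ≤ C₃ * OrliczMax.ext (OrliczMax.inv Ψ) (constW Φ Φs Ψ σ
                * constATilde α (fun i => complementary (Φs i)) Ψ σ ω)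
              * ∏ i, luxNorm (Φs i) (σ i) (f i)) := by
  obtain ⟨p, q, P, P', K, k, H⟩ := exists_powerGrowth hn hΦs hΨ hΦ hΦ_inv hΨΦ
  exact ⟨H.luxNorm_fracMax_le_constB hd, H.luxNorm_fracMax_le_constA hd,
    H.luxNorm_fracMax_le_constW hd⟩
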